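/- Conventions. A graph is a finite directed or undirected graph with $n$ vertices and nonnegative rational edge lengths. In the (point-to-point) orienteering problem one is given a graph, vertices $s,t$ and a rational time limit $T$, and one seeks an $s$-$t$ walk of total length at most $T$ that maximizes the number of distinct vertices visited. In Orient-TW (orienteering with time windows) each vertex $v$ has in addition a rational window $[R(v),D(v)]$ with $R(v)\le D(v)$; the walk starts at $s$ at time $0$, must be at $t$ by time $T$, may wait at vertices, and the objective is the number of distinct vertices $v$ at which the walk is present at some time in $[R(v),D(v)]$. $\mathrm{OPT}$ denotes the optimal value of an instance. A polynomial-time $\rho$-approximation halts on every instance in time polynomial in the (binary) input size and, on every instance that has a feasible walk, outputs a feasible walk of value at least $\mathrm{OPT}/\rho$. Let $L=L_{\max}/L_{\min}$, where $L_{\max}$ is the largest and $L_{\min}$ the smallest positive window length $D(v)-R(v)$ (and $L=1$ if all windows have length $0$). Theorem. There is an absolute constant $C>0$ such that the following holds, both for the class of directed graphs and for the class of undirected graphs. Let $\alpha(n,k)\ge 1$ be nondecreasing in $n$ and in $k$, and such that $k/\alpha(n,k)$ is nondecreasing in $k$ (for instance a constant, or a nondecreasing function of $n$ alone, or $c\,(2+\log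 k)^2$ with $c\ge 1$). If orienteering has a polynomial-time approximation algorithm with ratio $\alpha(n,\mathrm{OPT})$, then Orient-TW has a polynomial-time approximation algorithm with ratio $$C\cdot\alpha(n,\mathrm{OPT})\cdot\max\{1,\ \log \mathrm{OPT},\ \log L\},$$ where $\log\mathrm{OPT}$ is read as $0$ if $\mathrm{OPT}=0$. In particular, as $\mathrm{OPT}\le n$, the ratio is at most $C\,\alpha(n,\mathrm{OPT})\max\{1,\log n,\log L\}$. -/

import Mathlib

/-! ### Machine model: programs on trees with rational leaves, logarithmic cost -/

/-- Data handled by programs: binary trees whose leaves are `nil` or exact rational numbers. -/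
inductive Data : Type
  | nil : Data
  | num (q : ℚ) : Data
  | pair (a b : Data) : Data

namespace Data

/-- Size of a datum; numbers are measured by the bit lengths of numerator and denominator. -/
def size : Data → ℕ
  | nil => 1
  | num q => 1 + Nat.size q.num.natAbs + Nat.size q.den
  | pair a b => 1 + size a + size b

/-- Lists are represented by nested pairs ending in `nil`. -/
def list : List Data → Data
  | [] => nil
  | a :: l => pair a (list l)

/-- Truth values: `nil` is false, every other datum counts as true. -/
def ofBool (b : Bool) : Data := if b then num 1 else nil

/-- An optional number: `nil` if absent. -/
def ofOption : Option ℚ → Data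
  | none => nil
  | some q => num q

end Data

/-- The primitive operations. -/
inductive Prim : Type
  | id | fst | snd | isNil | isNum
  | add | sub | mul | div | floor | numer | denom | le

/-- Result of a primitive operation; operations applied to data of the wrong shape give `nil`. -/
def Prim.apply : Prim → Data → Data
  | .id, x => x
  | .fst, .pair a _ => a
  | .snd, .pair _ b => b
  | .isNil, .nil => Data.ofBool true
  | .isNum, .num _ => Data.ofBool true
  | .add, .pair (.num p) (.num q) => .num (p + q)
  | .sub, .pair (.num p) (.num q) => .num (p - q)
  | .mul, .pair (.num p) (.num q) => .num (p * q)
  | .div, .pair (.num p) (.num q) => .num (p / q)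
  | .floor, .num q => .num (⌊q⌋ : ℤ)
  | .numer, .num q => .num (q.num : ℤ)
  | .denom, .num q => .num (q.den : ℕ)
  | .le, .pair (.num p) (.num q) => Data.ofBool (decide (p ≤ q))
  | _, _ => .nil

/-- Programs. Each program transforms one datum into another. -/
inductive Prog : Type
  | const (d : Data) : Prog
  | prim (p : Prim) : Prog
  /-- first `f`, then `g` -/
  | seq (f g : Prog) : Prog
  /-- run `f` and `g` on the same input and pair the results -/
  | fork (f g : Prog) : Prog
  /-- if `c` then `f` else `g` -/
  | cond (c f g : Prog) : Prog
  /-- while `c` do `f` -/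
  | loop (c f : Prog) : Prog

/-- `Runs P x y t`: program `P` on input `x` halts with output `y` after `t` units of time.
Every elementary step is charged the sizes (in bits) of the data that it reads and writes, so that
running times agree with Turing machine times up to a polynomial. -/
inductive Runs : Prog → Data → Data → ℕ → Prop
  | const (d x : Data) : Runs (.const d) x d (x.size + d.size)
  | prim (p : Prim) (x : Data) : Runs (.prim p) x (p.apply x) (x.size + (p.apply x).size)
  | seq {f g : Prog} {x y z : Data} {t₁ t₂ : ℕ} :
      Runs f x y t₁ → Runs g y z t₂ → Runs (.seq f g) x z (t₁ + t₂ + 1)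
  | fork {f g : Prog} {x y z : Data} {t₁ t₂ : ℕ} :
      Runs f x y t₁ → Runs g x z t₂ →
        Runs (.fork f g) x (.pair y z) (t₁ + t₂ + x.size + (Data.pair y z).size)
  | condTrue {c f g : Prog} {x b y : Data} {t₁ t₂ : ℕ} :
      Runs c x b t₁ → b ≠ .nil → Runs f x y t₂ → Runs (.cond c f g) x y (t₁ + t₂ + x.size)
  | condFalse {c f g : Prog} {x y : Data} {t₁ t₂ : ℕ} :
      Runs c x .nil t₁ → Runs g x y t₂ → Runs (.cond c f g) x y (t₁ + t₂ + x.size)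
  | loopDone {c f : Prog} {x : Data} {t : ℕ} :
      Runs c x .nil t → Runs (.loop c f) x x (t + x.size)
  | loopStep {c f : Prog} {x b y z : Data} {t₁ t₂ t₃ : ℕ} :
      Runs c x b t₁ → b ≠ .nil → Runs f x y t₂ → Runs (.loop c f) y z t₃ →
        Runs (.loop c f) x z (t₁ + t₂ + t₃ + x.size)

/-- A program has at most one output and one running time on each input. -/
theorem Runs.deterministic {P : Prog} {x y y' : Data} {t t' : ℕ}
    (h : Runs P x y t) (h' : Runs P x y' t') : y = y' ∧ t = t' := by
  induction h generalizing y' t' with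
  | const d x => cases h'; exact ⟨rfl, rfl⟩
  | prim p x => cases h'; exact ⟨rfl, rfl⟩
  | seq _ _ ih₁ ih₂ =>
    cases h' with
    | seq a b =>
      obtain ⟨rfl, rfl⟩ := ih₁ a
      obtain ⟨rfl, rfl⟩ := ih₂ b
      exact ⟨rfl, rfl⟩
  | fork _ _ ih₁ ih₂ =>
    cases h' with
    | fork a b =>
      obtain ⟨rfl, rfl⟩ := ih₁ a
      obtain ⟨rfl, rfl⟩ := ih₂ b
      exact ⟨rfl, rfl⟩
  | condTrue _ hb _ ih₁ ih₂ =>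
    cases h' with
    | condTrue a _ b =>
      obtain ⟨rfl, rfl⟩ := ih₁ a
      obtain ⟨rfl, rfl⟩ := ih₂ b
      exact ⟨rfl, rfl⟩
    | condFalse a _ => exact absurd (ih₁ a).1 hb
  | condFalse _ _ ih₁ ih₂ =>
    cases h' with
    | condTrue a hb _ => exact absurd (ih₁ a).1.symm hb
    | condFalse a b =>
      obtain ⟨-, rfl⟩ := ih₁ a
      obtain ⟨rfl, rfl⟩ := ih₂ b
      exact ⟨rfl, rfl⟩
  | loopDone _ ih =>
    cases h' with
    | loopDone a =>
      obtain ⟨-, rfl⟩ := ih a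
      exact ⟨rfl, rfl⟩
    | loopStep a hb _ _ => exact absurd (ih a).1.symm hb
  | loopStep _ hb _ _ ih₁ ih₂ ih₃ =>
    cases h' with
    | loopDone a => exact absurd (ih₁ a).1 hb
    | loopStep a _ b c =>
      obtain ⟨rfl, rfl⟩ := ih₁ a
      obtain ⟨rfl, rfl⟩ := ih₂ b
      obtain ⟨rfl, rfl⟩ := ih₃ c
      exact ⟨rfl, rfl⟩

/-! ### Maximization problems and approximation algorithms -/

/-- A maximization problem with natural number values. -/
structure MaxProblem where
  Inst : Type
  Sol : Inst → Type
  encInst : Inst → Data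
  encSol : (I : Inst) → Sol I → Data
  Feasible : (I : Inst) → Sol I → Prop
  value : (I : Inst) → Sol I → ℕ

/-- The optimal value of an instance. For the problems below the values are bounded by the number
of vertices, so on an instance with a feasible solution this is a maximum. -/
noncomputable def MaxProblem.opt (P : MaxProblem) (I : P.Inst) : ℕ :=
  sSup {k | ∃ S, P.Feasible I S ∧ P.value I S = k}

/-- There is a polynomial-time algorithm for `P` with approximation ratio `ρ`: one program that
halts on every instance within time polynomial in the size of the encoded instance and that, on
every instance having a feasible solution, outputs a feasible solution whose value is at least
`OPT / ρ`. -/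
def MaxProblem.HasPolyTimeApprox (P : MaxProblem) (ρ : P.Inst → ℝ) : Prop :=
  ∃ (A : Prog) (p : Polynomial ℕ), ∀ I : P.Inst, ∃ (y : Data) (t : ℕ),
    Runs A (P.encInst I) y t ∧ t ≤ p.eval (P.encInst I).size ∧
    ((∃ S, P.Feasible I S) →
      ∃ S, P.Feasible I S ∧ y = P.encSol I S ∧ (P.opt I : ℝ) ≤ ρ I * (P.value I S : ℝ))

/-! ### Orienteering, without and with time windows -/

/-- A finite directed graph with vertex set `Fin n` and nonnegative rational edge lengths;
`weight u v = none` means that there is no edge from `u` to `v`. -/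
structure WGraph where
  n : ℕ
  weight : Fin n → Fin n → Option ℚ
  weight_nonneg : ∀ u v c, weight u v = some c → 0 ≤ c

/-- Directed graphs, or undirected ones (those with symmetric edge lengths). -/
inductive GraphKind : Type
  | directed
  | undirected

def GraphKind.Allows : GraphKind → WGraph → Prop
  | .directed, _ => True
  | .undirected, G => ∀ u v, G.weight u v = G.weight v u

/-- The total length of a walk, given as its list of vertices. -/
def WGraph.walkLength (G : WGraph) : List (Fin G.n) → ℚ
  | u :: v :: l => (G.weight u v).getD 0 + G.walkLength (v :: l)
  | _ => 0

/-- An orienteering instance: a graph, a start `s`, an end `t` and a time limit `T`. -/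
structure OrientInst extends WGraph where
  s : Fin n
  t : Fin n
  T : ℚ

/-- `W` is an `s`-`t` walk of length at most `T`. -/
structure OrientInst.Feasible (I : OrientInst) (W : List (Fin I.n)) : Prop where
  start : W.head? = some I.s
  finish : W.getLast? = some I.t
  edges : W.IsChain fun u v => (I.weight u v).isSome
  length_le : I.toWGraph.walkLength W ≤ I.T

/-- An instance of orienteering with time windows: vertex `v` has the window `[R v, D v]`. -/
structure TWInst extends OrientInst where
  R : Fin n → ℚ
  D : Fin n → ℚ
  window : ∀ v, R v ≤ D v

/-- `W` is an `s`-`t` walk with a time schedule: the entry `(v, τ)` says that the walk is at `v` at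
time `τ`. The walk starts at `s` at time `0` and is at `t` by time `T`; waiting is allowed. -/
structure TWInst.Feasible (I : TWInst) (W : List (Fin I.n × ℚ)) : Prop where
  start : ∃ τ, W.head? = some (I.s, τ) ∧ 0 ≤ τ
  finish : ∃ τ, W.getLast? = some (I.t, τ) ∧ τ ≤ I.T
  edges : W.IsChain fun a b => ∃ c, I.weight a.1 b.1 = some c ∧ a.2 + c ≤ b.2

/-- The number of distinct vertices that are visited during their windows. -/
def TWInst.reward (I : TWInst) (W : List (Fin I.n × ℚ)) : ℕ :=
  ((W.filter fun a => I.R a.1 ≤ a.2 ∧ a.2 ≤ I.D a.1).map Prod.fst).toFinset.card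

/-- The set of positive window lengths. -/
def TWInst.posLengths (I : TWInst) : Finset ℚ :=
  (Finset.univ.image fun v => I.D v - I.R v).filter fun l => 0 < l

/-- The ratio `L = L_max / L_min` of the longest to the shortest window length. Windows of length
zero are ignored in the minimum; if all windows have length zero, the ratio is `1`. -/
def TWInst.L (I : TWInst) : ℚ :=
  if h : I.posLengths.Nonempty then I.posLengths.max' h / I.posLengths.min' h else 1

def Data.vertex {n : ℕ} (v : Fin n) : Data := .num (v.val : ℚ)

/-- The length matrix, row by row. -/
def WGraph.enc (G : WGraph) : Data :=
  Data.list ((List.finRange G.n).map fun u =>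
    Data.list ((List.finRange G.n).map fun v => Data.ofOption (G.weight u v)))

def OrientInst.enc (I : OrientInst) : Data :=
  Data.list [.num (I.n : ℚ), I.toWGraph.enc, .vertex I.s, .vertex I.t, .num I.T]

def TWInst.enc (I : TWInst) : Data :=
  .pair I.toOrientInst.enc
    (Data.list ((List.finRange I.n).map fun v => .pair (.num (I.R v)) (.num (I.D v))))

/-- Orienteering: maximize the number of distinct vertices on an `s`-`t` walk of length at
most `T`. -/
def orienteering (κ : GraphKind) : MaxProblem where
  Inst := {I : OrientInst // κ.Allows I.toWGraph}
  Sol I := List (Fin I.1.n)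
  encInst I := I.1.enc
  encSol _ W := Data.list (W.map Data.vertex)
  Feasible I W := I.1.Feasible W
  value _ W := W.toFinset.card

/-- Orienteering with time windows. -/
def orientTW (κ : GraphKind) : MaxProblem where
  Inst := {I : TWInst // κ.Allows I.toWGraph}
  Sol I := List (Fin I.1.n × ℚ)
  encInst I := I.1.enc
  encSol _ W := Data.list (W.map fun a => .pair (.vertex a.1) (.num a.2))
  Feasible I W := I.1.Feasible W
  value I W := I.1.reward W

/-! ### Bit lengths -/

/-! Take an optimal walk and one visit inside the window for each rewarded vertex. These `k = OPT`
visits are sorted into `1 + 2J + 2H` types, with `J` about `log L` and `H` about `log OPT`. Within a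
type they fall into consecutive groups such that every visit time of a group lies in every window of
that group, and such that the deadlines (or, for other types, the release times) increase strictly
from group to group. By pigeonhole some type keeps a fraction `1/(1 + 2J + 2H)` of the visits
(`VisitType.exists_fits`, `VisitType.Fits.spec`, `TWInst.exists_isGroupChain`).

The types arise as follows. Let `μ` be the shortest positive window length and cut time into cells
of length `μ`. Windows of length zero form one type. If a window contains the cell of its visit
time, take the largest dyadic cell around that time contained in the window; its level and parity
give the type. Otherwise the window ends or begins inside the cell. Then the positions (in visiting
order) from the visit to the last one before the deadline, or from the first one after the release
time to the visit, form an interval, and the level of its most even element gives the type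
(`Nat.exists_dyadic`).

Inside a group the windows impose no order: if one waits for the latest release time and ends by the
earliest deadline, every vertex is served in time. A group is thus a plain orienteering problem on
the metric completion of the graph, restricted to vertices that meet these conditions. Seven
vertices describe a group: those with latest release, earliest deadline, least and greatest key, the
first and the last visit, and an encoded number of vertices to collect. So all descriptions can be
tried. Bisection over the budget turns the orienteering algorithm into one that collects `⌈g/α⌉`
vertices of a group of size `g` in no more time than the optimal walk spends there
(`WGraph.exists_search`).

A dynamic program strings groups together, keeping a fastest route for each key bound, position and
count. The strictly increasing keys prevent a vertex from being counted twice
(`TWInst.Sound.extend`), and dominance shows that the program matches every chain of groups up to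
the loss `α` (`TWInst.solve_of_isGroupChain`). Multiplying both losses gives the ratio
(`TWInst.solve_approx`).

Polynomial running time is proved by closure rules for `PTime`, with explicit bounds on bit lengths
and on accumulators of loops, ending in `PTime.solve`. -/

theorem Nat.size_mul_le (a b : ℕ) : Nat.size (a * b) ≤ Nat.size a + Nat.size b := by
  rw [Nat.size_le, pow_add]
  exact Nat.mul_lt_mul'' (Nat.lt_size_self a) (Nat.lt_size_self b)

theorem Nat.size_add_le (a b : ℕ) : Nat.size (a + b) ≤ max (Nat.size a) (Nat.size b) + 1 := by
  rw [Nat.size_le, pow_succ]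
  have ha := (Nat.lt_size_self a).trans_le
    (Nat.pow_le_pow_right two_pos (le_max_left a.size b.size))
  have hb := (Nat.lt_size_self b).trans_le
    (Nat.pow_le_pow_right two_pos (le_max_right a.size b.size))
  omega

/-- The larger of the bit lengths of numerator and denominator. -/
def Rat.bitLen (q : ℚ) : ℕ := max (Nat.size q.num.natAbs) (Nat.size q.den)

/-- Cancellation to lowest terms replaces numerator and denominator by divisors, so unreduced
fractions give upper bounds for all arithmetic operations. -/
theorem Rat.bitLen_div_le (a : ℤ) (b : ℕ) (hb : b ≠ 0) :
    ((a : ℚ) / b).bitLen ≤ max (Nat.size a.natAbs) (Nat.size b) := by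
  have e : ((a : ℚ) / b) = Rat.divInt a b := by rw [Rat.divInt_eq_div]; simp
  have hb' : (b : ℤ) ≠ 0 := by exact_mod_cast hb
  refine max_le_max ?_ ?_
  · rw [e]
    by_cases ha : a = 0
    · subst ha; simp
    · exact Nat.size_le_size (Nat.le_of_dvd (Int.natAbs_pos.2 ha)
        (Int.natAbs_dvd_natAbs.2 (Rat.num_dvd a hb')))
  · rw [e]
    refine Nat.size_le_size (Nat.le_of_dvd (Nat.pos_of_ne_zero hb) ?_)
    exact_mod_cast Rat.den_dvd a b

theorem Rat.bitLen_add_le (p q : ℚ) : (p + q).bitLen ≤ p.bitLen + q.bitLen + 1 := by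
  have e : p + q = ((p.num * q.den + q.num * p.den : ℤ) : ℚ) / ((p.den * q.den : ℕ) : ℚ) := by
    conv_lhs => rw [← Rat.num_div_den p, ← Rat.num_div_den q]
    have := p.den_nz
    have := q.den_nz
    push_cast
    field_simp
  rw [e]
  refine (Rat.bitLen_div_le _ _ (mul_ne_zero p.den_nz q.den_nz)).trans ?_
  refine max_le ?_ ?_
  · refine (Nat.size_le_size (Int.natAbs_add_le _ _)).trans ((Nat.size_add_le _ _).trans ?_)
    rw [Int.natAbs_mul, Int.natAbs_mul, Int.natAbs_natCast, Int.natAbs_natCast]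
    have h₁ := Nat.size_mul_le p.num.natAbs q.den
    have h₂ := Nat.size_mul_le q.num.natAbs p.den
    unfold Rat.bitLen
    omega
  · have h₁ := Nat.size_mul_le p.den q.den
    unfold Rat.bitLen
    omega

theorem Rat.bitLen_mul_le (p q : ℚ) : (p * q).bitLen ≤ p.bitLen + q.bitLen := by
  have e : p * q = ((p.num * q.num : ℤ) : ℚ) / ((p.den * q.den : ℕ) : ℚ) := by
    conv_lhs => rw [← Rat.num_div_den p, ← Rat.num_div_den q]
    push_cast
    rw [div_mul_div_comm]
  rw [e]
  refine (Rat.bitLen_div_le _ _ (mul_ne_zero p.den_nz q.den_nz)).trans ?_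
  have h₁ := Nat.size_mul_le p.num.natAbs q.num.natAbs
  have h₂ := Nat.size_mul_le p.den q.den
  rw [Int.natAbs_mul]
  unfold Rat.bitLen
  omega

theorem Rat.bitLen_neg (q : ℚ) : (-q).bitLen = q.bitLen := by simp [Rat.bitLen]

theorem Rat.bitLen_inv_le (q : ℚ) : q⁻¹.bitLen ≤ q.bitLen + 1 := by
  by_cases h : q = 0
  · subst h; simp
  have hn : q.num.natAbs ≠ 0 := by simpa using h
  have e : q⁻¹ = ((q.num.sign * q.den : ℤ) : ℚ) / (q.num.natAbs : ℚ) := by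
    conv_lhs => rw [← Rat.num_div_den q, inv_div]
    have h1 : (q.num : ℚ) = q.num.sign * q.num.natAbs := by
      conv_lhs => rw [← Int.sign_mul_natAbs q.num, Int.cast_mul, Int.cast_natCast]
    have hs : (q.num.sign : ℚ) * q.num.sign = 1 := by
      have : q.num ≠ 0 := by simpa using h
      rcases lt_or_gt_of_ne this with h' | h'
      · simp [Int.sign_eq_neg_one_of_neg h']
      · simp [Int.sign_eq_one_of_pos h']
    have hs0 : (q.num.sign : ℚ) ≠ 0 := left_ne_zero_of_mul_eq_one hs
    have hn' : (q.num.natAbs : ℚ) ≠ 0 := by exact_mod_cast hn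
    rw [h1, div_eq_div_iff (mul_ne_zero hs0 hn') hn']
    push_cast
    linear_combination (-(q.den : ℚ) * (q.num.natAbs : ℚ)) * hs
  rw [e]
  refine (Rat.bitLen_div_le _ _ hn).trans ?_
  rw [Int.natAbs_mul, Int.natAbs_natCast]
  have : q.num.sign.natAbs * q.den ≤ q.den := by
    have : q.num.sign.natAbs ≤ 1 := by rw [Int.natAbs_sign]; split_ifs <;> omega
    nlinarith
  have := Nat.size_le_size this
  unfold Rat.bitLen
  omega

theorem Rat.bitLen_intCast (a : ℤ) : (a : ℚ).bitLen = max (Nat.size a.natAbs) 1 := by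
  simp [Rat.bitLen]

theorem Rat.bitLen_natCast (a : ℕ) : (a : ℚ).bitLen = max (Nat.size a) 1 := by
  simp [Rat.bitLen]

theorem Rat.bitLen_max_le (p q : ℚ) : (max p q).bitLen ≤ max p.bitLen q.bitLen := by
  rcases max_choice p q with h | h <;> rw [h] <;> simp

theorem Rat.bitLen_floor_le (q : ℚ) : ((⌊q⌋ : ℤ) : ℚ).bitLen ≤ q.bitLen := by
  rw [Rat.bitLen_intCast]
  have h1 : 1 ≤ Nat.size q.den := by
    rw [Nat.one_le_iff_ne_zero, ← Nat.pos_iff_ne_zero, Nat.size_pos]; exact q.den_pos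
  refine max_le_max (Nat.size_le_size ?_) h1
  change q.floor.natAbs ≤ _
  rw [Rat.floor_def]
  exact Int.natAbs_ediv_le_natAbs _ _

theorem Data.size_num_le (q : ℚ) : (Data.num q).size ≤ 1 + 2 * q.bitLen := by
  simp only [Data.size, Rat.bitLen]; omega

theorem Rat.bitLen_lt_size (q : ℚ) : q.bitLen < (Data.num q).size := by
  simp only [Data.size, Rat.bitLen]; omega

theorem Data.size_ofBool_le (b : Bool) : (Data.ofBool b).size ≤ 3 := by
  cases b <;> simp [Data.ofBool, Data.size]

theorem Prim.size_apply_le (p : Prim) (x : Data) : (p.apply x).size ≤ 2 * x.size + 3 := by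
  have hb := Data.size_ofBool_le
  have hn := Data.size_num_le
  have hs := Rat.bitLen_lt_size
  unfold Prim.apply
  split
  case h_6 =>
    rename_i p q
    have := Rat.bitLen_add_le p q
    have h₁ := hn (p + q); have h₂ := hs p; have h₃ := hs q
    have : (Data.pair (.num p) (.num q)).size = 1 + (Data.num p).size + (Data.num q).size := rfl
    omega
  case h_7 =>
    rename_i p q
    have := Rat.bitLen_add_le p (-q)
    rw [← sub_eq_add_neg, Rat.bitLen_neg] at this
    have h₁ := hn (p - q); have h₂ := hs p; have h₃ := hs q
    have : (Data.pair (.num p) (.num q)).size = 1 + (Data.num p).size + (Data.num q).size := rfl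
    omega
  case h_8 =>
    rename_i p q
    have := Rat.bitLen_mul_le p q
    have h₁ := hn (p * q); have h₂ := hs p; have h₃ := hs q
    have : (Data.pair (.num p) (.num q)).size = 1 + (Data.num p).size + (Data.num q).size := rfl
    omega
  case h_9 =>
    rename_i p q
    have := Rat.bitLen_mul_le p q⁻¹
    have := Rat.bitLen_inv_le q
    rw [← div_eq_mul_inv] at *
    have h₁ := hn (p / q); have h₂ := hs p; have h₃ := hs q
    have : (Data.pair (.num p) (.num q)).size = 1 + (Data.num p).size + (Data.num q).size := rfl
    omega
  case h_10 =>
    rename_i q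
    have h₁ := Rat.bitLen_floor_le q; have h₂ := hn ⌊q⌋; have h₃ := hs q
    omega
  case h_11 =>
    rename_i q
    have h₂ := hn q.num; have h₃ := hs q
    rw [Rat.bitLen_intCast] at h₂
    have : q.num.natAbs.size ≤ q.bitLen := le_max_left _ _
    omega
  case h_12 =>
    rename_i q
    have h₂ := hn q.den; have h₃ := hs q
    rw [Rat.bitLen_natCast] at h₂
    have : q.den.size ≤ q.bitLen := le_max_right _ _
    omega
  case h_13 => exact (hb _).trans (by omega)
  all_goals
    try simp only [Data.size]
    try refine (hb _).trans ?_
    omega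

/-- Whatever is written is paid for. Hence a polynomial time bound also bounds the size of the
output, which is what makes polynomial time closed under composition. -/
theorem Runs.size_le {P : Prog} {x y : Data} {t : ℕ} (h : Runs P x y t) : y.size ≤ t := by
  induction h <;> omega

/-! ### Polynomial bounds -/

theorem Polynomial.eval_mono_nat (p : Polynomial ℕ) {m n : ℕ} (h : m ≤ n) :
    p.eval m ≤ p.eval n := by
  rw [Polynomial.eval_eq_sum_range, Polynomial.eval_eq_sum_range]
  exact Finset.sum_le_sum fun i _ => Nat.mul_le_mul_left _ (Nat.pow_le_pow_left h i)

/-- `f` is bounded by a polynomial in the size of the context `Γ`. -/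
def PolyBdd {X : Type} (Γ : X → Data) (f : X → ℕ) : Prop :=
  ∃ q : Polynomial ℕ, ∀ a, f a ≤ q.eval (Γ a).size

namespace PolyBdd

variable {X Y : Type} {Γ : X → Data} {f g : X → ℕ}

theorem mono (hg : PolyBdd Γ g) (h : ∀ a, f a ≤ g a) : PolyBdd Γ f := by
  obtain ⟨q, hq⟩ := hg
  exact ⟨q, fun a => (h a).trans (hq a)⟩

theorem const (c : ℕ) : PolyBdd Γ fun _ => c := ⟨.C c, fun a => by simp⟩

theorem size : PolyBdd Γ fun a => (Γ a).size := ⟨.X, fun a => by simp⟩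

theorem add (hf : PolyBdd Γ f) (hg : PolyBdd Γ g) : PolyBdd Γ fun a => f a + g a := by
  obtain ⟨p, hp⟩ := hf
  obtain ⟨q, hq⟩ := hg
  exact ⟨p + q, fun a => by simpa using add_le_add (hp a) (hq a)⟩

theorem mul (hf : PolyBdd Γ f) (hg : PolyBdd Γ g) : PolyBdd Γ fun a => f a * g a := by
  obtain ⟨p, hp⟩ := hf
  obtain ⟨q, hq⟩ := hg
  exact ⟨p * q, fun a => by simpa using Nat.mul_le_mul (hp a) (hq a)⟩

theorem eval (p : Polynomial ℕ) (hf : PolyBdd Γ f) : PolyBdd Γ fun a => p.eval (f a) := by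
  obtain ⟨q, hq⟩ := hf
  exact ⟨p.comp q, fun a => by simpa using p.eval_mono_nat (hq a)⟩

end PolyBdd

/-! ### Polynomial-time computability relative to a context -/

/-- Uniformly in the parameter `a`, one program computes `y a` from `Γ a` in polynomial time. -/
def PTime {X : Type} (Γ y : X → Data) : Prop :=
  ∃ (P : Prog) (p : Polynomial ℕ), ∀ a, ∃ t, Runs P (Γ a) (y a) t ∧ t ≤ p.eval (Γ a).size

namespace PTime

variable {X Y : Type} {Γ y z : X → Data}

theorem of_time {P : Prog} {f : X → ℕ} (hf : PolyBdd Γ f)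
    (h : ∀ a, ∃ t, Runs P (Γ a) (y a) t ∧ t ≤ f a) : PTime Γ y := by
  obtain ⟨q, hq⟩ := hf
  exact ⟨P, q, fun a => let ⟨t, h₁, h₂⟩ := h a; ⟨t, h₁, h₂.trans (hq a)⟩⟩

theorem size (h : PTime Γ y) : PolyBdd Γ fun a => (y a).size := by
  obtain ⟨P, p, h⟩ := h
  exact ⟨p, fun a => let ⟨t, h₁, h₂⟩ := h a; h₁.size_le.trans h₂⟩

theorem bdd (h : PTime Γ y) {f : X → ℕ} (hf : PolyBdd y f) : PolyBdd Γ f := by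
  obtain ⟨q, hq⟩ := hf
  exact (h.size.eval q).mono hq

theorem congr (h : PTime Γ y) (e : ∀ a, y a = z a) : PTime Γ z := by
  rwa [← funext e]

theorem reindex (φ : Y → X) (h : PTime Γ y) : PTime (fun b => Γ (φ b)) fun b => y (φ b) := by
  obtain ⟨P, p, h⟩ := h
  exact ⟨P, p, fun b => h _⟩

theorem const (d : Data) : PTime Γ fun _ => d :=
  of_time (PolyBdd.size.add (.const d.size)) fun _ => ⟨_, .const d _, le_rfl⟩

theorem prim (p : Prim) : PTime Γ fun a => p.apply (Γ a) :=
  of_time (PolyBdd.size.add (((PolyBdd.const 2).mul .size).add (.const 3))) fun _ =>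
    ⟨_, .prim p _, Nat.add_le_add_left (p.size_apply_le _) _⟩

theorem refl : PTime Γ Γ := prim .id

theorem trans (h : PTime Γ y) (h' : PTime y z) : PTime Γ z := by
  obtain ⟨P, p, hP⟩ := id h
  obtain ⟨Q, q, hQ⟩ := h'
  refine of_time (P := .seq P Q) (((PolyBdd.eval p .size).add (h.size.eval q)).add (.const 1))
    fun a => ?_
  obtain ⟨t, h₁, h₂⟩ := hP a
  obtain ⟨t', h₁', h₂'⟩ := hQ a
  exact ⟨_, .seq h₁ h₁', by omega⟩

theorem comp {Δ w : Y → Data} (h : PTime Δ w) (φ : X → Y) (h' : PTime Γ fun a => Δ (φ a)) :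
    PTime Γ fun a => w (φ a) := h'.trans (h.reindex φ)

theorem pair (h : PTime Γ y) (h' : PTime Γ z) : PTime Γ fun a => .pair (y a) (z a) := by
  obtain ⟨P, p, hP⟩ := id h
  obtain ⟨Q, q, hQ⟩ := id h'
  refine of_time (P := .fork P Q) ((((PolyBdd.eval p .size).add (PolyBdd.eval q .size)).add
    .size).add (((PolyBdd.const 1).add h.size).add h'.size)) fun a => ?_
  obtain ⟨t, h₁, h₂⟩ := hP a
  obtain ⟨t', h₁', h₂'⟩ := hQ a
  exact ⟨_, .fork h₁ h₁', by simp only [Data.size]; omega⟩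

theorem app (p : Prim) (h : PTime Γ y) : PTime Γ fun a => p.apply (y a) := h.trans (prim p)

theorem fst (h : PTime Γ fun a => .pair (y a) (z a)) : PTime Γ y := h.app .fst

theorem snd (h : PTime Γ fun a => .pair (y a) (z a)) : PTime Γ z := h.app .snd

/-- Weakening: a value computable from `Γ` is computable from an extended context. -/
theorem weak {B : X → Type} {e : (p : Σ a, B a) → Data} (h : PTime Γ y) :
    PTime (fun p : Σ a, B a => .pair (Γ p.1) (e p)) fun p => y p.1 :=
  (fst refl).trans (h.reindex Sigma.fst)

theorem weak₂ {B : X → Type} {C : (Σ a, B a) → Type} {e e' : (p : Σ a, C a) → Data}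
    (h : PTime Γ y) :
    PTime (fun p : Σ a, C a => .pair (.pair (Γ p.1.1) (e p)) (e' p)) fun p => y p.1.1 :=
  (fst (fst refl)).trans (h.reindex fun p : Σ a, C a => p.1.1)

theorem weak₃ {B : X → Type} {C : (Σ a, B a) → Type} {D : (Σ a, C a) → Type}
    {e e' e'' : (p : Σ a, D a) → Data} (h : PTime Γ y) :
    PTime (fun p : Σ a, D a => .pair (.pair (.pair (Γ p.1.1.1) (e p)) (e' p)) (e'' p))
      fun p => y p.1.1.1 :=
  (fst (fst (fst refl))).trans (h.reindex fun p : Σ a, D a => p.1.1.1)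

/-- The last variable of an extended context. -/
theorem last : PTime (fun a => .pair (y a) (z a)) z := snd refl

theorem num_add {p q : X → ℚ} (hp : PTime Γ fun a => .num (p a))
    (hq : PTime Γ fun a => .num (q a)) :
    PTime Γ fun a => .num (p a + q a) := (hp.pair hq).app .add

theorem num_sub {p q : X → ℚ} (hp : PTime Γ fun a => .num (p a))
    (hq : PTime Γ fun a => .num (q a)) :
    PTime Γ fun a => .num (p a - q a) := (hp.pair hq).app .sub

theorem num_mul {p q : X → ℚ} (hp : PTime Γ fun a => .num (p a))
    (hq : PTime Γ fun a => .num (q a)) :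
    PTime Γ fun a => .num (p a * q a) := (hp.pair hq).app .mul

theorem num_floor {p : X → ℚ} (hp : PTime Γ fun a => .num (p a)) :
    PTime Γ fun a => .num (⌊p a⌋ : ℤ) := hp.app .floor

theorem num_den {p : X → ℚ} (hp : PTime Γ fun a => .num (p a)) :
    PTime Γ fun a => .num ((p a).den : ℕ) := hp.app .denom

end PTime

/-! ### Decisions, conditionals and loops -/

/-- The predicate `p` can be decided from `Γ` in polynomial time. -/
def PolyDec {X : Type} (Γ : X → Data) (p : X → Prop) : Prop :=
  ∃ y, PTime Γ y ∧ ∀ a, y a ≠ .nil ↔ p a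

/-- Each branch has to be correct only on the parameters that reach it. This allows a branch to call
an algorithm that works under a promise on its input. -/
theorem PTime.cond {X : Type} {Γ c y z w : X → Data} (hc : PTime Γ c)
    (hy : PTime (X := {a // c a ≠ .nil}) (fun a => Γ a.1) fun a => y a.1)
    (hz : PTime (X := {a // c a = .nil}) (fun a => Γ a.1) fun a => z a.1)
    (h₁ : ∀ a, c a ≠ .nil → w a = y a) (h₂ : ∀ a, c a = .nil → w a = z a) : PTime Γ w := by
  obtain ⟨P, p, hP⟩ := hc
  obtain ⟨Q, q, hQ⟩ := hy
  obtain ⟨R, r, hR⟩ := hz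
  refine of_time (P := .cond P Q R) (((PolyBdd.eval p .size).add
    ((PolyBdd.eval q .size).add (PolyBdd.eval r .size))).add .size) fun a => ?_
  obtain ⟨t, ht, ht'⟩ := hP a
  by_cases h : c a = .nil
  · obtain ⟨t₂, ht₂, ht₂'⟩ := hR ⟨a, h⟩
    rw [h₂ a h]
    rw [h] at ht
    exact ⟨_, .condFalse ht ht₂, by simp only at ht₂' ⊢; omega⟩
  · obtain ⟨t₂, ht₂, ht₂'⟩ := hQ ⟨a, h⟩
    rw [h₁ a h]
    exact ⟨_, .condTrue ht h ht₂, by simp only at ht₂' ⊢; omega⟩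

namespace PolyDec

variable {X Y : Type} {Γ y z : X → Data} {p q : X → Prop}

theorem truthy (h : PTime Γ y) : PolyDec Γ fun a => y a ≠ .nil := ⟨y, h, fun _ => Iff.rfl⟩

theorem congr (h : PolyDec Γ p) (e : ∀ a, p a ↔ q a) : PolyDec Γ q := by
  obtain ⟨y, hy, h⟩ := h
  exact ⟨y, hy, fun a => (h a).trans (e a)⟩

theorem dite (h : PolyDec Γ p) {w : X → Data}
    (hy : PTime (X := {a // p a}) (fun a => Γ a.1) fun a => y a.1)
    (hz : PTime (X := {a // ¬ p a}) (fun a => Γ a.1) fun a => z a.1)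
    (h₁ : ∀ a, p a → w a = y a) (h₂ : ∀ a, ¬ p a → w a = z a) : PTime Γ w := by
  obtain ⟨c, hc, h⟩ := h
  refine hc.cond (y := y) (z := z) ?_ ?_ (fun a ha => h₁ a ((h a).1 ha)) fun a ha => h₂ a ?_
  · exact hy.reindex (Y := {a // c a ≠ .nil}) fun a => ⟨a.1, (h a.1).1 a.2⟩
  · exact hz.reindex (Y := {a // c a = .nil}) fun a => ⟨a.1, fun h' => (h a.1).2 h' a.2⟩
  · exact fun h' => (h a).2 h' ha

theorem ite {β : X → Type} {E : ∀ a, β a → Data} {f g : ∀ a, β a} [DecidablePred p]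
    (h : PolyDec Γ p) (hf : PTime Γ fun a => E a (f a)) (hg : PTime Γ fun a => E a (g a)) :
    PTime Γ fun a => E a (if p a then f a else g a) :=
  h.dite (y := fun a => E a (f a)) (z := fun a => E a (g a)) (hf.reindex Subtype.val)
    (hg.reindex Subtype.val) (fun a ha => by simp [ha])
    fun a ha => by simp [ha]

theorem le {f g : X → ℚ} (hf : PTime Γ fun a => .num (f a)) (hg : PTime Γ fun a => .num (g a)) :
    PolyDec Γ fun a => f a ≤ g a := by
  refine ⟨_, (hf.pair hg).app .le, fun a => ?_⟩
  by_cases h : f a ≤ g a <;> simp [Prim.apply, Data.ofBool, h]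

theorem not (h : PolyDec Γ p) : PolyDec Γ fun a => ¬ p a := by
  obtain ⟨y, hy, h⟩ := h
  refine ⟨_, hy.app .isNil, fun a => ?_⟩
  simp only [← h]
  cases y a <;> simp [Prim.apply, Data.ofBool]

theorem and (h : PolyDec Γ p) (h' : PolyDec Γ q) : PolyDec Γ fun a => p a ∧ q a := by
  classical
  obtain ⟨y, hy, h'⟩ := h'
  refine ⟨_, h.ite (E := fun _ d => d) hy (.const .nil), fun a => ?_⟩
  by_cases hp : p a <;> simp [hp, ← h']

theorem lt {f g : X → ℚ} (hf : PTime Γ fun a => .num (f a)) (hg : PTime Γ fun a => .num (g a)) :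
    PolyDec Γ fun a => f a < g a := (le hg hf).not.congr fun _ => not_le

theorem eq {f g : X → ℚ} (hf : PTime Γ fun a => .num (f a)) (hg : PTime Γ fun a => .num (g a)) :
    PolyDec Γ fun a => f a = g a := ((le hf hg).and (le hg hf)).congr fun _ => le_antisymm_iff.symm

theorem vertex_eq {n : X → ℕ} {u v : ∀ a, Fin (n a)} (hu : PTime Γ fun a => .vertex (u a))
    (hv : PTime Γ fun a => .vertex (v a)) : PolyDec Γ fun a => u a = v a :=
  (eq hu hv).congr fun a => by rw [Nat.cast_inj, Fin.ext_iff]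

end PolyDec

theorem PTime.num_max {X : Type} {Γ : X → Data} {p q : X → ℚ} (hp : PTime Γ fun a => .num (p a))
    (hq : PTime Γ fun a => .num (q a)) : PTime Γ fun a => .num (max (p a) (q a)) :=
  ((PolyDec.le hp hq).ite (E := fun _ => Data.num) hq hp).congr fun a => by rw [max_def]

/-- Iterating a polynomial-time step polynomially often, as long as the iterates stay small. -/
theorem PTime.iterate {X : Type} {σ : X → ℕ → Data} {K : X → ℕ} {c : (Σ a, Fin (K a + 1)) → Data}
    (hc : PTime (X := Σ a, Fin (K a + 1)) (fun p => σ p.1 p.2) c)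
    (hs : PTime (X := Σ a, Fin (K a)) (fun p => σ p.1 p.2) fun p => σ p.1 (p.2 + 1))
    (hlt : ∀ a (i : Fin (K a)), c ⟨a, i.castSucc⟩ ≠ .nil)
    (hend : ∀ a, c ⟨a, Fin.last _⟩ = .nil)
    (hK : PolyBdd (fun a => σ a 0) K) {M : X → ℕ} (hM : PolyBdd (fun a => σ a 0) M)
    (hb : ∀ a i, i ≤ K a → (σ a i).size ≤ M a) :
    PTime (fun a => σ a 0) fun a => σ a (K a) := by
  obtain ⟨P, p, hP⟩ := hc
  obtain ⟨Q, q, hQ⟩ := hs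
  -- Each of the `K a + 1` evaluations of the test costs at most `p(M)`, each step at most `q(M)`,
  -- and the loop itself charges the size of its state, at most `M`.
  refine of_time (P := .loop P Q) (f := fun a => (K a + 1) * (p.eval (M a) + q.eval (M a) + M a))
    ((hK.add (.const 1)).mul (((hM.eval p).add (hM.eval q)).add hM)) fun a => ?_
  suffices H : ∀ j i, i + j = K a → ∃ t, Runs (.loop P Q) (σ a i) (σ a (K a)) t ∧
      t ≤ (j + 1) * (p.eval (M a) + q.eval (M a) + M a) from H (K a) 0 (by omega)
  intro j
  induction j with
  | zero =>
    intro i hi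
    obtain rfl : i = K a := by omega
    obtain ⟨t, ht, ht'⟩ := hP ⟨a, Fin.last _⟩
    simp only [hend, Fin.val_last] at ht ht'
    have hh := hb a (K a) le_rfl
    have := p.eval_mono_nat hh
    exact ⟨_, .loopDone ht, by omega⟩
  | succ j ih =>
    intro i hi
    obtain ⟨t, ht, ht'⟩ := hP ⟨a, (⟨i, by omega⟩ : Fin (K a)).castSucc⟩
    obtain ⟨t₂, ht₂, ht₂'⟩ := hQ ⟨a, ⟨i, by omega⟩⟩
    obtain ⟨t₃, ht₃, ht₃'⟩ := ih (i + 1) (by omega)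
    simp only [Fin.val_castSucc] at ht ht' ht₂ ht₂'
    have hh := hb a i (by omega)
    have h₁ := p.eval_mono_nat hh
    have h₂ := q.eval_mono_nat hh
    refine ⟨_, .loopStep ht (hlt a _) ht₂ ht₃, ?_⟩
    rw [add_mul (j + 1) 1]
    omega

/-! ### Lists -/

/-- The list `l` with its entries encoded by `e`. -/
def Data.listOf {β : Type} (e : β → Data) (l : List β) : Data := Data.list (l.map e)

namespace Data

variable {β : Type} {e : β → Data}

@[simp] theorem listOf_nil : listOf e [] = .nil := rfl

@[simp] theorem listOf_cons (b : β) (l : List β) : listOf e (b :: l) = .pair (e b) (listOf e l) :=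
  rfl

theorem listOf_ne_nil (l : List β) : listOf e l ≠ .nil ↔ l ≠ [] := by cases l <;> simp

theorem listOf_map {γ : Type} (g : γ → β) (l : List γ) :
    listOf e (l.map g) = listOf (fun c => e (g c)) l := by simp [listOf, Function.comp_def]

theorem size_listOf_append (l l' : List β) :
    (listOf e (l ++ l')).size + 1 = (listOf e l).size + (listOf e l').size := by
  induction l with
  | nil => simp [size]; omega
  | cons b l ih => simp only [List.cons_append, listOf_cons, size]; omega

theorem length_lt_size (l : List β) : l.length < (listOf e l).size := by
  induction l with
  | nil => simp [size]
  | cons b l ih => simp only [List.length_cons, listOf_cons, size]; omega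

theorem size_lt_of_mem {l : List β} {b : β} (h : b ∈ l) : (e b).size < (listOf e l).size := by
  induction l with
  | nil => simp at h
  | cons c l ih =>
    simp only [listOf_cons, size]
    rcases List.mem_cons.1 h with rfl | h
    · omega
    · have := ih h; omega

theorem size_listOf_le_of_sublist {l l' : List β} (h : l.Sublist l') :
    (listOf e l).size ≤ (listOf e l').size := by
  induction h with
  | slnil => exact le_rfl
  | cons b _ ih => simp only [listOf_cons, size]; omega
  | cons_cons b _ ih => simp only [listOf_cons, size]; omega

theorem size_listOf_le {l : List β} {M : ℕ} (h : ∀ b ∈ l, (e b).size ≤ M) :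
    (listOf e l).size ≤ 1 + l.length * (1 + M) := by
  induction l with
  | nil => simp [size]
  | cons b l ih =>
    have h₁ := h b (by simp)
    have h₂ := ih fun c hc => h c (by simp [hc])
    simp only [listOf_cons, size, List.length_cons, Nat.add_mul]
    omega

theorem size_foldl_le {σ : Type} {es : σ → Data} {f : σ → β → σ} {N : ℕ} (s : σ) (l : List β)
    (h : ∀ s, ∀ b ∈ l, (es (f s b)).size ≤ (es s).size + N) :
    (es (l.foldl f s)).size ≤ (es s).size + l.length * N := by
  induction l generalizing s with
  | nil => simp
  | cons b l ih =>
    have h₁ := h s b (by simp)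
    have h₂ := ih (f s b) fun s c hc => h s c (by simp [hc])
    simp only [List.foldl_cons, List.length_cons, Nat.add_mul]
    omega

end Data

open Data (listOf)

namespace PTime

variable {X : Type} {Γ s b : X → Data}

theorem acc : PTime (fun p => .pair (Γ p) (.pair (s p) (b p))) s := fst (snd refl)

theorem elt : PTime (fun p => .pair (Γ p) (.pair (s p) (b p))) b := snd (snd refl)

end PTime

theorem PolyDec.ne_nil {X : Type} {B : X → Type} {Γ : X → Data} {e : ∀ a, B a → Data}
    {l : ∀ a, List (B a)} (h : PTime Γ fun a => listOf (e a) (l a)) :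
    PolyDec Γ fun a => l a ≠ [] :=
  (PolyDec.truthy h).congr fun _ => Data.listOf_ne_nil _

namespace PTime

variable {X : Type} {B C S : X → Type} {Γ : X → Data} {e : ∀ a, B a → Data}
  {e' : ∀ a, C a → Data} {l l' : ∀ a, List (B a)}

theorem length (h : PTime Γ fun a => listOf (e a) (l a)) : PolyBdd Γ fun a => (l a).length :=
  h.size.mono fun _ => (Data.length_lt_size _).le

/-- Folding over a list takes polynomial time if the accumulator stays small. -/
theorem foldl {es : ∀ a, S a → Data} {s₀ : ∀ a, S a} {f : ∀ a, S a → B a → S a}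
    (hl : PTime Γ fun a => listOf (e a) (l a)) (hi : PTime Γ fun a => es a (s₀ a))
    (hf : PTime (X := Σ a, S a × B a)
      (fun p => .pair (Γ p.1) (.pair (es p.1 p.2.1) (e p.1 p.2.2)))
      fun p => es p.1 (f p.1 p.2.1 p.2.2))
    {M : X → ℕ} (hM : PolyBdd Γ M)
    (hb : ∀ a pre, pre <+: l a → (es a (pre.foldl (f a) (s₀ a))).size ≤ M a) :
    PTime Γ fun a => es a ((l a).foldl (f a) (s₀ a)) := by
  -- The loop state consists of the context, the accumulator after `i` entries and the unread rest
  -- of the list; an empty rest ends the loop.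
  let σ : X → ℕ → Data := fun a i => .pair (Γ a) (.pair (es a (((l a).take i).foldl (f a) (s₀ a)))
    (listOf (e a) ((l a).drop i)))
  have h0 : PTime Γ fun a => σ a 0 := refl.pair (hi.pair (hl.congr fun a => by simp))
  have hΓ : PTime (fun a => σ a 0) Γ := fst refl
  have hl0 : PTime (fun a => σ a 0) fun a => listOf (e a) (l a) :=
    (snd (snd refl : PTime (fun a => σ a 0) _)).congr fun a => by simp
  have key : PTime (fun a => σ a 0) fun a => σ a (l a).length := by
    refine PTime.iterate (σ := σ) (K := fun a => (l a).length)
      (c := fun p => listOf (e p.1) ((l p.1).drop p.2)) ?_ ?_ ?_ ?_ hl0.length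
      (M := fun a => 2 + (Γ a).size + M a + (listOf (e a) (l a)).size) ?_ ?_
    · exact snd (snd refl)
    · have hd : ∀ (a : X) (i : Fin (l a).length),
          (l a).drop i = (l a)[i] :: (l a).drop (i + 1) := fun a i => by simp
      have H : PTime (X := Σ a, Fin (l a).length) (fun p => σ p.1 p.2) fun p =>
          .pair (Γ p.1) (.pair (es p.1 (((l p.1).take p.2).foldl (f p.1) (s₀ p.1)))
            (.pair (e p.1 (l p.1)[p.2]) (listOf (e p.1) ((l p.1).drop (p.2 + 1))))) :=
        refl.congr fun p => by simp only [σ, hd, Data.listOf_cons]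
      refine (fst H).pair (((((fst H).pair ((fst (snd H)).pair (fst (snd (snd H))))).trans
        (hf.reindex fun p : Σ a, Fin (l a).length =>
          ⟨p.1, (((l p.1).take p.2).foldl (f p.1) (s₀ p.1), (l p.1)[p.2])⟩)).congr
        fun p => ?_).pair (snd (snd (snd H))))
      rw [List.take_add_one, List.getElem?_eq_getElem p.2.isLt, Option.toList_some,
        List.foldl_append]
      rfl
    · intro a i
      rw [Data.listOf_ne_nil]
      simp
    · intro a
      simp
    · exact (((PolyBdd.const 2).add hΓ.size).add (hΓ.bdd hM)).add hl0.size
    · intro a i _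
      have h₁ := hb a _ ⟨_, List.take_append_drop i (l a)⟩
      have h₂ := Data.size_listOf_le_of_sublist (e := e a) (List.drop_sublist i (l a))
      simp only [σ, Data.size]
      omega
  exact (fst (snd (h0.trans key))).congr fun a => by simp

/-- A polynomial-time step could still double the accumulator each time. If each step adds at most
`N`, the accumulator stays polynomial. -/
theorem foldl_additive {es : ∀ a, S a → Data} {s₀ : ∀ a, S a} {f : ∀ a, S a → B a → S a}
    (hl : PTime Γ fun a => listOf (e a) (l a)) (hi : PTime Γ fun a => es a (s₀ a))
    (hf : PTime (X := Σ a, S a × B a)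
      (fun p => .pair (Γ p.1) (.pair (es p.1 p.2.1) (e p.1 p.2.2)))
      fun p => es p.1 (f p.1 p.2.1 p.2.2))
    {N : X → ℕ} (hN : PolyBdd Γ N)
    (hb : ∀ a s, ∀ b ∈ l a, (es a (f a s b)).size ≤ (es a s).size + N a) :
    PTime Γ fun a => es a ((l a).foldl (f a) (s₀ a)) := by
  refine foldl hl hi hf (M := fun a => (es a (s₀ a)).size + (l a).length * N a)
    (hi.size.add (hl.length.mul hN)) fun a pre hpre => ?_
  refine (Data.size_foldl_le _ _ fun s b hb' => hb a s b (hpre.subset hb')).trans ?_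
  exact Nat.add_le_add_left (Nat.mul_le_mul_right _ hpre.length_le) _

theorem nil : PTime Γ fun a => listOf (e a) [] := const .nil

theorem cons {b : ∀ a, B a} (hb : PTime Γ fun a => e a (b a))
    (hl : PTime Γ fun a => listOf (e a) (l a)) : PTime Γ fun a => listOf (e a) (b a :: l a) :=
  hb.pair hl

theorem singleton {b : ∀ a, B a} (hb : PTime Γ fun a => e a (b a)) :
    PTime Γ fun a => listOf (e a) [b a] := cons hb nil

theorem reverseAux (hl : PTime Γ fun a => listOf (e a) (l a))
    (hl' : PTime Γ fun a => listOf (e a) (l' a)) :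
    PTime Γ fun a => listOf (e a) ((l a).reverse ++ l' a) := by
  refine (foldl_additive (S := fun a => List (B a)) (es := fun a => listOf (e a)) (s₀ := l')
    (f := fun a s b => b :: s) hl hl' (cons elt acc)
    (N := fun a => 1 + (listOf (e a) (l a)).size) ((PolyBdd.const 1).add hl.size) ?_).congr ?_
  · intro a s b hb
    have := Data.size_lt_of_mem (e := e a) hb
    simp only [Data.listOf_cons, Data.size]
    omega
  · intro a
    rw [List.foldl_flip_cons_eq_append, List.map_id']

theorem reverse (hl : PTime Γ fun a => listOf (e a) (l a)) :
    PTime Γ fun a => listOf (e a) (l a).reverse := (reverseAux hl nil).congr fun a => by simp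

theorem append (hl : PTime Γ fun a => listOf (e a) (l a))
    (hl' : PTime Γ fun a => listOf (e a) (l' a)) :
    PTime Γ fun a => listOf (e a) (l a ++ l' a) := (reverseAux hl.reverse hl').congr fun a => by simp

theorem foldr {es : ∀ a, S a → Data} {s₀ : ∀ a, S a} {f : ∀ a, B a → S a → S a}
    (hl : PTime Γ fun a => listOf (e a) (l a)) (hi : PTime Γ fun a => es a (s₀ a))
    (hf : PTime (X := Σ a, S a × B a)
      (fun p => .pair (Γ p.1) (.pair (es p.1 p.2.1) (e p.1 p.2.2)))
      fun p => es p.1 (f p.1 p.2.2 p.2.1))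
    {M : X → ℕ} (hM : PolyBdd Γ M)
    (hb : ∀ a suf, suf <:+ l a → (es a (suf.foldr (f a) (s₀ a))).size ≤ M a) :
    PTime Γ fun a => es a ((l a).foldr (f a) (s₀ a)) := by
  refine (foldl hl.reverse hi (f := fun a s b => f a b s) hf hM fun a pre hpre => ?_).congr
    fun a => by rw [List.foldl_reverse]
  obtain ⟨post, hpost⟩ := hpre
  have := hb a pre.reverse ⟨post.reverse, by
    rw [← List.reverse_append, hpost, List.reverse_reverse]⟩
  rwa [List.foldr_reverse] at this

theorem flatMap {f : ∀ a, B a → List (C a)} (hl : PTime Γ fun a => listOf (e a) (l a))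
    (hf : PTime (X := Σ a, B a) (fun p => .pair (Γ p.1) (e p.1 p.2))
      fun p => listOf (e' p.1) (f p.1 p.2)) :
    PTime Γ fun a => listOf (e' a) ((l a).flatMap (f a)) := by
  obtain ⟨q, hq⟩ := hf.size
  refine (foldl_additive (S := fun a => List (C a)) (es := fun a => listOf (e' a))
    (s₀ := fun a => []) (f := fun a s b => f a b ++ s) hl.reverse nil
    (append ((refl.weak.pair elt).trans (hf.reindex
      fun p : Σ a, List (C a) × B a => ⟨p.1, p.2.2⟩)) acc)
    (N := fun a => q.eval (1 + (Γ a).size + (listOf (e a) (l a)).size))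
    ((((PolyBdd.const 1).add .size).add hl.size).eval q) ?_).congr ?_
  · intro a s b hb
    have h₁ := Data.size_listOf_append (e := e' a) (f a b) s
    have h₂ := hq ⟨a, b⟩
    have h₃ := Data.size_lt_of_mem (e := e a) (List.mem_reverse.1 hb)
    have h₄ := q.eval_mono_nat (show (Data.pair (Γ a) (e a b)).size ≤
      1 + (Γ a).size + (listOf (e a) (l a)).size by simp only [Data.size]; omega)
    simp only at h₂
    omega
  · intro a
    rw [List.foldl_reverse]
    induction l a with
    | nil => rfl
    | cons b l ih =>
      rw [List.foldr_cons, List.flatMap_cons, Data.listOf, List.map_append]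
      rw [Data.listOf, Data.listOf] at ih
      rw [Data.listOf, List.map_append]
      congr 2
      -- The induction hypothesis equates encodings; the encoded lists are recovered from it by
      -- injectivity.
      have inj : Function.Injective Data.list := by
        intro l₁
        induction l₁ with
        | nil => intro l₂ h; cases l₂ <;> simp_all [Data.list]
        | cons b l ih =>
          intro l₂ h
          cases l₂ with
          | nil => simp [Data.list] at h
          | cons c l₂ => simp only [Data.list, Data.pair.injEq] at h; rw [h.1, ih h.2]
      exact inj ih

theorem map {y : (Σ a, B a) → Data} (hl : PTime Γ fun a => listOf (e a) (l a))
    (hf : PTime (X := Σ a, B a) (fun p => .pair (Γ p.1) (e p.1 p.2)) y) :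
    PTime Γ fun a => listOf (fun b => y ⟨a, b⟩) (l a) :=
  (flatMap (C := B) (f := fun _ b => [b]) (e' := fun a b => y ⟨a, b⟩) hl (singleton hf)).congr
    fun a => by simp

theorem map' {f : ∀ a, B a → C a} (hl : PTime Γ fun a => listOf (e a) (l a))
    (hf : PTime (X := Σ a, B a) (fun p => .pair (Γ p.1) (e p.1 p.2)) fun p => e' p.1 (f p.1 p.2)) :
    PTime Γ fun a => listOf (e' a) ((l a).map (f a)) :=
  (map hl hf).congr fun a => (Data.listOf_map (e := e' a) (f a) (l a)).symm

theorem filter {p : ∀ a, B a → Prop} [∀ a, DecidablePred (p a)]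
    (hl : PTime Γ fun a => listOf (e a) (l a))
    (hp : PolyDec (X := Σ a, B a) (fun p => .pair (Γ p.1) (e p.1 p.2)) fun b => p b.1 b.2) :
    PTime Γ fun a => listOf (e a) ((l a).filter (p a ·)) := by
  refine (flatMap (f := fun a b => if p a b then [b] else []) (e' := e) hl
    (hp.ite (E := fun p => listOf (e p.1)) (singleton (B := fun p : Σ a, B a => B p.1) (e := fun p => e p.1) last)
      (nil (e := fun p : Σ a, B a => e p.1)))).congr fun a => ?_
  congr 1
  induction l a with
  | nil => rfl
  | cons b l ih => by_cases h : p a b <;> simp [h, ih]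

theorem product {l₂ : ∀ a, List (C a)} (hl : PTime Γ fun a => listOf (e a) (l a))
    (hl₂ : PTime Γ fun a => listOf (e' a) (l₂ a)) :
    PTime Γ fun a => listOf (fun b : B a × C a => .pair (e a b.1) (e' a b.2)) (l a ×ˢ l₂ a) := by
  refine flatMap (C := fun a => B a × C a) (f := fun a b => (l₂ a).map (Prod.mk b))
    (e' := fun a b => .pair (e a b.1) (e' a b.2)) hl ?_
  have hb : PTime (X := Σ a, B a) (fun p => .pair (Γ p.1) (e p.1 p.2)) fun p => e p.1 p.2 := last
  refine (map (B := fun p : Σ a, B a => C p.1) (y := fun p => .pair (e p.1.1 p.1.2) (e' p.1.1 p.2))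
    hl₂.weak (hb.weak.pair last)).congr fun p => ?_
  rw [Data.listOf_map]

/-- Partial results are lists with at most one entry, and `flatMap` is their bind. `take 1` gives
the head in this form. -/
theorem take_one (hl : PTime Γ fun a => listOf (e a) (l a)) :
    PTime Γ fun a => listOf (e a) ((l a).take 1) := by
  classical
  refine ((PolyDec.ne_nil hl).ite (E := fun _ d => d) ((hl.app .fst).pair (.const .nil))
    (.const .nil)).congr fun a => ?_
  cases l a <;> simp [Prim.apply]

theorem drop_one (hl : PTime Γ fun a => listOf (e a) (l a)) :
    PTime Γ fun a => listOf (e a) ((l a).drop 1) := by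
  refine (hl.app .snd).congr fun a => ?_
  cases l a <;> simp [Prim.apply]

theorem head? {l : X → List ℚ} (hl : PTime Γ fun a => listOf .num (l a)) :
    PTime Γ fun a => .ofOption (l a).head? := by
  refine (hl.app .fst).congr fun a => ?_
  cases l a <;> simp [Prim.apply, Data.ofOption]

theorem toList {o : X → Option ℚ} (h : PTime Γ fun a => .ofOption (o a)) :
    PTime Γ fun a => listOf .num (o a).toList := by
  classical
  refine ((PolyDec.truthy h).ite (E := fun _ d => d) (h.pair (.const .nil))
    (.const .nil)).congr fun a => ?_
  cases o a <;> simp [Data.ofOption]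

theorem getD {o : X → Option ℚ} (h : PTime Γ fun a => .ofOption (o a)) :
    PTime Γ fun a => .num ((o a).getD 0) := by
  classical
  refine ((PolyDec.truthy h).ite (E := fun _ d => d) h (.const (.num 0))).congr fun a => ?_
  cases o a <;> simp [Data.ofOption]

theorem tails (hl : PTime Γ fun a => listOf (e a) (l a)) :
    PTime Γ fun a => listOf (listOf (e a)) (l a).tails := by
  -- The head of the accumulator is always the suffix read so far, so one right fold produces all
  -- suffixes.
  have ht : ∀ (a : X) (l : List (B a)),
      l.foldr (fun b s => (b :: s.headD []) :: s) [[]] = l.tails := fun a l => by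
    induction l with
    | nil => rfl
    | cons b l ih =>
      rw [List.foldr_cons, ih, List.tails_cons]
      cases l <;> simp
  refine (foldr (S := fun a => List (List (B a))) (es := fun a => listOf (listOf (e a)))
    (s₀ := fun a => [[]]) (f := fun a b s => (b :: s.headD []) :: s) hl (singleton nil)
    (cons (cons elt ?_) acc)
    (M := fun a => 1 + ((l a).length + 1) * (1 + (listOf (e a) (l a)).size))
    ((PolyBdd.const 1).add ((hl.length.add (.const 1)).mul ((PolyBdd.const 1).add hl.size)))
    ?_).congr fun a => by rw [ht]
  · refine (acc.app .fst).congr fun p => ?_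
    rcases p with ⟨a, s, b⟩
    cases s <;> simp [Prim.apply]
  · intro a suf hsuf
    rw [ht]
    refine (Data.size_listOf_le fun t h =>
      Data.size_listOf_le_of_sublist (e := e a) (((List.mem_tails _ _).1 h).trans hsuf).sublist).trans ?_
    rw [List.length_tails]
    have := hsuf.length_le
    gcongr

theorem nat_length (hl : PTime Γ fun a => listOf (e a) (l a)) :
    PTime Γ fun a => .num ((l a).length : ℕ) := by
  have hf : ∀ (a : X) (l : List (B a)), l.foldl (fun (s : ℕ) _ => s + 1) 0 = l.length := fun a l => by
    rw [List.foldl_const]; simp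
  refine (foldl (S := fun _ => ℕ) (es := fun _ s => .num (s : ℚ)) (s₀ := fun _ => 0)
    (f := fun a s b => s + 1) hl (.const _)
    ((num_add acc (.const (.num 1))).congr fun p => by simp)
    (M := fun a => 3 + 2 * (l a).length)
    ((PolyBdd.const 3).add ((PolyBdd.const 2).mul hl.length)) fun a pre hpre => ?_).congr
    fun a => by rw [hf]
  rw [hf]
  have h₁ := Data.size_num_le (pre.length : ℚ)
  have h₂ := hpre.length_le
  have h₃ : Nat.size pre.length ≤ pre.length := Nat.size_le.2 Nat.lt_two_pow_self
  rw [Rat.bitLen_natCast] at h₁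
  omega

end PTime

/-! ### Minimisation, table lookup and unary counters -/

/-- An entry of least cost of the list, as a list with at most one entry. -/
def List.best {β : Type} (cost : β → ℚ) (l : List β) : List β :=
  l.foldl (fun s b => if s.filter (cost · ≤ cost b) ≠ [] then s.filter (cost · ≤ cost b) else [b]) []

namespace List

variable {β : Type} (cost : β → ℚ)

theorem best_concat (l : List β) (b : β) : (l ++ [b]).best cost =
    if (l.best cost).filter (cost · ≤ cost b) ≠ [] then (l.best cost).filter (cost · ≤ cost b)
    else [b] := by
  simp [best, foldl_append]

theorem best_spec (l : List β) : (l = [] ∧ l.best cost = []) ∨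
    ∃ b ∈ l, l.best cost = [b] ∧ ∀ c ∈ l, cost b ≤ cost c := by
  induction l using List.reverseRecOn with
  | nil => exact .inl ⟨rfl, rfl⟩
  | append_singleton l b ih =>
    right
    rw [best_concat]
    rcases ih with ⟨rfl, h⟩ | ⟨c, hc, h, h'⟩
    · exact ⟨b, by simp, by simp [h], by simp⟩
    · by_cases hcb : cost c ≤ cost b
      · refine ⟨c, by simp [hc], by simp [h, hcb], fun d hd => ?_⟩
        rcases mem_append.1 hd with hd | hd
        · exact h' d hd
        · rw [mem_singleton.1 hd]; exact hcb
      · refine ⟨b, by simp, by simp [h, hcb], fun d hd => ?_⟩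
        rcases mem_append.1 hd with hd | hd
        · exact (not_le.1 hcb).le.trans (h' d hd)
        · rw [mem_singleton.1 hd]

variable {cost}

theorem mem_of_mem_best {l : List β} {b : β} (h : b ∈ l.best cost) : b ∈ l := by
  rcases best_spec cost l with ⟨-, h'⟩ | ⟨c, hc, h', -⟩
  · simp [h'] at h
  · rw [h', mem_singleton] at h; exact h ▸ hc

theorem exists_best {l : List β} {c : β} (h : c ∈ l) :
    ∃ b ∈ l, l.best cost = [b] ∧ cost b ≤ cost c := by
  rcases best_spec cost l with ⟨rfl, -⟩ | ⟨b, hb, h', h''⟩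
  · simp at h
  · exact ⟨b, hb, h', h'' c h⟩

theorem length_best_le (l : List β) : (l.best cost).length ≤ 1 := by
  rcases best_spec cost l with ⟨-, h⟩ | ⟨b, -, h, -⟩ <;> simp [h]

end List

namespace PTime

variable {X : Type} {B C : X → Type} {Γ : X → Data} {e : ∀ a, B a → Data}
  {e' : ∀ a, C a → Data} {l : ∀ a, List (B a)}

theorem best {cost : ∀ a, B a → ℚ} (hl : PTime Γ fun a => listOf (e a) (l a))
    (hc : PTime (X := Σ a, B a) (fun p => .pair (Γ p.1) (e p.1 p.2)) fun p => .num (cost p.1 p.2)) :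
    PTime Γ fun a => listOf (e a) ((l a).best (cost a)) := by
  have hfil : PTime (X := Σ a, List (B a) × B a)
      (fun p => .pair (Γ p.1) (.pair (listOf (e p.1) p.2.1) (e p.1 p.2.2)))
      (fun p => listOf (e p.1) (p.2.1.filter (cost p.1 · ≤ cost p.1 p.2.2))) := by
    have hΓ : PTime (X := Σ a, List (B a) × B a)
      (fun p => .pair (Γ p.1) (.pair (listOf (e p.1) p.2.1) (e p.1 p.2.2))) fun p => Γ p.1 := refl.weak
    have hb : PTime (X := Σ a, List (B a) × B a)
      (fun p => .pair (Γ p.1) (.pair (listOf (e p.1) p.2.1) (e p.1 p.2.2))) fun p => e p.1 p.2.2 := elt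
    refine filter (B := fun p : Σ a, List (B a) × B a => B p.1) (e := fun p => e p.1)
      (p := fun p b => cost p.1 b ≤ cost p.1 p.2.2) acc (PolyDec.le ?_ ?_)
    · exact hc.comp (fun p : Σ p : (Σ a, List (B a) × B a), B p.1 => (⟨p.1.1, p.2⟩ : Σ a, B a))
        (hΓ.weak.pair last)
    · exact hc.comp (fun p : Σ p : (Σ a, List (B a) × B a), B p.1 => (⟨p.1.1, p.1.2.2⟩ : Σ a, B a))
        (hΓ.weak.pair hb.weak)
  refine foldl (S := fun a => List (B a)) (es := fun a => listOf (e a)) (s₀ := fun a => [])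
    hl nil ((PolyDec.ne_nil hfil).ite (E := fun p => listOf (e p.1)) hfil
      (singleton (B := fun p : Σ a, List (B a) × B a => B p.1) (e := fun p => e p.1) elt))
    -- The accumulator has at most one entry, and that entry comes from the list itself.
    (M := fun a => 1 + 1 * (1 + (listOf (e a) (l a)).size))
    ((PolyBdd.const 1).add ((PolyBdd.const 1).mul ((PolyBdd.const 1).add hl.size)))
    fun a pre hpre => ?_
  change (listOf (e a) (pre.best (cost a))).size ≤ _
  refine (Data.size_listOf_le fun b hb => (Data.size_lt_of_mem
    (hpre.subset (List.mem_of_mem_best hb))).le).trans ?_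
  have := List.length_best_le (cost := cost a) pre
  gcongr

/-- Looking up the value of a tabulated function. -/
theorem lookup {n : X → ℕ} {y : ∀ a, Fin (n a) → Data} {v : ∀ a, Fin (n a)}
    (hy : PTime Γ fun a => listOf (y a) (List.finRange (n a)))
    (hv : PTime Γ fun a => .vertex (v a)) : PTime Γ fun a => y a (v a) := by
  -- The index is counted down to zero while heads of the table are dropped.
  let σ : X → ℕ → Data := fun a i =>
    .pair (.num ((v a - i : ℕ) : ℚ)) (listOf (y a) ((List.finRange (n a)).drop i))
  have h0 : PTime Γ fun a => σ a 0 := hv.pair (hy.congr fun a => by simp)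
  have hl0 : PTime (fun a => σ a 0) fun a => listOf (y a) (List.finRange (n a)) :=
    (snd (refl : PTime (fun a => σ a 0) _)).congr fun a => by simp
  have hb : ∀ a i, (listOf (y a) ((List.finRange (n a)).drop i)).size ≤
      (listOf (y a) (List.finRange (n a))).size := fun a i =>
    Data.size_listOf_le_of_sublist (List.drop_sublist _ _)
  have hn := hl0.length
  simp only [List.length_finRange] at hn
  have key : PTime (fun a => σ a 0) fun a => σ a (v a) := by
    have hdec : PolyDec (X := Σ a, Fin ((v a : ℕ) + 1)) (fun p => σ p.1 p.2)
        fun p => (1 : ℚ) ≤ ((v p.1 - p.2 : ℕ) : ℚ) := .le (.const (.num 1)) (fst refl)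
    obtain ⟨c, hc, hc'⟩ := hdec
    refine PTime.iterate (σ := σ) (K := fun a => v a) (c := c) hc ?_ ?_ ?_
      (hn.mono fun a => (v a).isLt.le)
      (M := fun a => 4 + 2 * n a + (listOf (y a) (List.finRange (n a))).size) ?_ ?_
    · refine pair ((num_sub (fst refl) (.const (.num 1))).congr fun p => ?_) ?_
      · have := p.2.isLt
        rw [← Nat.sub_sub, Nat.cast_sub (n := v p.1 - p.2) (by omega)]
        simp
      · refine (snd refl).app .snd |>.congr fun p => ?_
        rw [List.drop_eq_getElem_cons (by simp; omega)]
        rfl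
    · intro a i
      rw [hc']
      have := i.isLt
      simp only [Fin.val_castSucc, Nat.one_le_cast]
      omega
    · intro a
      rw [← not_ne_iff, hc']
      simp
    · exact ((PolyBdd.const 4).add ((PolyBdd.const 2).mul hn)).add hl0.size
    · intro a i _
      have h₁ := Data.size_num_le ((v a - i : ℕ) : ℚ)
      have h₃ : Nat.size (v a - i) ≤ v a - i := Nat.size_le.2 Nat.lt_two_pow_self
      rw [Rat.bitLen_natCast] at h₁
      have := (v a).isLt
      have := hb a i
      simp only [σ, Data.size] at h₁ ⊢
      omega
  refine (((snd (h0.trans key)).app .fst)).congr fun a => ?_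
  rw [List.drop_eq_getElem_cons (by simp)]
  simp [Prim.apply]

theorem _root_.Data.size_natCast_le (k : ℕ) : (Data.num (k : ℚ)).size ≤ 3 + 2 * k := by
  have h₁ := Data.size_num_le (k : ℚ)
  have h₃ : Nat.size k ≤ k := Nat.size_le.2 Nat.lt_two_pow_self
  rw [Rat.bitLen_natCast] at h₁
  omega

/-- The number is available in binary only, so writing down all smaller numbers needs the extra
assumption that it is polynomially bounded. -/
theorem finRange {n : X → ℕ} (hn : PTime Γ fun a => .num (n a : ℚ)) (hb : PolyBdd Γ n) :
    PTime Γ fun a => listOf .vertex (List.finRange (n a)) := by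
  let σ : X → ℕ → Data := fun a i => .pair (Γ a) (.pair (.num ((n a - i : ℕ) : ℚ))
    (listOf .vertex ((List.finRange (n a)).drop (n a - i))))
  have h0 : PTime Γ fun a => σ a 0 := refl.pair (hn.pair ((PTime.const .nil).congr fun a => by
    rw [Nat.sub_zero, List.drop_eq_nil_of_le (by simp)]; rfl))
  have hΓ : PTime (fun a => σ a 0) Γ := fst refl
  have key : PTime (fun a => σ a 0) fun a => σ a (n a) := by
    have hnum : PTime (X := Σ a, Fin (n a + 1)) (fun p => σ p.1 p.2)
        fun p => .num ((n p.1 - p.2 : ℕ) : ℚ) := fst (snd refl)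
    obtain ⟨c, hc, hc'⟩ := PolyDec.le (.const (.num 1)) hnum
    refine PTime.iterate (σ := σ) (K := n) (c := c) hc ?_ ?_ ?_ (hΓ.bdd hb)
      (M := fun a => (Γ a).size + 5 + 2 * n a + (1 + n a * (1 + (3 + 2 * n a)))) ?_ ?_
    · have hpred : PTime (X := Σ a, Fin (n a)) (fun p => σ p.1 p.2)
          fun p => .num ((n p.1 - (p.2 + 1) : ℕ) : ℚ) := by
        refine (num_sub (fst (snd refl)) (.const (.num 1))).congr fun p => ?_
        have := p.2.isLt
        rw [← Nat.sub_sub, Nat.cast_sub (n := n p.1 - p.2) (by omega)]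
        simp
      refine (fst refl).pair (hpred.pair ((hpred.pair (snd (snd refl))).congr fun p => ?_))
      have := p.2.isLt
      rw [List.drop_eq_getElem_cons (i := n p.1 - (p.2 + 1)) (by simp; omega),
        show n p.1 - (p.2 + 1) + 1 = n p.1 - p.2 by omega]
      simp [Data.vertex]
    · intro a i
      rw [hc']
      have := i.isLt
      simp only [Fin.val_castSucc, Nat.one_le_cast]
      omega
    · intro a
      rw [← not_ne_iff, hc']
      simp
    · have hn' := hΓ.bdd hb
      exact ((hΓ.size.add (.const 5)).add ((PolyBdd.const 2).mul hn')).add ((PolyBdd.const 1).add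
        (hn'.mul ((PolyBdd.const 1).add ((PolyBdd.const 3).add ((PolyBdd.const 2).mul hn')))))
    · intro a i _
      have h₁ := Data.size_natCast_le (n a - i)
      have h₂ : (listOf .vertex ((List.finRange (n a)).drop (n a - i))).size ≤
          1 + n a * (1 + (3 + 2 * n a)) := by
        refine (Data.size_listOf_le_of_sublist (List.drop_sublist _ _)).trans
          ((Data.size_listOf_le (M := 3 + 2 * n a) fun v _ => ?_).trans (by simp))
        exact (Data.size_natCast_le v).trans (by have := v.isLt; omega)
      simp only [σ, Data.size] at h₁ ⊢
      omega
  exact (snd (snd (h0.trans key))).congr fun a => by simp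

end PTime

/-- A list whose length is the bit length of the integer part of `q`. -/
def Rat.bits (q : ℚ) : List Unit := List.replicate (Nat.size ⌊q⌋.toNat) ()

theorem Rat.lt_two_pow_bits (q : ℚ) : q < 2 ^ q.bits.length := by
  rw [Rat.bits, List.length_replicate]
  have h₁ := Nat.lt_size_self ⌊q⌋.toNat
  have h₂ : ⌊q⌋ + 1 ≤ ((2 ^ ⌊q⌋.toNat.size : ℕ) : ℤ) := by
    have := Int.self_le_toNat ⌊q⌋
    omega
  calc q < ⌊q⌋ + 1 := Int.lt_floor_add_one q
    _ ≤ ((2 ^ ⌊q⌋.toNat.size : ℕ) : ℤ) := by exact_mod_cast h₂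
    _ = _ := by push_cast; rfl

theorem PTime.bits {X : Type} {Γ : X → Data} {q : X → ℚ} (hq : PTime Γ fun a => .num (q a)) :
    PTime Γ fun a => listOf (fun _ => .nil) (q a).bits := by
  let m : X → ℕ := fun a => ⌊q a⌋.toNat
  have hm : PTime Γ fun a => .num (m a : ℚ) :=
    (num_max hq.num_floor (.const (.num 0))).congr fun a => by
      have := Int.toNat_eq_max ⌊q a⌋
      rw [← Int.cast_natCast (R := ℚ) (m a), this]
      push_cast; rfl
  -- Halving `m` until it vanishes takes exactly `Nat.size m` rounds, each of which adds one entry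
  -- to the output.
  let σ : X → ℕ → Data := fun a i =>
    .pair (.num ((m a / 2 ^ i : ℕ) : ℚ)) (listOf (fun _ => .nil) (List.replicate i ()))
  have h0 : PTime Γ fun a => σ a 0 := (hm.congr fun a => by simp).pair (.const .nil)
  have hK : ∀ a, (m a).size < (σ a 0).size := fun a => by
    simp only [σ, Data.size, pow_zero, Nat.div_one, Rat.num_natCast, Int.natAbs_natCast]
    omega
  have key : PTime (fun a => σ a 0) fun a => σ a (m a).size := by
    obtain ⟨c, hc, hc'⟩ := PolyDec.le (.const (.num 1)) (fst refl : PTime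
      (X := Σ a, Fin ((m a).size + 1)) (fun p => σ p.1 p.2) fun p => .num ((m p.1 / 2 ^ p.2.1 : ℕ) : ℚ))
    refine PTime.iterate (σ := σ) (K := fun a => (m a).size) (c := c) hc ?_ ?_ ?_
      (PolyBdd.size.mono fun a => (hK a).le)
      (M := fun a => 5 + 4 * (σ a 0).size)
      ((PolyBdd.const 5).add ((PolyBdd.const 4).mul .size)) ?_
    · refine pair ((num_floor (num_mul (fst refl) (.const (.num (1/2))))).congr fun p => ?_) ?_
      · have : ((m p.1 / 2 ^ (p.2 : ℕ) : ℕ) : ℚ) * (1 / 2) = ((m p.1 / 2 ^ (p.2 : ℕ) : ℕ) : ℚ) / (2 : ℕ) := by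
          push_cast; ring
        rw [this, Rat.floor_natCast_div_natCast, pow_succ, ← Nat.div_div_eq_div_mul]
        rfl
      · exact (const .nil).pair (snd refl)
    · intro a i
      rw [hc']
      refine Nat.one_le_cast.2 ?_
      exact Nat.div_pos (Nat.lt_size.1 i.isLt) (by positivity)
    · intro a
      rw [← not_ne_iff, hc']
      simp only [Fin.val_last, Nat.div_eq_of_lt (Nat.lt_size_self _)]
      simp
    · intro a i hi
      have h₁ := Data.size_num_le ((m a / 2 ^ i : ℕ) : ℚ)
      have h₂ := Nat.size_le_size (Nat.div_le_self (m a) (2 ^ i))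
      have h₃ : (listOf (fun _ => .nil) (List.replicate i ())).size ≤ 1 + i * (1 + 1) :=
        (Data.size_listOf_le fun _ _ => le_rfl).trans (by simp [Data.size])
      have h₄ := hK a
      rw [Rat.bitLen_natCast] at h₁
      simp only [σ, Data.size] at h₁ h₄ ⊢
      omega
  exact snd (h0.trans key)

/-! ### The algorithm -/

/-- A timed route, latest stop first. The entry `(v, c, a)` says that `v` is reached over an edge
of length `c` and is not left before time `a`. -/
abbrev Route (n : ℕ) : Type := List (Fin n × ℚ × ℚ)

namespace Route

variable {n : ℕ}

/-- The time at which the route is at its final stop. -/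
def time (r : Route n) : ℚ := r.foldr (fun e t => max (t + e.2.1) e.2.2) 0

/-- Wait at the final stop until time `a`. -/
def waitUntil (a : ℚ) (r : Route n) : Route n :=
  (r.take 1).map (fun e => (e.1, e.2.1, max e.2.2 a)) ++ r.drop 1

/-- The stops with their times, in chronological order. -/
def schedule (r : Route n) : List (Fin n × ℚ) :=
  (r.tails.flatMap fun s => (s.take 1).map fun e => (e.1, time s)).reverse

end Route

namespace WGraph

variable (G : WGraph)

/-- One round of the Bellman-Ford algorithm. -/
def pathStep (P : Fin G.n → Fin G.n → List (Route G.n)) (u v : Fin G.n) : List (Route G.n) :=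
  List.best Route.time (P u v ++ (List.finRange G.n).flatMap fun x =>
    (P u x).flatMap fun p => (G.weight x v).toList.map fun c => (v, c, 0) :: p)

/-- A path omits its first vertex, so the path from a vertex to itself is the empty route. -/
def trivialPaths (u v : Fin G.n) : List (Route G.n) := if u = v then [[]] else []

def pathTable : Fin G.n → Fin G.n → List (Route G.n) :=
  (List.finRange G.n).foldl (fun P _ => G.pathStep P) G.trivialPaths

/-- A shortest path from `u` to `v` (without its first vertex), as a list with at most one entry. -/
def path (u v : Fin G.n) : List (Route G.n) := G.pathTable u v

def dist (u v : Fin G.n) : Option ℚ := ((G.path u v).map Route.time).head?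

/-- Prolong the route by a shortest path to `v`. -/
def goTo (r : Route G.n) (v : Fin G.n) : Route G.n :=
  ((r.take 1).flatMap fun e => (G.path e.1 v).flatMap id) ++ r

/-- Wait until time `a`, then visit the vertices of `W`. -/
def ride (a : ℚ) (W : List (Fin G.n)) (r : Route G.n) : Route G.n :=
  W.foldl G.goTo (r.waitUntil a)

/-- The orienteering instance with budget `B`, raised so that the edge from `u` to `w` is
affordable. -/
abbrev query (u w : Fin G.n) (B : ℚ) : OrientInst :=
  { G with s := u, t := w, T := max B ((G.weight u w).getD 0) }

variable (O : (J : OrientInst) → List (Fin J.n))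

/-- The budget `B` suffices for the algorithm `O` to find more than `k` vertices. -/
def Enough (u w : Fin G.n) (k : ℕ) (B : ℚ) : Prop := k < (O (G.query u w B)).toFinset.card

instance (u w : Fin G.n) (k : ℕ) (B : ℚ) : Decidable (G.Enough O u w k B) :=
  inferInstanceAs (Decidable (_ < _))

/-- The number of bisection steps, in unary. -/
def precision (T : ℚ) : List Unit :=
  (T + 1).bits ++ (List.finRange G.n).flatMap fun u => (List.finRange G.n).flatMap fun v =>
    (G.weight u v).toList.flatMap fun c => Rat.bits (c.den : ℕ)

def bisectStep (u w : Fin G.n) (k : ℕ) (s : ℚ × ℚ) : ℚ × ℚ :=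
  if G.Enough O u w k (s.1 + s.2 * (1 / 2)) then (s.1, s.2 * (1 / 2))
  else (s.1 + s.2 * (1 / 2), s.2 * (1 / 2))

/-- Bisection for the least sufficient budget below `T`: an insufficient budget and a gap. -/
def bisect (u w : Fin G.n) (k : ℕ) (T : ℚ) : ℚ × ℚ :=
  -- The lower end starts at `-1`, below every walk length; adding the gap `T + 1` puts the upper
  -- end at `T`.
  (G.precision T).foldl (fun s _ => G.bisectStep O u w k s) (-1, T + 1)

/-- A short walk from `u` to `w` with more than `k` vertices, as a list with at most one entry. -/
def search (u w : Fin G.n) (k : ℕ) (T : ℚ) : List (List (Fin G.n)) :=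
  if G.Enough O u w k ((G.bisect O u w k T).1 + (G.bisect O u w k T).2) then
    [O (G.query u w ((G.bisect O u w k T).1 + (G.bisect O u w k T).2))]
  else []

end WGraph

/-- The parameters of a group of vertices: those `v` with `R v ≤ R p`, `D q ≤ D v` and key between
the keys of `x` and `y` are to be visited on a walk from `u` to `w`, more than `k` of them. -/
structure GroupData (n : ℕ) where
  p : Fin n
  q : Fin n
  x : Fin n
  y : Fin n
  u : Fin n
  w : Fin n
  k : Fin n

/-- A partial solution: all keys counted are at most `bound`, `count` vertices are counted. -/
structure Label (n : ℕ) where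
  bound : ℚ
  count : ℕ
  route : Route n

namespace TWInst

variable (I : TWInst)

/-- The groups of a chain are ordered by deadlines or by release times. -/
def key : Bool → Fin I.n → ℚ
  | true => I.D
  | false => I.R

/-- Any stop made after `R p` and before `D q` lies in the window of every such vertex. The range of
keys separates the groups of a chain. -/
def InGroup (m : Bool) (g : GroupData I.n) (v : Fin I.n) : Prop :=
  I.R v ≤ I.R g.p ∧ I.D g.q ≤ I.D v ∧ I.key m g.x ≤ I.key m v ∧ I.key m v ≤ I.key m g.y

instance (m : Bool) (g : GroupData I.n) (v : Fin I.n) : Decidable (I.InGroup m g v) :=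
  inferInstanceAs (Decidable (_ ∧ _))

def groups : List (GroupData I.n) :=
  (List.finRange I.n ×ˢ List.finRange I.n ×ˢ List.finRange I.n ×ˢ List.finRange I.n ×ˢ
    List.finRange I.n ×ˢ List.finRange I.n ×ˢ List.finRange I.n).map fun t =>
  ⟨t.1, t.2.1, t.2.2.1, t.2.2.2.1, t.2.2.2.2.1, t.2.2.2.2.2.1, t.2.2.2.2.2.2⟩

/-- Shortest path lengths are used because vertices passed between two members need not belong to
the group and earn nothing. Outside vertices stay in the graph but are isolated: they cannot be
collected, and the number of vertices in `α(n, ·)` does not change. -/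
def groupWeight (m : Bool) (g : GroupData I.n) (u v : Fin I.n) : Option ℚ :=
  if I.InGroup m g u ∧ I.InGroup m g v then I.toWGraph.dist u v else none

end TWInst

/-! ### Nonnegative path lengths and the group graph -/

theorem Route.time_nonneg {n : ℕ} {r : Route n} (h : ∀ e ∈ r, 0 ≤ e.2.1) : 0 ≤ r.time := by
  induction r with
  | nil => exact le_rfl
  | cons e r ih =>
    have h₁ := ih fun e he => h e (by simp [he])
    have h₂ := h e (by simp)
    exact le_max_of_le_left (add_nonneg h₁ h₂)

namespace WGraph

variable (G : WGraph)

theorem pathTable_eq : G.pathTable = G.pathStep^[G.n] G.trivialPaths := by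
  rw [pathTable, List.foldl_const, List.length_finRange]

/-- The round number bounds the number of edges of the stored paths; keeping it in the motive yields
the size bound for the table. -/
theorem iterate_pathStep_induction {motive : Fin G.n → Fin G.n → ℕ → Route G.n → Prop}
    (hnil : ∀ u, motive u u 0 [])
    (hsucc : ∀ u v m p, motive u v m p → motive u v (m + 1) p)
    (hcons : ∀ u x v m p c, motive u x m p → G.weight x v = some c →
      motive u v (m + 1) ((v, c, 0) :: p))
    (m : ℕ) : ∀ u v, ∀ p ∈ G.pathStep^[m] G.trivialPaths u v, motive u v m p := by
  induction m with
  | zero =>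
    intro u v p hp
    simp only [Function.iterate_zero, id_eq, trivialPaths] at hp
    split_ifs at hp with h
    · subst h; rw [List.mem_singleton.1 hp]; exact hnil u
    · simp at hp
  | succ m ih =>
    intro u v p hp
    rw [Function.iterate_succ_apply'] at hp
    have hp := List.mem_of_mem_best hp
    simp only [List.mem_append, List.mem_flatMap, List.mem_map, Option.mem_toList] at hp
    rcases hp with hp | ⟨x, -, p', hp', c, hc, rfl⟩
    · exact hsucc _ _ _ _ (ih _ _ _ hp)
    · exact hcons _ _ _ _ _ _ (ih _ _ _ hp') hc

theorem path_induction {motive : Fin G.n → Fin G.n → Route G.n → Prop}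
    (hnil : ∀ u, motive u u [])
    (hcons : ∀ u x v p c, motive u x p → G.weight x v = some c → motive u v ((v, c, 0) :: p))
    {u v : Fin G.n} {p : Route G.n} (hp : p ∈ G.path u v) : motive u v p := by
  rw [path, pathTable_eq] at hp
  exact G.iterate_pathStep_induction (motive := fun u v _ p => motive u v p) hnil
    (fun _ _ _ _ => id) (fun u x v _ p c => hcons u x v p c) _ _ _ _ hp

theorem path_nonneg {u v : Fin G.n} {p : Route G.n} (hp : p ∈ G.path u v) :
    ∀ e ∈ p, 0 ≤ e.2.1 :=
  G.path_induction (motive := fun _ _ p => ∀ e ∈ p, 0 ≤ e.2.1) (by simp)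
    (fun u x v p c h hc e he => by
      rcases List.mem_cons.1 he with rfl | he
      · exact G.weight_nonneg _ _ _ hc
      · exact h e he) hp

theorem dist_nonneg {u v : Fin G.n} {c : ℚ} (h : G.dist u v = some c) : 0 ≤ c := by
  simp only [dist, List.head?_map, Option.map_eq_some_iff] at h
  obtain ⟨p, hp, rfl⟩ := h
  exact Route.time_nonneg (G.path_nonneg (List.mem_of_mem_head? hp))

end WGraph

namespace TWInst

variable (I : TWInst)

/-- The metric completion of the graph, restricted to the vertices of the group. -/
abbrev groupGraph (m : Bool) (g : GroupData I.n) : WGraph where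
  n := I.n
  weight := I.groupWeight m g
  weight_nonneg u v c h := by
    unfold groupWeight at h
    split_ifs at h
    exact I.toWGraph.dist_nonneg h

variable (O : (J : OrientInst) → List (Fin J.n))

/-- The prolongation of a partial solution by the path `p` and the walk `W`, if it is in time. -/
def visit (m : Bool) (l : Label I.n) (g : GroupData I.n) (p : Route I.n) (W : List (Fin I.n)) :
    List (Label I.n) :=
  if (I.toWGraph.ride (I.R g.p) W (p ++ l.route)).time ≤ I.D g.q then
    [⟨I.key m g.y, l.count + (g.k + 1), I.toWGraph.ride (I.R g.p) W (p ++ l.route)⟩]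
  else []

/-- The walks through the group `g`. -/
def groupWalks (m : Bool) (g : GroupData I.n) : List (List (Fin I.n)) :=
  -- The test ensures that both ends lie in the group and that the direct edge is a feasible walk of
  -- every query.
  if (I.groupWeight m g g.u g.w).isSome then (I.groupGraph m g).search O g.u g.w g.k I.T else []

/-- The prolongations of a partial solution by a visit to the group `g`. -/
def extend (m : Bool) (l : Label I.n) (g : GroupData I.n) : List (Label I.n) :=
  if l.bound < I.key m g.x then
    (l.route.take 1).flatMap fun e => (I.toWGraph.path e.1 g.u).flatMap fun p =>
      (I.groupWalks O m g).flatMap fun W => I.visit m l g p W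
  else []

/-- A number smaller than all keys. -/
def bottom (m : Bool) : ℚ := (List.finRange I.n).foldl (fun s v => min s (I.key m v)) 0 - 1

/-- A fastest label with the given bound, position and count. -/
def select (ls : List (Label I.n)) (h : ℚ) (v : Fin I.n) (c : ℕ) : List (Label I.n) :=
  List.best (fun l => l.route.time) (ls.flatMap fun l => (l.route.take 1).flatMap fun e =>
    if l.bound = h ∧ e.1 = v ∧ (l.count : ℚ) = c then [l] else [])

def bounds (m : Bool) : List ℚ := I.bottom m :: (List.finRange I.n).map (I.key m)

def counts : List ℕ := 0 :: (List.finRange I.n).map fun k : Fin I.n => (k : ℕ) + 1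

/-- Keep a fastest label for each bound, position and count. -/
def prune (m : Bool) (ls : List (Label I.n)) : List (Label I.n) :=
  (I.bounds m).flatMap fun h => (List.finRange I.n).flatMap fun v =>
    I.counts.flatMap fun c => I.select ls h v c

def round (m : Bool) (ls : List (Label I.n)) : List (Label I.n) :=
  I.prune m (ls ++ ls.flatMap fun l => I.groups.flatMap fun g => I.extend O m l g)

def initial (m : Bool) : List (Label I.n) := [⟨I.bottom m, 0, [(I.s, 0, 0)]⟩]

def labels (m : Bool) : List (Label I.n) :=
  (List.finRange I.n).foldl (fun ls _ => I.round O m ls) (I.initial m)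

/-- The labels that can be completed to a solution, after the completion. -/
def finals (m : Bool) : List (ℕ × Route I.n) :=
  (I.labels O m).flatMap fun l => (l.route.take 1).flatMap fun e =>
  (I.toWGraph.path e.1 I.t).flatMap fun p =>
    if (p ++ l.route).time ≤ I.T then [(l.count, p ++ l.route)] else []

/-- The solution found by the algorithm. -/
def solve : List (Fin I.n × ℚ) :=
  (List.best (fun x => -(x.1 : ℚ)) (I.finals O true ++ I.finals O false)).flatMap
    fun x => Route.schedule x.2

end TWInst

/-! ### Running time of the algorithm -/

def Data.entry {n : ℕ} (e : Fin n × ℚ × ℚ) : Data :=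
  .pair (.vertex e.1) (.pair (.num e.2.1) (.num e.2.2))

def Data.route {n : ℕ} (r : Route n) : Data := listOf Data.entry r

def WGraph.code (G : WGraph) : Data := .pair (.num G.n) G.enc

/-- The encoding of a table of lists of routes. -/
def Data.table {n : ℕ} (P : Fin n → Fin n → List (Route n)) : Data :=
  listOf (fun u => listOf (fun v => listOf Data.route (P u v)) (List.finRange n)) (List.finRange n)

/-- Denominators multiply under addition, so bit lengths add up along the route, while maxima create
no new numbers. -/
theorem Rat.bitLen_time_le {n : ℕ} (r : Route n) :
    r.time.bitLen ≤ 1 + r.length * ((Data.route r).size + 1) := by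
  suffices H : ∀ S, (∀ e ∈ r, (Data.entry e).size ≤ S) → r.time.bitLen ≤ 1 + r.length * (S + 1) from
    H _ fun e he => (Data.size_lt_of_mem he).le
  intro S hS
  induction r with
  | nil => simp [Route.time, Rat.bitLen]
  | cons e r ih =>
    have h₁ := ih fun e he => hS e (by simp [he])
    have h₂ := hS e (by simp)
    have h₃ := Rat.bitLen_max_le (Route.time r + e.2.1) e.2.2
    have h₄ := Rat.bitLen_add_le (Route.time r) e.2.1
    have h₅ := Rat.bitLen_lt_size e.2.1
    have h₆ := Rat.bitLen_lt_size e.2.2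
    have h₇ : (Data.entry e).size = 1 + (Data.vertex e.1).size + (1 + (Data.num e.2.1).size +
      (Data.num e.2.2).size) := rfl
    have h₈ : Route.time (e :: r) = max (Route.time r + e.2.1) e.2.2 := rfl
    rw [h₈, List.length_cons, Nat.add_mul]
    omega

namespace PTime

variable {X : Type} {Γ : X → Data}

theorem entry {n : X → ℕ} {v : ∀ a, Fin (n a)} {c d : X → ℚ} (hv : PTime Γ fun a => .vertex (v a))
    (hc : PTime Γ fun a => .num (c a)) (hd : PTime Γ fun a => .num (d a)) :
    PTime Γ fun a => Data.entry (v a, c a, d a) := hv.pair (hc.pair hd)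

section Entry

variable {n : X → ℕ} {e : ∀ a, Fin (n a) × ℚ × ℚ}

theorem entry_fst (h : PTime Γ fun a => Data.entry (e a)) :
    PTime Γ fun a => .vertex (e a).1 := fst h

theorem entry_snd (h : PTime Γ fun a => Data.entry (e a)) :
    PTime Γ fun a => .num (e a).2.1 := fst (snd h)

theorem entry_trd (h : PTime Γ fun a => Data.entry (e a)) :
    PTime Γ fun a => .num (e a).2.2 := snd (snd h)

end Entry

variable {n : X → ℕ} {r r' : ∀ a, Route (n a)}

theorem time (hr : PTime Γ fun a => Data.route (r a)) : PTime Γ fun a => .num (r a).time := by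
  refine foldr (S := fun _ => ℚ) (es := fun _ => .num) (s₀ := fun _ => 0) hr (.const _)
    (num_max (num_add acc (entry_snd elt)) (entry_trd elt))
    (M := fun a => 1 + 2 * (1 + (r a).length * ((Data.route (r a)).size + 1))) ?_ ?_
  · exact (PolyBdd.const 1).add ((PolyBdd.const 2).mul ((PolyBdd.const 1).add
      (hr.length.mul (hr.size.add (.const 1)))))
  · intro a suf hsuf
    refine (Data.size_num_le _).trans ?_
    have h₁ := Rat.bitLen_time_le suf
    have h₂ : (Data.route suf).size ≤ (Data.route (r a)).size :=
      Data.size_listOf_le_of_sublist hsuf.sublist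
    have h₃ := hsuf.length_le
    have h₄ : suf.length * ((Data.route suf).size + 1) ≤
      (r a).length * ((Data.route (r a)).size + 1) := by gcongr
    change 1 + 2 * (Route.time suf).bitLen ≤ _
    omega

theorem waitUntil {d : X → ℚ} (hr : PTime Γ fun a => Data.route (r a))
    (hd : PTime Γ fun a => .num (d a)) : PTime Γ fun a => Data.route ((r a).waitUntil (d a)) := by
  refine append (map' (take_one hr) ?_) (drop_one hr)
  have he : PTime (X := Σ a, Fin (n a) × ℚ × ℚ) (fun p => .pair (Γ p.1) (Data.entry p.2))
    fun p => Data.entry p.2 := last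
  exact entry (entry_fst he) (entry_snd he) (num_max (entry_trd he) hd.weak)

theorem schedule (hr : PTime Γ fun a => Data.route (r a)) :
    PTime Γ fun a => listOf (fun x => .pair (.vertex x.1) (.num x.2)) (r a).schedule := by
  refine reverse (flatMap (tails hr) ?_)
  have hs : PTime (X := Σ a, List (Fin (n a) × ℚ × ℚ))
    (fun p => .pair (Γ p.1) (listOf Data.entry p.2)) fun p => .num (Route.time p.2) := time last
  exact map' (take_one last) ((entry_fst last).pair hs.weak)

section Graph

variable {G : X → WGraph}

theorem verts (H : PTime Γ fun a => (G a).code) :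
    PTime Γ fun a => listOf .vertex (List.finRange (G a).n) := by
  refine finRange (fst H) ?_
  have : PTime Γ fun a => listOf (fun u => listOf (fun v => .ofOption ((G a).weight u v))
    (List.finRange (G a).n)) (List.finRange (G a).n) := snd H
  simpa using this.length

theorem n_bdd (H : PTime Γ fun a => (G a).code) :
    PolyBdd Γ fun a => (G a).n := by simpa using (verts H).length

theorem weight (H : PTime Γ fun a => (G a).code)
    {u v : ∀ a, Fin (G a).n} (hu : PTime Γ fun a => .vertex (u a))
    (hv : PTime Γ fun a => .vertex (v a)) : PTime Γ fun a => .ofOption ((G a).weight (u a) (v a)) :=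
  lookup (y := fun a v => .ofOption ((G a).weight (u a) v))
    (lookup (y := fun a u => listOf (fun v => .ofOption ((G a).weight u v))
      (List.finRange (G a).n)) (snd H) hu) hv

theorem table_apply {P : ∀ a, Fin (n a) → Fin (n a) → List (Route (n a))}
    (hP : PTime Γ fun a => Data.table (P a)) {u v : ∀ a, Fin (n a)}
    (hu : PTime Γ fun a => .vertex (u a)) (hv : PTime Γ fun a => .vertex (v a)) :
    PTime Γ fun a => listOf Data.route (P a (u a) (v a)) :=
  lookup (y := fun a v => listOf Data.route (P a (u a) v))
    (lookup (y := fun a u => listOf (fun v => listOf Data.route (P a u v))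
      (List.finRange (n a))) hP hu) hv

theorem pathStep_apply (H : PTime Γ fun a => (G a).code)
    {P : ∀ a, Fin (G a).n → Fin (G a).n → List (Route (G a).n)}
    (hP : PTime Γ fun a => Data.table (P a)) {u v : ∀ a, Fin (G a).n}
    (hu : PTime Γ fun a => .vertex (u a)) (hv : PTime Γ fun a => .vertex (v a)) :
    PTime Γ fun a => listOf Data.route ((G a).pathStep (P a) (u a) (v a)) := by
  refine best (append (table_apply hP hu hv) (flatMap (verts H) ?_)) (time last)
  have hx : PTime (X := Σ a, Fin (G a).n) (fun p => .pair (Γ p.1) (.vertex p.2))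
    fun p => .vertex p.2 := last
  refine flatMap (e := fun _ => Data.route) (table_apply hP.weak hu.weak hx) ?_
  have hw := weight H.weak hx hv.weak
  have hp : PTime (X := Σ p : (Σ a, Fin (G a).n), Route (G p.1).n)
    (fun p => .pair (.pair (Γ p.1.1) (.vertex p.1.2)) (Data.route p.2)) fun p => Data.route p.2 := last
  exact map' hw.toList.weak (cons (e := fun _ => Data.entry) 
    (l := fun p : Σ p : (Σ p : (Σ a, Fin (G a).n), Route (G p.1).n), ℚ => p.1.2)
    (entry hv.weak₃ last (.const (.num 0))) hp.weak)

theorem pathStep (H : PTime Γ fun a => (G a).code)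
    {P : ∀ a, Fin (G a).n → Fin (G a).n → List (Route (G a).n)}
    (hP : PTime Γ fun a => Data.table (P a)) :
    PTime Γ fun a => Data.table ((G a).pathStep (P a)) := by
  have hx : PTime (X := Σ a, Fin (G a).n) (fun p => .pair (Γ p.1) (.vertex p.2))
    fun p => .vertex p.2 := last
  exact map (y := fun p => listOf (fun v => listOf Data.route ((G p.1).pathStep (P p.1) p.2 v))
    (List.finRange (G p.1).n)) (verts H)
    (map (B := fun p : Σ a, Fin (G a).n => Fin (G p.1).n)
      (y := fun p => listOf Data.route ((G p.1.1).pathStep (P p.1.1) p.1.2 p.2)) (verts H.weak)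
      (pathStep_apply H.weak₂ hP.weak₂ hx.weak last))

theorem trivialPaths (H : PTime Γ fun a => (G a).code) :
    PTime Γ fun a => Data.table (G a).trivialPaths := by
  have hx : PTime (X := Σ a, Fin (G a).n) (fun p => .pair (Γ p.1) (.vertex p.2))
    fun p => .vertex p.2 := last
  refine map (y := fun p => listOf (fun v => listOf Data.route ((G p.1).trivialPaths p.2 v))
    (List.finRange (G p.1).n)) (verts H)
    (map (B := fun p : Σ a, Fin (G a).n => Fin (G p.1).n)
      (y := fun p => listOf Data.route ((G p.1.1).trivialPaths p.1.2 p.2)) (verts H.weak) ?_)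
  exact (PolyDec.vertex_eq hx.weak last).ite (E := fun _ => listOf Data.route)
    (.const (listOf Data.route [([] : Route 0)])) (.const .nil)

/-- Each cell holds at most one route, whose edge lengths are copied from the graph rather than
summed. After `m` rounds the route has at most `m` stops, which bounds the size of all intermediate
tables. -/
theorem pathTable (H : PTime Γ fun a => (G a).code) :
    PTime Γ fun a => Data.table (G a).pathTable := by
  refine foldl (S := fun a => Fin (G a).n → Fin (G a).n → List (Route (G a).n))
    (es := fun _ => Data.table) (verts H) (trivialPaths H) (pathStep H.weak acc)
    (M := fun a => 1 + (G a).n * (1 + (1 + (G a).n * (1 + (1 + 1 * (1 +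
      (1 + (G a).n * ((G a).code.size + 2 * (G a).n + 10)))))))) ?_ ?_
  · have hn := n_bdd H
    exact (PolyBdd.const 1).add (hn.mul ((PolyBdd.const 1).add ((PolyBdd.const 1).add (hn.mul
      ((PolyBdd.const 1).add ((PolyBdd.const 1).add ((PolyBdd.const 1).mul ((PolyBdd.const 1).add
      ((PolyBdd.const 1).add (hn.mul ((H.size.add ((PolyBdd.const 2).mul hn)).add
      (PolyBdd.const 10))))))))))))
  · intro a pre hpre
    have hlen : pre.length ≤ (G a).n := by simpa using hpre.length_le
    rw [List.foldl_const]
    have h₁ := (G a).iterate_pathStep_induction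
      (motive := fun u v m p => (Data.route p).size ≤ 1 + m * ((G a).code.size + 2 * (G a).n + 10))
      (fun u => by simp [Data.route, Data.size])
      (fun u v m p h => h.trans (by rw [Nat.add_mul m]; omega))
      (fun u x v m p c h hc => by
        have h₁ : (Data.route ((v, c, 0) :: p)).size = 1 + (1 + (Data.vertex v).size +
          (1 + (Data.num c).size + (Data.num 0).size)) + (Data.route p).size := rfl
        have h₀ : (Data.num 0).size = 2 := rfl
        have h₂ : (Data.vertex v).size ≤ 3 + 2 * v := Data.size_natCast_le v
        have h₃ : (Data.num c).size < (G a).code.size := by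
          have e₁ := Data.size_lt_of_mem (e := fun v => .ofOption ((G a).weight x v))
            (List.mem_finRange v)
          simp only [hc] at e₁
          change (Data.num c).size < _ at e₁
          have e₂ := Data.size_lt_of_mem (e := fun u => listOf (fun v => .ofOption
            ((G a).weight u v)) (List.finRange (G a).n)) (List.mem_finRange x)
          have e₃ : (G a).code.size = 1 + (Data.num (G a).n).size + (listOf (fun u => listOf
            (fun v => .ofOption ((G a).weight u v)) (List.finRange (G a).n))
            (List.finRange (G a).n)).size := rfl
          omega
        have := v.isLt
        rw [h₁, Nat.add_mul m]
        omega) pre.length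
    have h₂ : ∀ m u v, ((G a).pathStep^[m] (G a).trivialPaths u v).length ≤ 1 := by
      intro m u v
      cases m with
      | zero => simp only [Function.iterate_zero, id_eq, WGraph.trivialPaths]; split_ifs <;> simp
      | succ m => rw [Function.iterate_succ_apply']; exact List.length_best_le _
    refine (Data.size_listOf_le (M := 1 + (G a).n * (1 + (1 + 1 * (1 + (1 + (G a).n *
      ((G a).code.size + 2 * (G a).n + 10)))))) fun u _ => ?_).trans (by simp)
    refine (Data.size_listOf_le (M := 1 + 1 * (1 + (1 + (G a).n *
      ((G a).code.size + 2 * (G a).n + 10)))) fun v _ => ?_).trans (by simp)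
    refine (Data.size_listOf_le fun p hp => (h₁ u v p hp)).trans ?_
    have := h₂ pre.length u v
    gcongr

variable {u v : ∀ a, Fin (G a).n}

theorem path (H : PTime Γ fun a => (G a).code)
    (hu : PTime Γ fun a => .vertex (u a)) (hv : PTime Γ fun a => .vertex (v a)) :
    PTime Γ fun a => listOf Data.route ((G a).path (u a) (v a)) :=
  table_apply (pathTable H) hu hv

theorem dist (H : PTime Γ fun a => (G a).code)
    (hu : PTime Γ fun a => .vertex (u a)) (hv : PTime Γ fun a => .vertex (v a)) :
    PTime Γ fun a => .ofOption ((G a).dist (u a) (v a)) :=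
  head? (map' (path H hu hv) (time last))

end Graph

end PTime

/-! ### Growth of routes and of the bisection interval -/

theorem Data.size_route_append {n : ℕ} (p r : Route n) :
    (Data.route (p ++ r)).size + 1 = (Data.route p).size + (Data.route r).size :=
  Data.size_listOf_append p r

theorem Data.size_route_waitUntil_le {n : ℕ} (d : ℚ) (r : Route n) :
    (Data.route (r.waitUntil d)).size ≤ (Data.route r).size + (Data.num d).size := by
  cases r with
  | nil => simp [Route.waitUntil]
  | cons e r =>
    have h : Route.waitUntil d (e :: r) = (e.1, e.2.1, max e.2.2 d) :: r := by
      simp [Route.waitUntil]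
    have h₂ : (Data.num (max e.2.2 d)).size ≤ (Data.num e.2.2).size + (Data.num d).size := by
      rcases max_choice e.2.2 d with h | h <;> rw [h] <;> omega
    rw [h]
    simp only [Data.route, Data.listOf_cons, Data.entry, Data.size] at h₂ ⊢
    omega

namespace WGraph

variable (G : WGraph)

theorem length_path_le (u v : Fin G.n) : (G.path u v).length ≤ 1 := by
  rw [path, pathTable_eq]
  suffices key : ∀ m, (G.pathStep^[m] G.trivialPaths u v).length ≤ 1 from key _
  intro m
  cases m with
  | zero => simp only [Function.iterate_zero, id_eq, WGraph.trivialPaths]; split_ifs <;> simp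
  | succ m => rw [Function.iterate_succ_apply']; exact List.length_best_le _

theorem size_path_lt {u v : Fin G.n} {p : Route G.n} (hp : p ∈ G.path u v) :
    (Data.route p).size < (Data.table G.pathTable).size := by
  have e₁ := Data.size_lt_of_mem (e := Data.route) hp
  have e₂ := Data.size_lt_of_mem (e := fun v => listOf Data.route (G.pathTable u v))
    (List.mem_finRange v)
  have e₃ := Data.size_lt_of_mem (e := fun u => listOf (fun v => listOf Data.route (G.pathTable u v))
    (List.finRange G.n)) (List.mem_finRange u)
  exact e₁.trans (e₂.trans e₃)

theorem goTo_eq (r : Route G.n) (v : Fin G.n) :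
    G.goTo r v = r ∨ ∃ e ∈ r.head?, ∃ p ∈ G.path e.1 v, G.goTo r v = p ++ r := by
  cases r with
  | nil => simp [goTo]
  | cons e r =>
    have h := G.length_path_le e.1 v
    rcases h' : G.path e.1 v with - | ⟨p, - | ⟨q, l⟩⟩
    · left; simp [goTo, h']
    · right; exact ⟨e, rfl, p, by simp [h'], by simp [goTo, h']⟩
    · simp [h'] at h

theorem size_goTo_le (r : Route G.n) (v : Fin G.n) :
    (Data.route (G.goTo r v)).size ≤ (Data.route r).size + (Data.table G.pathTable).size := by
  rcases G.goTo_eq r v with h | ⟨e, -, p, hp, h⟩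
  · rw [h]; omega
  · rw [h]
    have h₁ := Data.size_route_append p r
    have h₂ := G.size_path_lt hp
    omega

theorem size_ride_le (d : ℚ) (W : List (Fin G.n)) (r : Route G.n) :
    (Data.route (G.ride d W r)).size ≤ (Data.route r).size + (Data.num d).size +
      W.length * (Data.table G.pathTable).size := by
  have h₁ := Data.size_foldl_le (es := Data.route) (f := G.goTo) (r.waitUntil d) W
    fun s v _ => G.size_goTo_le s v
  have h₂ := Data.size_route_waitUntil_le d r
  unfold ride
  omega

/-- This is why budgets are raised to the length of the direct edge: every query meets the promise
under which the orienteering algorithm is guaranteed to answer correctly. -/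
theorem query_feasible {u w : Fin G.n} (h : (G.weight u w).isSome) (B : ℚ) :
    (G.query u w B).Feasible [u, w] where
  start := rfl
  finish := rfl
  edges := by simpa using h
  length_le := by simp [WGraph.walkLength]

end WGraph

theorem List.card_toFinset_eq_length_filter {n : ℕ} (W : List (Fin n)) :
    W.toFinset.card = ((List.finRange n).filter (· ∈ W)).length := by
  rw [← List.toFinset_card_of_nodup ((List.nodup_finRange n).filter _)]
  congr 1
  ext v
  simp

/-- Halving adds at most two bits to the gap, and the lower end is a sum of at most `i` gaps and
`-1`. -/
theorem Rat.bitLen_bisect_le (G : WGraph) (O : (J : OrientInst) → List (Fin J.n)) (u w : Fin G.n)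
    (k : ℕ) (T : ℚ) (i K : ℕ) (hi : i ≤ K) :
    ((G.bisectStep O u w k)^[i] (-1, T + 1)).1.bitLen ≤ 1 + i * ((T + 1).bitLen + 2 * K + 1) ∧
    ((G.bisectStep O u w k)^[i] (-1, T + 1)).2.bitLen ≤ (T + 1).bitLen + 2 * i := by
  induction i with
  | zero => simp [Rat.bitLen]
  | succ i ih =>
    obtain ⟨h₁, h₂⟩ := ih (by omega)
    rw [Function.iterate_succ_apply']
    set s := (G.bisectStep O u w k)^[i] (-1, T + 1)
    have h₃ : (s.2 * (1 / 2)).bitLen ≤ s.2.bitLen + 2 :=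
      (Rat.bitLen_mul_le _ _).trans (Nat.add_le_add_left (by norm_num [Rat.bitLen]; decide) _)
    have h₄ := Rat.bitLen_add_le s.1 (s.2 * (1 / 2))
    rw [Nat.add_mul i]
    unfold WGraph.bisectStep
    split_ifs <;> constructor <;> simp only <;> omega

namespace PTime

variable {X : Type} {Γ : X → Data}

theorem goTo {G : X → WGraph} {v : ∀ a, Fin (G a).n} {r : ∀ a, Route (G a).n}
    (H : PTime Γ fun a => (G a).code) (hr : PTime Γ fun a => Data.route (r a))
    (hv : PTime Γ fun a => .vertex (v a)) : PTime Γ fun a => Data.route ((G a).goTo (r a) (v a)) := by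
  refine append (flatMap (e := fun _ => Data.entry) (take_one hr) ?_) hr
  exact flatMap (path H.weak (entry_fst last) hv.weak) last

theorem ride {G : X → WGraph} {W : ∀ a, List (Fin (G a).n)} {r : ∀ a, Route (G a).n} {d : X → ℚ}
    (H : PTime Γ fun a => (G a).code) (hd : PTime Γ fun a => .num (d a))
    (hW : PTime Γ fun a => listOf .vertex (W a)) (hr : PTime Γ fun a => Data.route (r a)) :
    PTime Γ fun a => Data.route ((G a).ride (d a) (W a) (r a)) :=
  foldl_additive (S := fun a => Route (G a).n) (es := fun _ => Data.route) hW (waitUntil hr hd)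
    (goTo H.weak acc elt) (pathTable H).size fun a s v _ => (G a).size_goTo_le s v

theorem _root_.PolyDec.mem {n : X → ℕ} {v : ∀ a, Fin (n a)} {W : ∀ a, List (Fin (n a))}
    (hv : PTime Γ fun a => .vertex (v a)) (hW : PTime Γ fun a => listOf .vertex (W a)) :
    PolyDec Γ fun a => v a ∈ W a := by
  refine (PolyDec.ne_nil (filter (p := fun a b => b = v a) hW
    (PolyDec.vertex_eq last hv.weak))).congr fun a => ?_
  simp [List.filter_eq_nil_iff]

theorem card {n : X → ℕ} {W : ∀ a, List (Fin (n a))}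
    (hV : PTime Γ fun a => listOf .vertex (List.finRange (n a)))
    (hW : PTime Γ fun a => listOf .vertex (W a)) : PTime Γ fun a => .num (W a).toFinset.card :=
  (nat_length (filter (p := fun a b => b ∈ W a) hV (PolyDec.mem last hW.weak))).congr fun a => by
    rw [List.card_toFinset_eq_length_filter]

section Search

variable {κ : GraphKind} {O : (J : OrientInst) → List (Fin J.n)}
  {G : X → WGraph} {u w : ∀ a, Fin (G a).n} {k : X → ℕ} {B T : X → ℚ}

/-- The answer of the algorithm is known to be a list of vertices only on feasible instances of the
given kind; `hG` and `hs` place the queries among these. -/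
theorem probe (hO : PTime (X := {J : OrientInst // κ.Allows J.toWGraph ∧ ∃ W, J.Feasible W})
      (fun J => J.1.enc) fun J => listOf .vertex (O J.1))
    (H : PTime Γ fun a => (G a).code) (hu : PTime Γ fun a => .vertex (u a))
    (hw : PTime Γ fun a => .vertex (w a)) (hG : ∀ a, κ.Allows (G a))
    (hs : ∀ a, ((G a).weight (u a) (w a)).isSome) (hB : PTime Γ fun a => .num (B a)) :
    PTime Γ fun a => listOf .vertex (O ((G a).query (u a) (w a) (B a))) :=
  hO.comp (fun a => ⟨(G a).query (u a) (w a) (B a), hG a, _, (G a).query_feasible (hs a) (B a)⟩)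
    ((fst H).pair ((snd H).pair (hu.pair (hw.pair
      ((num_max hB (getD (weight H hu hw))).pair (.const .nil))))))

theorem enough (hO : PTime (X := {J : OrientInst // κ.Allows J.toWGraph ∧ ∃ W, J.Feasible W})
      (fun J => J.1.enc) fun J => listOf .vertex (O J.1))
    (H : PTime Γ fun a => (G a).code) (hu : PTime Γ fun a => .vertex (u a))
    (hw : PTime Γ fun a => .vertex (w a)) (hG : ∀ a, κ.Allows (G a))
    (hs : ∀ a, ((G a).weight (u a) (w a)).isSome) (hk : PTime Γ fun a => .num (k a))
    (hB : PTime Γ fun a => .num (B a)) :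
    PolyDec Γ fun a => (G a).Enough O (u a) (w a) (k a) (B a) :=
  (PolyDec.lt hk (card (verts H) (probe hO H hu hw hG hs hB))).congr fun _ => Nat.cast_lt

theorem precision (H : PTime Γ fun a => (G a).code) (hT : PTime Γ fun a => .num (T a)) :
    PTime Γ fun a => listOf (fun _ => .nil) ((G a).precision (T a)) := by
  refine append (bits (num_add hT (.const (.num 1)))) (flatMap (verts H) ?_)
  refine flatMap (verts H.weak) ?_
  have hx : PTime (X := Σ a, Fin (G a).n) (fun p => .pair (Γ p.1) (.vertex p.2))
    fun p => .vertex p.2 := last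
  exact flatMap (toList (weight H.weak₂ hx.weak last)) (bits (num_den last))

theorem bisect (hO : PTime (X := {J : OrientInst // κ.Allows J.toWGraph ∧ ∃ W, J.Feasible W})
      (fun J => J.1.enc) fun J => listOf .vertex (O J.1))
    (H : PTime Γ fun a => (G a).code) (hu : PTime Γ fun a => .vertex (u a))
    (hw : PTime Γ fun a => .vertex (w a)) (hG : ∀ a, κ.Allows (G a))
    (hs : ∀ a, ((G a).weight (u a) (w a)).isSome) (hk : PTime Γ fun a => .num (k a))
    (hT : PTime Γ fun a => .num (T a)) :
    PTime Γ fun a => .pair (.num ((G a).bisect O (u a) (w a) (k a) (T a)).1)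
      (.num ((G a).bisect O (u a) (w a) (k a) (T a)).2) := by
  have hT1 := num_add hT (.const (.num 1))
  have hK := (precision H hT).length
  refine foldl (S := fun _ => ℚ × ℚ) (es := fun _ s => .pair (.num s.1) (.num s.2))
    (precision H hT) (pair (.const (.num (-1))) hT1) ?_
    (M := fun a => 1 + (1 + 2 * (1 + ((G a).precision (T a)).length *
      ((.num (T a + 1) : Data).size + 2 * ((G a).precision (T a)).length + 1))) +
      (1 + 2 * ((.num (T a + 1) : Data).size + 2 * ((G a).precision (T a)).length))) ?_ ?_
  · have h₁ : PTime (X := Σ _ : X, (ℚ × ℚ) × Unit) (fun p => .pair (Γ p.1)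
        (.pair (.pair (.num p.2.1.1) (.num p.2.1.2)) .nil)) fun p => .num p.2.1.1 := fst acc
    have h₂ : PTime (X := Σ _ : X, (ℚ × ℚ) × Unit) (fun p => .pair (Γ p.1)
        (.pair (.pair (.num p.2.1.1) (.num p.2.1.2)) .nil)) fun p => .num (p.2.1.2 * (1 / 2)) :=
      num_mul (snd acc) (.const (.num (1 / 2)))
    have h₃ := num_add h₁ h₂
    exact (enough hO H.weak hu.weak hw.weak (fun p => hG p.1) (fun p => hs p.1) hk.weak h₃).ite
      (β := fun _ => ℚ × ℚ) (E := fun _ s => .pair (.num s.1) (.num s.2)) (h₁.pair h₂) (h₃.pair h₂)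
  · have h₁ := (hT1.size.add ((PolyBdd.const 2).mul hK))
    exact ((PolyBdd.const 1).add ((PolyBdd.const 1).add ((PolyBdd.const 2).mul ((PolyBdd.const 1).add
      (hK.mul (h₁.add (.const 1))))))).add ((PolyBdd.const 1).add ((PolyBdd.const 2).mul h₁))
  · intro a pre hpre
    rw [List.foldl_const]
    obtain ⟨h₁, h₂⟩ := Rat.bitLen_bisect_le (G a) O (u a) (w a) (k a) (T a) pre.length _
      hpre.length_le
    have h₃ := hpre.length_le
    have h₄ := Rat.bitLen_lt_size (T a + 1)
    have h₅ : pre.length * ((T a + 1).bitLen + 2 * ((G a).precision (T a)).length + 1) ≤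
      ((G a).precision (T a)).length * ((.num (T a + 1) : Data).size +
        2 * ((G a).precision (T a)).length + 1) := by gcongr
    have h₆ := Data.size_num_le (((G a).bisectStep O (u a) (w a) (k a))^[pre.length] (-1, T a + 1)).1
    have h₇ := Data.size_num_le (((G a).bisectStep O (u a) (w a) (k a))^[pre.length] (-1, T a + 1)).2
    have h₈ : ∀ x y : Data, (Data.pair x y).size = 1 + x.size + y.size := fun _ _ => rfl
    rw [h₈]
    omega

theorem search (hO : PTime (X := {J : OrientInst // κ.Allows J.toWGraph ∧ ∃ W, J.Feasible W})
      (fun J => J.1.enc) fun J => listOf .vertex (O J.1))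
    (H : PTime Γ fun a => (G a).code) (hu : PTime Γ fun a => .vertex (u a))
    (hw : PTime Γ fun a => .vertex (w a)) (hG : ∀ a, κ.Allows (G a))
    (hs : ∀ a, ((G a).weight (u a) (w a)).isSome) (hk : PTime Γ fun a => .num (k a))
    (hT : PTime Γ fun a => .num (T a)) :
    PTime Γ fun a => listOf (listOf .vertex) ((G a).search O (u a) (w a) (k a) (T a)) := by
  have hb := bisect hO H hu hw hG hs hk hT
  have hB := num_add (fst hb) (snd hb)
  exact (enough hO H hu hw hG hs hk hB).ite (E := fun _ => listOf (listOf .vertex))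
    (singleton (e := fun _ => listOf .vertex) (probe hO H hu hw hG hs hB)) nil

end Search

end PTime

/-! ### Shortest paths -/

namespace WGraph

variable (G : WGraph)

/-- `W` is a walk from `u` to `v`. -/
structure IsWalk (u v : Fin G.n) (W : List (Fin G.n)) : Prop where
  head : W.head? = some u
  last : W.getLast? = some v
  chain : W.IsChain fun x y => (G.weight x y).isSome

variable {G}

theorem walkLength_cons_cons (u v : Fin G.n) (l : List (Fin G.n)) :
    G.walkLength (u :: v :: l) = (G.weight u v).getD 0 + G.walkLength (v :: l) := rfl

theorem getD_weight_nonneg (u v : Fin G.n) : 0 ≤ (G.weight u v).getD 0 := by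
  cases h : G.weight u v with
  | none => simp
  | some c => simpa using G.weight_nonneg u v c h

theorem walkLength_nonneg (W : List (Fin G.n)) : 0 ≤ G.walkLength W := by
  induction W with
  | nil => exact le_rfl
  | cons u l ih =>
    cases l with
    | nil => exact le_rfl
    | cons v l => exact add_nonneg (getD_weight_nonneg u v) ih

theorem walkLength_concat (W : List (Fin G.n)) (x v : Fin G.n) (h : W.getLast? = some x) :
    G.walkLength (W ++ [v]) = G.walkLength W + (G.weight x v).getD 0 := by
  induction W with
  | nil => simp at h
  | cons u l ih =>
    cases l with
    | nil =>
      simp only [List.getLast?_singleton, Option.some.injEq] at h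
      subst h
      simp [walkLength]
    | cons y l =>
      have := ih (by simpa using h)
      simp only [List.cons_append] at this ⊢
      rw [walkLength_cons_cons, walkLength_cons_cons, this]
      ring

theorem walkLength_reverse (hs : ∀ u v, G.weight u v = G.weight v u) (W : List (Fin G.n)) :
    G.walkLength W.reverse = G.walkLength W := by
  induction W with
  | nil => rfl
  | cons u l ih =>
    cases l with
    | nil => rfl
    | cons v l =>
      rw [List.reverse_cons, walkLength_concat _ v u (by simp), ih, walkLength_cons_cons, hs v u]
      ring

theorem walkLength_le_of_suffix {W W' : List (Fin G.n)} (h : W <:+ W') :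
    G.walkLength W ≤ G.walkLength W' := by
  obtain ⟨l, rfl⟩ := h
  induction l with
  | nil => exact le_rfl
  | cons u l ih =>
    refine ih.trans ?_
    rw [List.cons_append]
    cases h : l ++ W with
    | nil => exact le_rfl
    | cons v l' =>
      rw [walkLength_cons_cons]
      exact le_add_of_nonneg_left (getD_weight_nonneg u v)

theorem IsWalk.reverse (hs : ∀ u v, G.weight u v = G.weight v u) {u v : Fin G.n}
    {W : List (Fin G.n)} (h : G.IsWalk u v W) : G.IsWalk v u W.reverse where
  head := by simpa using h.last
  last := by simpa using h.head
  chain := by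
    rw [List.isChain_reverse]
    exact h.chain.imp fun x y hxy => by rw [hs]; exact hxy

/-- Cutting out closed subwalks does not lengthen a walk, as edge lengths are nonnegative. Hence `n`
rounds of Bellman-Ford suffice. -/
theorem exists_nodup_walk {u v : Fin G.n} {W : List (Fin G.n)} (h : G.IsWalk u v W) :
    ∃ W', G.IsWalk u v W' ∧ W'.Nodup ∧ G.walkLength W' ≤ G.walkLength W := by
  induction W generalizing u with
  | nil => exact absurd h.head (by simp)
  | cons a l ih =>
    obtain rfl : a = u := by simpa using h.head
    cases l with
    | nil => exact ⟨[a], h, by simp, le_rfl⟩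
    | cons b l =>
      have hc := List.isChain_cons_cons.1 h.chain
      obtain ⟨W', h₁, h₂, h₃⟩ := ih (u := b) ⟨rfl, by simpa using h.last, hc.2⟩
      by_cases ha : a ∈ W'
      · obtain ⟨l₁, l₂, rfl⟩ := List.append_of_mem ha
        have hs : a :: l₂ <:+ l₁ ++ a :: l₂ := List.suffix_append _ _
        refine ⟨a :: l₂, ⟨rfl, by simpa using h₁.last, h₁.chain.suffix hs⟩,
          h₂.sublist hs.sublist, ?_⟩
        rw [walkLength_cons_cons]
        have := walkLength_le_of_suffix hs
        have := getD_weight_nonneg a b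
        linarith
      · cases W' with
        | nil => exact absurd h₁.head (by simp)
        | cons b' l' =>
          obtain rfl : b' = b := by simpa using h₁.head
          refine ⟨a :: b' :: l', ⟨rfl, by simpa using h₁.last,
            List.isChain_cons_cons.2 ⟨hc.1, h₁.chain⟩⟩, List.nodup_cons.2 ⟨ha, h₂⟩, ?_⟩
          rw [walkLength_cons_cons, walkLength_cons_cons]
          linarith

theorem time_cons_zero {v : Fin G.n} {c : ℚ} {p : Route G.n} (hc : 0 ≤ c)
    (hp : ∀ e ∈ p, 0 ≤ e.2.1) : Route.time ((v, c, 0) :: p) = Route.time p + c :=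
  max_eq_left (add_nonneg (Route.time_nonneg hp) hc)

theorem exists_walk_of_mem_path {u v : Fin G.n} {p : Route G.n} (hp : p ∈ G.path u v) :
    ∃ W, G.IsWalk u v W ∧ G.walkLength W = p.time := by
  refine (G.path_induction (motive := fun u v p => (∀ e ∈ p, 0 ≤ e.2.1) ∧
    ∃ W, G.IsWalk u v W ∧ G.walkLength W = p.time) ?_ ?_ hp).2
  · exact fun u => ⟨by simp, [u], ⟨rfl, rfl, by simp⟩, rfl⟩
  · rintro u x v p c ⟨hp, W, hW, hl⟩ hc
    have h0 := G.weight_nonneg _ _ _ hc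
    refine ⟨?_, W ++ [v], ⟨?_, by simp, ?_⟩, ?_⟩
    · intro e he
      rcases List.mem_cons.1 he with rfl | he
      · exact h0
      · exact hp e he
    · rw [List.head?_append, hW.head]; rfl
    · refine List.isChain_append.2 ⟨hW.chain, by simp, ?_⟩
      intro y hy z hz
      rw [hW.last] at hy
      obtain rfl : x = y := by simpa using hy
      obtain rfl : v = z := by simpa using hz
      simp [hc]
    · rw [walkLength_concat _ x v hW.last, hl, time_cons_zero h0 hp, hc]
      rfl

/-- Removing the last vertex of the walk reduces to the previous round: after `m` rounds the table
competes with all walks of at most `m` edges. -/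
theorem exists_mem_iterate_pathStep (m : ℕ) {u v : Fin G.n} {W : List (Fin G.n)}
    (hW : G.IsWalk u v W) (hm : W.length ≤ m + 1) :
    ∃ p ∈ G.pathStep^[m] G.trivialPaths u v, p.time ≤ G.walkLength W := by
  induction m generalizing v W with
  | zero =>
    match W, hW, hm with
    | [], hW, _ => exact absurd hW.head (by simp)
    | [a], hW, _ =>
      obtain rfl : a = u := by simpa using hW.head
      obtain rfl : a = v := by simpa using hW.last
      exact ⟨[], by simp [trivialPaths], le_rfl⟩
    | a :: b :: l, _, hm => simp at hm
  | succ m ih =>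
    rw [Function.iterate_succ_apply']
    suffices H : ∃ p ∈ (G.pathStep^[m] G.trivialPaths u v ++ (List.finRange G.n).flatMap fun x =>
        (G.pathStep^[m] G.trivialPaths u x).flatMap fun p =>
          (G.weight x v).toList.map fun c => (v, c, 0) :: p), p.time ≤ G.walkLength W by
      obtain ⟨p, hp, hp'⟩ := H
      obtain ⟨q, -, hq, hq'⟩ := List.exists_best (cost := Route.time) hp
      exact ⟨q, by rw [pathStep, hq]; simp, hq'.trans hp'⟩
    by_cases hlen : W.length ≤ m + 1
    · obtain ⟨p, hp, hp'⟩ := ih hW hlen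
      exact ⟨p, by simp [hp], hp'⟩
    · rcases List.eq_nil_or_concat W with rfl | ⟨W', v', rfl⟩
      · exact absurd hW.head (by simp)
      rw [List.concat_eq_append] at *
      obtain rfl : v' = v := by simpa using hW.last
      have hW' : W' ≠ [] := by rintro rfl; simp at hlen
      obtain ⟨x, hx⟩ : ∃ x, W'.getLast? = some x := ⟨_, List.getLast?_eq_some_getLast hW'⟩
      obtain ⟨h₁, -, h₃⟩ := List.isChain_append.1 hW.chain
      obtain ⟨c, hc⟩ := Option.isSome_iff_exists.1 (h₃ x (by simp [hx]) v' (by simp))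
      have hh : W'.head? = some u := by
        have := hW.head
        rw [List.head?_append_of_ne_nil _ hW'] at this
        exact this
      obtain ⟨p, hp, hp'⟩ := ih (v := x) ⟨hh, hx, h₁⟩ (by simpa using hm)
      refine ⟨(v', c, 0) :: p, ?_, ?_⟩
      · simp only [List.mem_append, List.mem_flatMap, List.mem_map, Option.mem_toList]
        exact .inr ⟨x, List.mem_finRange x, p, hp, c, hc, rfl⟩
      · have hn : ∀ e ∈ p, 0 ≤ e.2.1 :=
          G.iterate_pathStep_induction (motive := fun _ _ _ p => ∀ e ∈ p, 0 ≤ e.2.1) (by simp)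
            (fun _ _ _ _ => id) (fun u x v m p c h hc e he => by
              rcases List.mem_cons.1 he with rfl | he
              · exact G.weight_nonneg _ _ _ hc
              · exact h e he) _ _ _ _ hp
        rw [walkLength_concat _ x v' hx, time_cons_zero (G.weight_nonneg _ _ _ hc) hn, hc]
        simpa using hp'

theorem exists_path_of_walk {u v : Fin G.n} {W : List (Fin G.n)} (hW : G.IsWalk u v W) :
    ∃ p, G.path u v = [p] ∧ p.time ≤ G.walkLength W := by
  obtain ⟨W', h₁, h₂, h₃⟩ := exists_nodup_walk hW
  have hlen : W'.length ≤ G.n + 1 := by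
    have := h₂.length_le_card
    rw [Fintype.card_fin] at this
    omega
  obtain ⟨p, hp, hp'⟩ := exists_mem_iterate_pathStep G.n h₁ hlen
  rw [← pathTable_eq] at hp
  have hl := G.length_path_le u v
  rcases h : G.path u v with - | ⟨q, - | ⟨q', l⟩⟩
  · rw [path] at h; simp [h] at hp
  · rw [path] at h
    rw [h, List.mem_singleton] at hp
    exact ⟨q, rfl, hp ▸ hp'.trans h₃⟩
  · simp [h] at hl

theorem dist_eq_some_iff {u v : Fin G.n} {c : ℚ} :
    G.dist u v = some c ↔ ∃ p, G.path u v = [p] ∧ p.time = c := by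
  have hl := G.length_path_le u v
  rcases h : G.path u v with - | ⟨q, - | ⟨q', l⟩⟩
  · simp [dist, h]
  · simp [dist, h]
  · simp [h] at hl

theorem exists_walk_of_dist {u v : Fin G.n} {c : ℚ} (h : G.dist u v = some c) :
    ∃ W, G.IsWalk u v W ∧ G.walkLength W = c := by
  obtain ⟨p, hp, rfl⟩ := dist_eq_some_iff.1 h
  exact exists_walk_of_mem_path (by simp [hp])

theorem exists_dist_of_walk {u v : Fin G.n} {W : List (Fin G.n)} (hW : G.IsWalk u v W) :
    ∃ c, G.dist u v = some c ∧ c ≤ G.walkLength W := by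
  obtain ⟨p, hp, hp'⟩ := exists_path_of_walk hW
  exact ⟨_, dist_eq_some_iff.2 ⟨p, hp, rfl⟩, hp'⟩

theorem dist_comm (hs : ∀ u v, G.weight u v = G.weight v u) (u v : Fin G.n) :
    G.dist u v = G.dist v u := by
  have key : ∀ u v c, G.dist u v = some c → ∃ c', G.dist v u = some c' ∧ c' ≤ c := by
    intro u v c h
    obtain ⟨W, hW, rfl⟩ := exists_walk_of_dist h
    rw [← walkLength_reverse hs]
    exact exists_dist_of_walk (hW.reverse hs)
  rcases h : G.dist u v with - | c
  · rcases h' : G.dist v u with - | c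
    · rfl
    · obtain ⟨c', h'', -⟩ := key _ _ _ h'
      simp [h] at h''
  · obtain ⟨c', h', hc⟩ := key _ _ _ h
    obtain ⟨c'', h'', hc'⟩ := key _ _ _ h'
    rw [h] at h''
    obtain rfl : c = c'' := by simpa using h''
    rw [h', le_antisymm hc hc']

end WGraph

/-- Reversing walks shows that shortest path lengths in an undirected graph are symmetric, so the
queries stay in the class for which the orienteering algorithm is given. -/
theorem TWInst.allows_groupGraph {κ : GraphKind} (I : TWInst) (h : κ.Allows I.toWGraph) (m : Bool)
    (g : GroupData I.n) : κ.Allows (I.groupGraph m g) := by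
  cases κ with
  | directed => trivial
  | undirected =>
    intro u v
    change I.groupWeight m g u v = I.groupWeight m g v u
    unfold TWInst.groupWeight
    rw [WGraph.dist_comm h u v]
    simp only [and_comm]

/-! ### Running time of one extension of a label -/

def Data.group {n : ℕ} (g : GroupData n) : Data :=
  .pair (.vertex g.p) (.pair (.vertex g.q) (.pair (.vertex g.x) (.pair (.vertex g.y)
    (.pair (.vertex g.u) (.pair (.vertex g.w) (.vertex g.k))))))

def Data.label {n : ℕ} (l : Label n) : Data :=
  .pair (.num l.bound) (.pair (.num l.count) (.route l.route))

namespace PTime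

variable {X : Type} {Γ : X → Data} {n : X → ℕ}

section Group

variable {g : ∀ a, GroupData (n a)}

theorem group_p (hg : PTime Γ fun a => Data.group (g a)) : PTime Γ fun a => .vertex (g a).p := fst hg

theorem group_q (hg : PTime Γ fun a => Data.group (g a)) : PTime Γ fun a => .vertex (g a).q :=
  fst (snd hg)

theorem group_x (hg : PTime Γ fun a => Data.group (g a)) : PTime Γ fun a => .vertex (g a).x :=
  fst (snd (snd hg))

theorem group_y (hg : PTime Γ fun a => Data.group (g a)) : PTime Γ fun a => .vertex (g a).y :=
  fst (snd (snd (snd hg)))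

theorem group_u (hg : PTime Γ fun a => Data.group (g a)) : PTime Γ fun a => .vertex (g a).u :=
  fst (snd (snd (snd (snd hg))))

theorem group_w (hg : PTime Γ fun a => Data.group (g a)) : PTime Γ fun a => .vertex (g a).w :=
  fst (snd (snd (snd (snd (snd hg)))))

theorem group_k (hg : PTime Γ fun a => Data.group (g a)) : PTime Γ fun a => .num ((g a).k : ℕ) :=
  snd (snd (snd (snd (snd (snd hg)))))

variable {l : ∀ a, Label (n a)}

theorem label_bound (hl : PTime Γ fun a => Data.label (l a)) : PTime Γ fun a => .num (l a).bound :=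
  fst hl

theorem label_count (hl : PTime Γ fun a => Data.label (l a)) :
    PTime Γ fun a => .num ((l a).count : ℕ) := fst (snd hl)

theorem label_route (hl : PTime Γ fun a => Data.label (l a)) :
    PTime Γ fun a => Data.route (l a).route := snd (snd hl)

end Group

variable {I : X → TWInst}

theorem code_graph (H : PTime Γ fun a => (I a).enc) : PTime Γ fun a => (I a).toWGraph.code :=
  (fst (fst H)).pair (fst (snd (fst H)))

theorem start (H : PTime Γ fun a => (I a).enc) : PTime Γ fun a => .vertex (I a).s :=
  fst (snd (snd (fst H)))

theorem target (H : PTime Γ fun a => (I a).enc) : PTime Γ fun a => .vertex (I a).t :=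
  fst (snd (snd (snd (fst H))))

theorem limit (H : PTime Γ fun a => (I a).enc) : PTime Γ fun a => .num (I a).T :=
  fst (snd (snd (snd (snd (fst H)))))

theorem window {v : ∀ a, Fin (I a).n} (H : PTime Γ fun a => (I a).enc)
    (hv : PTime Γ fun a => .vertex (v a)) :
    PTime Γ fun a => .pair (.num ((I a).R (v a))) (.num ((I a).D (v a))) :=
  lookup (y := fun a v => .pair (.num ((I a).R v)) (.num ((I a).D v))) (snd H) hv

theorem key {v : ∀ a, Fin (I a).n} (m : Bool) (H : PTime Γ fun a => (I a).enc)
    (hv : PTime Γ fun a => .vertex (v a)) : PTime Γ fun a => .num ((I a).key m (v a)) := by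
  cases m with
  | true => exact snd (window H hv)
  | false => exact fst (window H hv)

theorem inGroup {v : ∀ a, Fin (I a).n} {g : ∀ a, GroupData (I a).n} (m : Bool)
    (H : PTime Γ fun a => (I a).enc) (hg : PTime Γ fun a => Data.group (g a))
    (hv : PTime Γ fun a => .vertex (v a)) : PolyDec Γ fun a => (I a).InGroup m (g a) (v a) :=
  (PolyDec.le (fst (window H hv)) (fst (window H (group_p hg)))).and
    ((PolyDec.le (snd (window H (group_q hg))) (snd (window H hv))).and
      ((PolyDec.le (key m H (group_x hg)) (key m H hv)).and
        (PolyDec.le (key m H hv) (key m H (group_y hg)))))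

theorem groupWeight {u v : ∀ a, Fin (I a).n} {g : ∀ a, GroupData (I a).n} (m : Bool)
    (H : PTime Γ fun a => (I a).enc) (hg : PTime Γ fun a => Data.group (g a))
    (hu : PTime Γ fun a => .vertex (u a)) (hv : PTime Γ fun a => .vertex (v a)) :
    PTime Γ fun a => .ofOption ((I a).groupWeight m (g a) (u a) (v a)) :=
  ((inGroup m H hg hu).and (inGroup m H hg hv)).ite (E := fun _ => .ofOption)
    (dist (code_graph H) hu hv) (.const .nil)

theorem groupWeight_row {u : ∀ a, Fin (I a).n} {g : ∀ a, GroupData (I a).n} (m : Bool)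
    (H : PTime Γ fun a => (I a).enc) (hg : PTime Γ fun a => Data.group (g a))
    (hu : PTime Γ fun a => .vertex (u a)) :
    PTime Γ fun a => listOf (fun v => .ofOption ((I a).groupWeight m (g a) (u a) v))
      (List.finRange (I a).n) :=
  map (B := fun a => Fin (I a).n) (e := fun _ => .vertex)
    (y := fun p => .ofOption ((I p.1).groupWeight m (g p.1) (u p.1) p.2)) (verts (code_graph H))
    (groupWeight m H.weak hg.weak hu.weak last)

theorem groupWeight_table {g : ∀ a, GroupData (I a).n} (m : Bool)
    (H : PTime Γ fun a => (I a).enc) (hg : PTime Γ fun a => Data.group (g a)) :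
    PTime Γ fun a => listOf (fun u => listOf (fun v => .ofOption ((I a).groupWeight m (g a) u v))
      (List.finRange (I a).n)) (List.finRange (I a).n) :=
  map (B := fun a => Fin (I a).n) (e := fun _ => .vertex)
    (y := fun p => listOf (fun v => .ofOption ((I p.1).groupWeight m (g p.1) p.2 v))
    (List.finRange (I p.1).n)) (verts (code_graph H)) (groupWeight_row m H.weak hg.weak last)

theorem groupGraph {g : ∀ a, GroupData (I a).n} (m : Bool)
    (H : PTime Γ fun a => (I a).enc) (hg : PTime Γ fun a => Data.group (g a)) :
    PTime Γ fun a => ((I a).groupGraph m (g a)).code :=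
  (fst (fst H)).pair (groupWeight_table m H hg)

theorem groups (H : PTime Γ fun a => (I a).enc) :
    PTime Γ fun a => listOf Data.group (I a).groups := by
  have hV := verts (code_graph H)
  exact (hV.product (hV.product (hV.product (hV.product (hV.product (hV.product hV)))))).congr
    fun a => by rw [TWInst.groups, Data.listOf_map]; rfl

variable {κ : GraphKind} {O : (J : OrientInst) → List (Fin J.n)}

theorem groupWeight_isSome {u v : ∀ a, Fin (I a).n} {g : ∀ a, GroupData (I a).n} (m : Bool)
    (H : PTime Γ fun a => (I a).enc) (hg : PTime Γ fun a => Data.group (g a))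
    (hu : PTime Γ fun a => .vertex (u a)) (hv : PTime Γ fun a => .vertex (v a)) :
    PolyDec Γ fun a => ((I a).groupWeight m (g a) (u a) (v a)).isSome :=
  (PolyDec.truthy (groupWeight m H hg hu hv)).congr fun a => by
    cases (I a).groupWeight m (g a) (u a) (v a) <;> simp [Data.ofOption]

theorem groupWalks {g : ∀ a, GroupData (I a).n} (m : Bool)
    (hO : PTime (X := {J : OrientInst // κ.Allows J.toWGraph ∧ ∃ W, J.Feasible W})
      (fun J => J.1.enc) fun J => listOf .vertex (O J.1))
    (hI : ∀ a, κ.Allows (I a).toWGraph)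
    (H : PTime Γ fun a => (I a).enc) (hg : PTime Γ fun a => Data.group (g a)) :
    PTime Γ fun a => listOf (listOf .vertex) ((I a).groupWalks O m (g a)) := by
  refine (groupWeight_isSome m H hg (group_u hg) (group_w hg)).dite
    (y := fun a => listOf (listOf .vertex)
      (((I a).groupGraph m (g a)).search O (g a).u (g a).w (g a).k (I a).T))
    (z := fun _ => .nil) ?_ (.const .nil) (fun a ha => by rw [TWInst.groupWalks, if_pos ha])
    (fun a ha => by rw [TWInst.groupWalks, if_neg ha]; rfl)
  have H' := H.reindex (Subtype.val (p := fun a =>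
    ((I a).groupWeight m (g a) (g a).u (g a).w).isSome))
  have hg' := hg.reindex (Subtype.val (p := fun a =>
    ((I a).groupWeight m (g a) (g a).u (g a).w).isSome))
  exact search (G := fun a : {a // ((I a).groupWeight m (g a) (g a).u (g a).w).isSome} =>
    (I a.1).groupGraph m (g a.1)) hO (groupGraph m H' hg') (group_u hg') (group_w hg')
    (fun a => (I a.1).allows_groupGraph (hI a.1) m (g a.1)) (fun a => a.2) (group_k hg') (limit H')

theorem visit {g : ∀ a, GroupData (I a).n} {l : ∀ a, Label (I a).n} {p : ∀ a, Route (I a).n}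
    {W : ∀ a, List (Fin (I a).n)} (m : Bool)
    (H : PTime Γ fun a => (I a).enc) (hg : PTime Γ fun a => Data.group (g a))
    (hl : PTime Γ fun a => Data.label (l a)) (hp : PTime Γ fun a => Data.route (p a))
    (hW : PTime Γ fun a => listOf .vertex (W a)) :
    PTime Γ fun a => listOf Data.label ((I a).visit m (l a) (g a) (p a) (W a)) := by
  have hr := ride (code_graph H) (fst (window H (group_p hg))) hW (append hp (label_route hl))
  refine (PolyDec.le (time hr) (snd (window H (group_q hg)))).ite
    (E := fun _ => listOf Data.label) (singleton ?_) nil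
  exact pair (key m H (group_y hg)) (pair ((num_add (label_count hl)
    (num_add (group_k hg) (.const (.num 1)))).congr fun p => by push_cast; rfl) hr)

theorem extend {g : ∀ a, GroupData (I a).n} {l : ∀ a, Label (I a).n} (m : Bool)
    (hO : PTime (X := {J : OrientInst // κ.Allows J.toWGraph ∧ ∃ W, J.Feasible W})
      (fun J => J.1.enc) fun J => listOf .vertex (O J.1))
    (hI : ∀ a, κ.Allows (I a).toWGraph)
    (H : PTime Γ fun a => (I a).enc) (hg : PTime Γ fun a => Data.group (g a))
    (hl : PTime Γ fun a => Data.label (l a)) :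
    PTime Γ fun a => listOf Data.label ((I a).extend O m (l a) (g a)) := by
  refine (PolyDec.lt (label_bound hl) (key m H (group_x hg))).ite
    (E := fun _ => listOf Data.label) ?_ nil
  refine flatMap (take_one (label_route hl)) ?_
  refine flatMap (path (code_graph H.weak) (entry_fst last) (group_u hg.weak)) ?_
  have hp : PTime (X := Σ p : (Σ a, Fin (I a).n × ℚ × ℚ), Route (I p.1).n)
    (fun p => .pair (.pair (Γ p.1.1) (Data.entry p.1.2)) (Data.route p.2))
    fun p => Data.route p.2 := last
  exact flatMap (e := fun _ => listOf .vertex) (groupWalks m hO hI H hg).weak₂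
    (visit m H.weak₃ hg.weak₃ hl.weak₃ hp.weak last)

end PTime

/-! ### Number and size of the labels -/

theorem List.length_flatMap_le {β γ : Type} {l : List β} {f : β → List γ} {M : ℕ}
    (h : ∀ b ∈ l, (f b).length ≤ M) : (l.flatMap f).length ≤ l.length * M := by
  induction l with
  | nil => simp
  | cons b l ih =>
    have h₁ := h b (by simp)
    have h₂ := ih fun c hc => h c (by simp [hc])
    rw [List.flatMap_cons, List.length_append, List.length_cons, Nat.add_mul]
    omega

namespace TWInst

variable (I : TWInst) (O : (J : OrientInst) → List (Fin J.n))

theorem mem_select {ls : List (Label I.n)} {h : ℚ} {v : Fin I.n} {c : ℕ} {l : Label I.n}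
    (hl : l ∈ I.select ls h v c) :
    l ∈ ls ∧ l.bound = h ∧ l.count = c ∧ ∃ e ∈ l.route.head?, e.1 = v := by
  have := List.mem_of_mem_best hl
  simp only [List.mem_flatMap] at this
  obtain ⟨l', hl', e, he, this⟩ := this
  split_ifs at this with hc
  · rw [List.mem_singleton] at this
    subst this
    refine ⟨hl', hc.1, by exact_mod_cast hc.2.2, e, ?_, hc.2.1⟩
    rcases hr : l.route with - | ⟨e', r⟩
    · simp [hr] at he
    · simp only [hr, List.take_succ_cons, List.take_zero, List.mem_singleton] at he
      simp [he]
  · simp at this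

theorem mem_counts {c : ℕ} : c ∈ I.counts ↔ c ≤ I.n := by
  simp only [counts, List.mem_cons, List.mem_map, List.mem_finRange, true_and]
  constructor
  · rintro (rfl | ⟨k, rfl⟩)
    · omega
    · exact k.isLt
  · intro h
    rcases Nat.eq_zero_or_pos c with h0 | h0
    · exact .inl h0
    · exact .inr ⟨⟨c - 1, by omega⟩, by simp; omega⟩

theorem mem_prune {m : Bool} {ls : List (Label I.n)} {l : Label I.n} (hl : l ∈ I.prune m ls) :
    l ∈ ls ∧ l.bound ∈ I.bounds m ∧ l.count ≤ I.n := by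
  simp only [prune, List.mem_flatMap] at hl
  obtain ⟨h, hh, v, -, c, hc, hl⟩ := hl
  obtain ⟨h₁, h₂, h₃, -⟩ := I.mem_select hl
  exact ⟨h₁, h₂ ▸ hh, h₃ ▸ (I.mem_counts).1 hc⟩

/-- There are `n + 1` bounds, `n` positions and `n + 1` counts, with at most one label for each
combination, however many labels were generated. -/
theorem length_prune_le (m : Bool) (ls : List (Label I.n)) :
    (I.prune m ls).length ≤ (I.n + 1) * (I.n * ((I.n + 1) * 1)) := by
  refine (List.length_flatMap_le (M := I.n * ((I.n + 1) * 1)) fun h _ => ?_).trans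
    (by simp [bounds])
  refine (List.length_flatMap_le (M := (I.n + 1) * 1) fun h _ => ?_).trans (by simp)
  exact (List.length_flatMap_le fun h _ => List.length_best_le _).trans (by simp [counts])

/-- All walks through groups. -/
def walkPool (m : Bool) : List (List (Fin I.n)) := I.groups.flatMap fun g => I.groupWalks O m g

theorem mem_groups (g : GroupData I.n) : g ∈ I.groups := by
  simp only [groups, List.mem_map]
  exact ⟨(g.p, g.q, g.x, g.y, g.u, g.w, g.k), by simp, rfl⟩

/-- A bound for the growth of a route under one extension. -/
def growth (m : Bool) : ℕ :=
  (Data.table I.toWGraph.pathTable).size + I.enc.size +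
    (listOf (listOf .vertex) (I.walkPool O m)).size * (Data.table I.toWGraph.pathTable).size

theorem mem_extend {m : Bool} {l l' : Label I.n} {g : GroupData I.n} (h : l' ∈ I.extend O m l g) :
    l.bound < I.key m g.x ∧ ∃ e ∈ l.route.head?, ∃ p ∈ I.toWGraph.path e.1 g.u,
      ∃ W ∈ I.groupWalks O m g, (I.toWGraph.ride (I.R g.p) W (p ++ l.route)).time ≤ I.D g.q ∧
        l' = ⟨I.key m g.y, l.count + (g.k + 1), I.toWGraph.ride (I.R g.p) W (p ++ l.route)⟩ := by
  unfold extend at h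
  split_ifs at h with hb
  · simp only [List.mem_flatMap] at h
    obtain ⟨e, he, p, hp, W, hW, h⟩ := h
    unfold visit at h
    split_ifs at h with ht
    · refine ⟨hb, e, ?_, p, hp, W, hW, ht, List.mem_singleton.1 h⟩
      rcases hr : l.route with - | ⟨e', r⟩
      · simp [hr] at he
      · simp only [hr, List.take_succ_cons, List.take_zero, List.mem_singleton] at he
        simp [he]
    · simp at h
  · simp at h

theorem size_extend_le {m : Bool} {l l' : Label I.n} {g : GroupData I.n}
    (h : l' ∈ I.extend O m l g) :
    (Data.route l'.route).size ≤ (Data.route l.route).size + I.growth O m := by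
  obtain ⟨-, e, -, p, hp, W, hW, -, rfl⟩ := I.mem_extend O h
  have h₁ := I.toWGraph.size_ride_le (I.R g.p) W (p ++ l.route)
  have h₂ := Data.size_route_append p l.route
  have h₃ := I.toWGraph.size_path_lt hp
  have h₄ : (Data.num (I.R g.p)).size < I.enc.size := by
    have e₁ := Data.size_lt_of_mem (e := fun v => Data.pair (.num (I.R v)) (.num (I.D v)))
      (List.mem_finRange g.p)
    have e₂ : I.enc.size = 1 + I.toOrientInst.enc.size + (listOf (fun v => Data.pair (.num (I.R v))
      (.num (I.D v))) (List.finRange I.n)).size := rfl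
    simp only [Data.size] at e₁ e₂ ⊢
    omega
  have h₅ : W.length ≤ (listOf (listOf .vertex) (I.walkPool O m)).size := by
    have e₁ := Data.length_lt_size (e := Data.vertex) W
    have hmem : W ∈ I.walkPool O m := List.mem_flatMap.2 ⟨g, I.mem_groups g, hW⟩
    have e₂ := Data.size_lt_of_mem (e := listOf .vertex) hmem
    omega
  have h₆ : W.length * (Data.table I.toWGraph.pathTable).size ≤
    (listOf (listOf .vertex) (I.walkPool O m)).size * (Data.table I.toWGraph.pathTable).size := by
    gcongr
  unfold growth
  simp only
  omega

/-- After pruning, bounds and counts belong to lists fixed by the instance. Only the routes grow, by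
at most `growth` per round. -/
theorem mem_iterate_round {m : Bool} {i : ℕ} {l : Label I.n}
    (hl : l ∈ (I.round O m)^[i] (I.initial m)) :
    (Data.route l.route).size ≤ (Data.route [(I.s, (0 : ℚ), (0 : ℚ))]).size + i * I.growth O m ∧
      l.bound ∈ I.bounds m ∧ l.count ≤ I.n := by
  induction i generalizing l with
  | zero =>
    simp only [Function.iterate_zero, id_eq, initial, List.mem_singleton] at hl
    subst hl
    simp [bounds]
  | succ i ih =>
    rw [Function.iterate_succ_apply'] at hl
    obtain ⟨h₁, h₂, h₃⟩ := I.mem_prune hl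
    refine ⟨?_, h₂, h₃⟩
    rw [Nat.add_mul i]
    rcases List.mem_append.1 h₁ with h₁ | h₁
    · have := (ih h₁).1
      omega
    · simp only [List.mem_flatMap] at h₁
      obtain ⟨l₀, hl₀, g, -, h₁⟩ := h₁
      have h₄ := (ih hl₀).1
      have h₅ := I.size_extend_le O h₁
      omega

theorem length_iterate_round_le (m : Bool) (i : ℕ) :
    ((I.round O m)^[i] (I.initial m)).length ≤ 1 + (I.n + 1) * (I.n * ((I.n + 1) * 1)) := by
  cases i with
  | zero => simp [initial]
  | succ i =>
    rw [Function.iterate_succ_apply']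
    exact (I.length_prune_le m _).trans (by omega)

end TWInst

/-! ### Running time of the dynamic program -/

namespace PTime

variable {X : Type} {Γ : X → Data} {I : X → TWInst} {κ : GraphKind}
  {O : (J : OrientInst) → List (Fin J.n)}

theorem num_min {p q : X → ℚ} (hp : PTime Γ fun a => .num (p a))
    (hq : PTime Γ fun a => .num (q a)) : PTime Γ fun a => .num (min (p a) (q a)) :=
  ((PolyDec.le hp hq).ite (E := fun _ => Data.num) hp hq).congr fun a => by rw [min_def]

theorem keys (m : Bool) (H : PTime Γ fun a => (I a).enc) :
    PTime Γ fun a => listOf .num ((List.finRange (I a).n).map ((I a).key m)) :=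
  map' (e := fun _ => .vertex) (verts (code_graph H)) (key m H.weak last)

theorem bottom (m : Bool) (H : PTime Γ fun a => (I a).enc) :
    PTime Γ fun a => .num ((I a).bottom m) := by
  refine num_sub ?_ (.const (.num 1))
  refine foldl (S := fun _ => ℚ) (es := fun _ => .num) (verts (code_graph H)) (.const (.num 0))
    (num_min acc (key m H.weak elt))
    (M := fun a => 2 + (listOf .num ((List.finRange (I a).n).map ((I a).key m))).size)
    ((PolyBdd.const 2).add (keys m H).size) fun a pre _ => ?_
  induction pre using List.reverseRecOn with
  | nil =>
    have h : (Data.num 0).size = 2 := rfl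
    exact h.le.trans (Nat.le_add_right 2 _)
  | append_singleton pre v ih =>
    rw [List.foldl_append, List.foldl_cons, List.foldl_nil]
    rcases min_choice (pre.foldl (fun s v => min s ((I a).key m v)) 0) ((I a).key m v) with h | h
    · rw [h]; exact ih (by assumption |> fun h => (List.prefix_append _ _).trans h)
    · rw [h]
      have := Data.size_lt_of_mem (e := Data.num)
        (List.mem_map_of_mem (f := (I a).key m) (List.mem_finRange v))
      omega

theorem bounds (m : Bool) (H : PTime Γ fun a => (I a).enc) :
    PTime Γ fun a => listOf .num ((I a).bounds m) := cons (bottom m H) (keys m H)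

theorem counts (H : PTime Γ fun a => (I a).enc) :
    PTime Γ fun a => listOf (fun c : ℕ => .num c) (I a).counts :=
  cons (e := fun _ (c : ℕ) => .num c) (.const (.num ((0 : ℕ) : ℚ)))
    (map' (e := fun _ => .vertex) (e' := fun _ (c : ℕ) => .num c) (f := fun _ k => (k : ℕ) + 1)
      (verts (code_graph H)) ((num_add last (.const (.num 1))).congr fun p => by push_cast; rfl))

theorem select {ls : ∀ a, List (Label (I a).n)} {h : X → ℚ} {v : ∀ a, Fin (I a).n} {c : X → ℕ}
    (hls : PTime Γ fun a => listOf Data.label (ls a)) (hh : PTime Γ fun a => .num (h a))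
    (hv : PTime Γ fun a => .vertex (v a)) (hc : PTime Γ fun a => .num (c a)) :
    PTime Γ fun a => listOf Data.label ((I a).select (ls a) (h a) (v a) (c a)) := by
  refine best (flatMap hls ?_) (time (label_route last))
  have hl : PTime (X := Σ a, Label (I a).n) (fun p => .pair (Γ p.1) (Data.label p.2))
    fun p => Data.label p.2 := last
  refine flatMap (e := fun _ => Data.entry) (take_one (label_route hl)) ?_
  exact ((PolyDec.eq (label_bound hl.weak) hh.weak₂).and ((PolyDec.vertex_eq (entry_fst last)
    hv.weak₂).and (PolyDec.eq (label_count hl.weak) hc.weak₂))).ite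
    (E := fun _ => listOf Data.label) (singleton hl.weak) nil

theorem prune {ls : ∀ a, List (Label (I a).n)} (m : Bool) (H : PTime Γ fun a => (I a).enc)
    (hls : PTime Γ fun a => listOf Data.label (ls a)) :
    PTime Γ fun a => listOf Data.label ((I a).prune m (ls a)) := by
  refine flatMap (bounds m H) ?_
  have hh : PTime (X := Σ _ : X, ℚ) (fun p => .pair (Γ p.1) (.num p.2)) fun p => .num p.2 := last
  refine flatMap (e := fun _ => .vertex) (verts (code_graph H.weak)) ?_
  have hv : PTime (X := Σ p : (Σ _ : X, ℚ), Fin (I p.1).n)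
    (fun p => .pair (.pair (Γ p.1.1) (.num p.1.2)) (.vertex p.2)) fun p => .vertex p.2 := last
  exact flatMap (e := fun _ (c : ℕ) => .num c) (counts H.weak₂)
    (select hls.weak₃ hh.weak₂ hv.weak last)

theorem initial (m : Bool) (H : PTime Γ fun a => (I a).enc) :
    PTime Γ fun a => listOf Data.label ((I a).initial m) :=
  singleton (pair (bottom m H) (pair (.const (.num ((0 : ℕ) : ℚ)))
    (singleton (entry (start H) (.const (.num 0)) (.const (.num 0))))))

theorem round {ls : ∀ a, List (Label (I a).n)}
    (hO : PTime (X := {J : OrientInst // κ.Allows J.toWGraph ∧ ∃ W, J.Feasible W})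
      (fun J => J.1.enc) fun J => listOf .vertex (O J.1))
    (m : Bool)
    (hI : ∀ a, κ.Allows (I a).toWGraph) (H : PTime Γ fun a => (I a).enc)
    (hls : PTime Γ fun a => listOf Data.label (ls a)) :
    PTime Γ fun a => listOf Data.label ((I a).round O m (ls a)) := by
  refine prune m H (append hls (flatMap hls ?_))
  have hl : PTime (X := Σ a, Label (I a).n) (fun p => .pair (Γ p.1) (Data.label p.2))
    fun p => Data.label p.2 := last
  exact flatMap (e := fun _ => Data.group) (groups H.weak)
    (extend m hO (fun p => hI p.1.1) H.weak₂ last hl.weak)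

theorem growth
    (hO : PTime (X := {J : OrientInst // κ.Allows J.toWGraph ∧ ∃ W, J.Feasible W})
      (fun J => J.1.enc) fun J => listOf .vertex (O J.1))
    (m : Bool) (hI : ∀ a, κ.Allows (I a).toWGraph) (H : PTime Γ fun a => (I a).enc) :
    PolyBdd Γ fun a => (I a).growth O m := by
  have h₁ := (pathTable (code_graph H)).size
  have h₂ : PTime Γ fun a => listOf (listOf .vertex) ((I a).walkPool O m) :=
    flatMap (e := fun _ => Data.group) (groups H) (groupWalks m hO (fun p => hI p.1) H.weak last)
  exact (h₁.add H.size).add (h₂.size.mul h₁)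

theorem labels
    (hO : PTime (X := {J : OrientInst // κ.Allows J.toWGraph ∧ ∃ W, J.Feasible W})
      (fun J => J.1.enc) fun J => listOf .vertex (O J.1))
    (m : Bool) (hI : ∀ a, κ.Allows (I a).toWGraph) (H : PTime Γ fun a => (I a).enc) :
    PTime Γ fun a => listOf Data.label ((I a).labels O m) := by
  have hn := n_bdd (code_graph H)
  have hs : PTime Γ fun a => Data.route [((I a).s, (0 : ℚ), (0 : ℚ))] :=
    singleton (entry (start H) (.const (.num 0)) (.const (.num 0)))
  have hroute := hs.size.add (hn.mul (growth hO m hI H))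
  refine foldl (S := fun a => List (Label (I a).n)) (es := fun _ => listOf Data.label)
    (verts (code_graph H)) (initial m H) (round hO m (fun p => hI p.1) H.weak acc)
    (M := fun a => 1 + (1 + ((I a).n + 1) * ((I a).n * (((I a).n + 1) * 1))) *
      (1 + (1 + (listOf .num ((I a).bounds m)).size + (1 + (3 + 2 * (I a).n) +
        ((Data.route [((I a).s, (0 : ℚ), (0 : ℚ))]).size + (I a).n * (I a).growth O m))))) ?_ ?_
  · have hn1 := hn.add (.const 1)
    exact (PolyBdd.const 1).add (((PolyBdd.const 1).add (hn1.mul (hn.mul (hn1.mul (.const 1))))).mul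
      ((PolyBdd.const 1).add (((PolyBdd.const 1).add (bounds m H).size).add (((PolyBdd.const 1).add
      ((PolyBdd.const 3).add ((PolyBdd.const 2).mul hn))).add hroute))))
  · intro a pre hpre
    have hlen : pre.length ≤ (I a).n := by simpa using hpre.length_le
    rw [List.foldl_const]
    refine (Data.size_listOf_le (M := (1 + (listOf .num ((I a).bounds m)).size +
      (1 + (3 + 2 * (I a).n) + ((Data.route [((I a).s, (0 : ℚ), (0 : ℚ))]).size +
      (I a).n * (I a).growth O m)))) fun l hl => ?_).trans ?_
    · obtain ⟨h₁, h₂, h₃⟩ := (I a).mem_iterate_round O hl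
      have h₄ := Data.size_lt_of_mem (e := Data.num) h₂
      have h₅ := Data.size_natCast_le l.count
      have h₆ : pre.length * (I a).growth O m ≤ (I a).n * (I a).growth O m := by gcongr
      have h₇ : (Data.label l).size = 1 + (Data.num l.bound).size + (1 + (Data.num l.count).size +
        (Data.route l.route).size) := rfl
      omega
    · have := (I a).length_iterate_round_le O m pre.length
      gcongr

theorem finals
    (hO : PTime (X := {J : OrientInst // κ.Allows J.toWGraph ∧ ∃ W, J.Feasible W})
      (fun J => J.1.enc) fun J => listOf .vertex (O J.1))
    (m : Bool) (hI : ∀ a, κ.Allows (I a).toWGraph) (H : PTime Γ fun a => (I a).enc) :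
    PTime Γ fun a => listOf (fun x : ℕ × Route (I a).n => .pair (.num x.1) (.route x.2))
      ((I a).finals O m) := by
  refine flatMap (labels hO m hI H) ?_
  have hl : PTime (X := Σ a, Label (I a).n) (fun p => .pair (Γ p.1) (Data.label p.2))
    fun p => Data.label p.2 := last
  refine flatMap (e := fun _ => Data.entry) (take_one (label_route hl)) ?_
  refine flatMap (path (code_graph H.weak₂) (entry_fst last) (target H.weak₂)) ?_
  have hr : PTime (X := Σ p : (Σ p : (Σ a, Label (I a).n), Fin (I p.1).n × ℚ × ℚ),
      Route (I p.1.1).n) (fun p => .pair (.pair (.pair (Γ p.1.1.1) (Data.label p.1.1.2))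
        (Data.entry p.1.2)) (Data.route p.2)) fun p => Data.route (p.2 ++ p.1.1.2.route) :=
    append last (label_route hl).weak₂
  exact (PolyDec.le (time hr) (limit H.weak₃)).ite
    (E := fun p => listOf fun x : ℕ × Route (I p.1.1.1).n => .pair (.num x.1) (.route x.2))
    (singleton (X := Σ p : (Σ p : (Σ a, Label (I a).n), Fin (I p.1).n × ℚ × ℚ), Route (I p.1.1).n)
      (e := fun p => fun x : ℕ × Route (I p.1.1.1).n => .pair (.num x.1) (.route x.2))
      (b := fun p => (p.1.1.2.count, p.2 ++ p.1.1.2.route)) (pair (label_count hl).weak₂ hr)) nil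

theorem solve
    (hO : PTime (X := {J : OrientInst // κ.Allows J.toWGraph ∧ ∃ W, J.Feasible W})
      (fun J => J.1.enc) fun J => listOf .vertex (O J.1))
    (hI : ∀ a, κ.Allows (I a).toWGraph) (H : PTime Γ fun a => (I a).enc) :
    PTime Γ fun a => listOf (fun x => .pair (.vertex x.1) (.num x.2)) ((I a).solve O) := by
  refine flatMap (best (append (finals hO true hI H) (finals hO false hI H)) ?_) (schedule (snd last))
  exact (num_sub (.const (.num 0)) (fst last)).congr fun p => by rw [zero_sub]

end PTime

/-! ### Correctness of the search for short walks -/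

namespace WGraph

variable {G : WGraph} {O : (J : OrientInst) → List (Fin J.n)} {u w : Fin G.n} {k : ℕ} {T : ℚ}

/-- `Q` is the product of the denominators of all edge lengths. `precision` counts the bits of `T +
1` and of all these denominators, so that after as many halvings the gap `T + 1` has shrunk below
`1/Q`. -/
theorem exists_common_den : ∃ Q : ℕ, 0 < Q ∧
    (∀ u v c, G.weight u v = some c → c.den ∣ Q) ∧
    (T + 1) * Q < 2 ^ (G.precision T).length := by
  let d : Fin G.n → Fin G.n → ℕ := fun u v => (G.weight u v).elim 1 Rat.den
  have hd : ∀ u v, d u v ≤ 2 ^ ((G.weight u v).toList.flatMap fun c =>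
      Rat.bits (c.den : ℕ)).length := by
    intro u v
    rcases h : G.weight u v with - | c
    · simp [d, h]
    · have := (Rat.lt_two_pow_bits (c.den : ℕ)).le
      simp only [d, h, Option.elim_some, Option.toList_some, List.flatMap_cons, List.flatMap_nil,
        List.append_nil]
      exact_mod_cast this
  have hpos : 0 < ∏ u, ∏ v, d u v := by
    refine Finset.prod_pos fun u _ => Finset.prod_pos fun v _ => ?_
    rcases h : G.weight u v with - | c
    · simp [d, h]
    · simpa [d, h] using c.den_pos
  refine ⟨∏ u, ∏ v, d u v, hpos, ?_, ?_⟩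
  · intro u v c h
    have h₁ : c.den = d u v := by simp [d, h]
    rw [h₁]
    exact (Finset.dvd_prod_of_mem _ (Finset.mem_univ v)).trans
      (Finset.dvd_prod_of_mem (fun u => ∏ v, d u v) (Finset.mem_univ u))
  · have hle : ∏ u, ∏ v, d u v ≤ 2 ^ ((List.finRange G.n).flatMap fun u =>
        (List.finRange G.n).flatMap fun v => (G.weight u v).toList.flatMap fun c =>
          Rat.bits (c.den : ℕ)).length := by
      simp only [List.length_flatMap (l := List.finRange G.n)]
      rw [← Fin.sum_univ_def, ← Finset.prod_pow_eq_pow_sum]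
      refine Finset.prod_le_prod' fun u _ => ?_
      rw [← Fin.sum_univ_def, ← Finset.prod_pow_eq_pow_sum]
      exact Finset.prod_le_prod' fun v _ => hd u v
    have hle' : ((∏ u, ∏ v, d u v : ℕ) : ℚ) ≤ 2 ^ ((List.finRange G.n).flatMap fun u =>
        (List.finRange G.n).flatMap fun v => (G.weight u v).toList.flatMap fun c =>
          Rat.bits (c.den : ℕ)).length := by exact_mod_cast hle
    rw [precision, List.length_append, pow_add]
    exact mul_lt_mul (Rat.lt_two_pow_bits _) hle' (by exact_mod_cast hpos) (by positivity)

theorem exists_int_walkLength {Q : ℕ} (h : ∀ u v c, G.weight u v = some c → c.den ∣ Q)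
    (W : List (Fin G.n)) : ∃ z : ℤ, G.walkLength W * Q = z := by
  induction W with
  | nil => exact ⟨0, by simp [walkLength]⟩
  | cons u l ih =>
    cases l with
    | nil => exact ⟨0, by simp [walkLength]⟩
    | cons v l =>
      obtain ⟨z, hz⟩ := ih
      rcases h' : G.weight u v with - | c
      · exact ⟨z, by simp [walkLength_cons_cons, h', hz]⟩
      · obtain ⟨m, rfl⟩ := h u v c h'
        refine ⟨c.num * m + z, ?_⟩
        rw [walkLength_cons_cons, h', add_mul, hz]
        push_cast
        rw [Option.getD_some, ← mul_assoc, Rat.mul_den_eq_num]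

/-- `Enough` need not be monotone in the budget. It suffices that the upper end stays sufficient and
that the lower end stays below `b`: it moves only to insufficient budgets, and none of these is at
least `b`. -/
theorem bisect_spec {b : ℚ} (hb : 0 ≤ b) (hT : b ≤ T) (hE : ∀ B, b ≤ B → G.Enough O u w k B) :
    (G.bisect O u w k T).1 < b ∧
      G.Enough O u w k ((G.bisect O u w k T).1 + (G.bisect O u w k T).2) ∧
      (G.bisect O u w k T).2 * 2 ^ (G.precision T).length = T + 1 := by
  unfold bisect
  rw [List.foldl_const]
  induction (G.precision T).length with
  | zero => exact ⟨by simp; linarith, by simpa using hE T hT, by simp⟩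
  | succ i ih =>
    obtain ⟨h₁, h₂, h₃⟩ := ih
    rw [Function.iterate_succ_apply']
    set s := (fun s => G.bisectStep O u w k s)^[i] (-1, T + 1)
    unfold bisectStep
    split_ifs with h
    · exact ⟨h₁, h, by rw [pow_succ, ← h₃]; ring⟩
    · refine ⟨lt_of_not_ge fun h' => h (hE _ h'), ?_, by rw [pow_succ, ← h₃]; ring⟩
      have : s.1 + s.2 * (1 / 2) + s.2 * (1 / 2) = s.1 + s.2 := by ring
      simpa only [this] using h₂

/-- If the bisected budget is binding, the walk found is shorter than `W₀` plus `1/Q`. Both lengths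
are multiples of `1/Q`, so it is no longer than `W₀`. If the budget was raised to the direct edge,
`hd` gives the same conclusion. -/
theorem exists_search (hO : ∀ B, (G.query u w B).Feasible (O (G.query u w B)))
    {W₀ : List (Fin G.n)} (hd : (G.weight u w).getD 0 ≤ G.walkLength W₀)
    (hT : G.walkLength W₀ ≤ T) (hE : ∀ B, G.walkLength W₀ ≤ B → G.Enough O u w k B) :
    ∃ W ∈ G.search O u w k T, G.walkLength W ≤ G.walkLength W₀ := by
  have hW₀ := walkLength_nonneg W₀
  obtain ⟨h₁, h₂, h₃⟩ := bisect_spec (walkLength_nonneg W₀) hT hE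
  refine ⟨O (G.query u w ((G.bisect O u w k T).1 + (G.bisect O u w k T).2)),
    by rw [search, if_pos h₂]; simp, ?_⟩
  obtain ⟨Q, hQ, hdvd, hlt⟩ := G.exists_common_den (T := T)
  have hle := (hO ((G.bisect O u w k T).1 + (G.bisect O u w k T).2)).length_le
  set W := O (G.query u w ((G.bisect O u w k T).1 + (G.bisect O u w k T).2))
  obtain ⟨z, hz⟩ := exists_int_walkLength hdvd W
  obtain ⟨z₀, hz₀⟩ := exists_int_walkLength hdvd W₀
  have hQ' : (0 : ℚ) < Q := by exact_mod_cast hQ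
  have hgap : (G.bisect O u w k T).2 * Q < 1 := by
    rw [← h₃] at hlt
    have hp : (0 : ℚ) < 2 ^ (G.precision T).length := by positivity
    nlinarith
  have hle' : G.walkLength W ≤
    max ((G.bisect O u w k T).1 + (G.bisect O u w k T).2) ((G.weight u w).getD 0) := hle
  rcases le_max_iff.1 hle' with h | h
  · have h₅ : (z : ℚ) < z₀ + 1 := by
      rw [← hz, ← hz₀]
      nlinarith
    have h₆ : z ≤ z₀ := by
      have : z < z₀ + 1 := by exact_mod_cast h₅
      omega
    have h₇ : (z : ℚ) ≤ z₀ := by exact_mod_cast h₆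
    rw [← hz, ← hz₀] at h₇
    exact le_of_mul_le_mul_right h₇ hQ'
  · exact h.trans hd

theorem isWalk_of_mem_search (hO : ∀ B, (G.query u w B).Feasible (O (G.query u w B)))
    {W : List (Fin G.n)} (hW : W ∈ G.search O u w k T) :
    G.IsWalk u w W ∧ k < W.toFinset.card := by
  unfold search at hW
  split_ifs at hW with h
  · rw [List.mem_singleton] at hW
    subst hW
    have := hO ((G.bisect O u w k T).1 + (G.bisect O u w k T).2)
    exact ⟨⟨this.start, this.finish, this.edges⟩, h⟩
  · simp at hW

end WGraph

/-! ### Routes and their schedules -/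

/-- `r` is a timed route in `G` that starts at `s` at time `0`. -/
inductive WGraph.IsRoute (G : WGraph) (s : Fin G.n) : Route G.n → Prop
  | start (a : ℚ) : IsRoute G s [(s, 0, a)]
  | cons {e : Fin G.n × ℚ × ℚ} {r : Route G.n} {v : Fin G.n} {c : ℚ} (a : ℚ) :
      IsRoute G s (e :: r) → G.weight e.1 v = some c → IsRoute G s ((v, c, a) :: e :: r)

theorem Route.time_cons {n : ℕ} (e : Fin n × ℚ × ℚ) (r : Route n) :
    Route.time (e :: r) = max (r.time + e.2.1) e.2.2 := rfl

theorem Route.mem_schedule {n : ℕ} {r : Route n} {x : Fin n × ℚ} :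
    x ∈ r.schedule ↔ ∃ e r', e :: r' <:+ r ∧ x = (e.1, Route.time (e :: r')) := by
  simp only [schedule, List.mem_reverse, List.mem_flatMap, List.mem_tails]
  constructor
  · rintro ⟨s, hs, hx⟩
    cases s with
    | nil => simp at hx
    | cons e r' => exact ⟨e, r', hs, by simpa using hx⟩
  · rintro ⟨e, r', hs, rfl⟩
    exact ⟨e :: r', hs, by simp⟩

theorem Route.schedule_cons {n : ℕ} (e : Fin n × ℚ × ℚ) (r : Route n) :
    Route.schedule (e :: r) = r.schedule ++ [(e.1, Route.time (e :: r))] := by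
  simp [schedule]

theorem Route.mem_schedule_of_suffix {n : ℕ} {r r' : Route n} (h : r <:+ r') {x : Fin n × ℚ}
    (hx : x ∈ r.schedule) : x ∈ r'.schedule := by
  rw [mem_schedule] at hx ⊢
  obtain ⟨e, s, hs, rfl⟩ := hx
  exact ⟨e, s, hs.trans h, rfl⟩

namespace WGraph

variable {G : WGraph} {s : Fin G.n} {r : Route G.n}

namespace IsRoute

theorem nonneg (h : G.IsRoute s r) : ∀ e ∈ r, 0 ≤ e.2.1 := by
  induction h with
  | start a => simp
  | cons a h hw ih =>
    intro e he
    rcases List.mem_cons.1 he with rfl | he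
    · exact G.weight_nonneg _ _ _ hw
    · exact ih e he

theorem time_nonneg (h : G.IsRoute s r) : 0 ≤ r.time := Route.time_nonneg h.nonneg

theorem waitUntil (h : G.IsRoute s r) (a : ℚ) : G.IsRoute s (r.waitUntil a) := by
  cases h with
  | start b => exact .start _
  | cons b h hw => exact .cons _ h hw

theorem isChain_schedule (h : G.IsRoute s r) :
    r.schedule.IsChain fun a b => ∃ c, G.weight a.1 b.1 = some c ∧ a.2 + c ≤ b.2 := by
  induction h with
  | start a => simp [Route.schedule]
  | @cons e r v c a h hw ih =>
    rw [Route.schedule_cons]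
    refine List.isChain_append.2 ⟨ih, by simp, ?_⟩
    intro x hx y hy
    rw [Route.schedule_cons, List.getLast?_concat] at hx
    obtain rfl : _ = x := by simpa using hx
    obtain rfl : _ = y := by simpa using hy
    exact ⟨c, hw, le_max_left _ _⟩

theorem head?_schedule (h : G.IsRoute s r) : ∃ τ, r.schedule.head? = some (s, τ) ∧ 0 ≤ τ := by
  induction h with
  | start a => exact ⟨_, rfl, (IsRoute.start (G := G) (s := s) a).time_nonneg⟩
  | cons a h hw ih =>
    obtain ⟨τ, hτ, h0⟩ := ih
    exact ⟨τ, by rw [Route.schedule_cons, List.head?_append, hτ]; rfl, h0⟩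

end IsRoute

theorem time_le_of_suffix {r r' : Route G.n} (hr : r <:+ r') (h : ∀ e ∈ r', 0 ≤ e.2.1) :
    r.time ≤ r'.time := by
  obtain ⟨l, rfl⟩ := hr
  induction l with
  | nil => exact le_rfl
  | cons e l ih =>
    refine (ih fun e he => h e (by simp at he ⊢; tauto)).trans ?_
    rw [List.cons_append, Route.time_cons]
    exact le_max_of_le_left (le_add_of_nonneg_right (h e (by simp)))

theorem path_append {e : Fin G.n × ℚ × ℚ} {v : Fin G.n} {p : Route G.n} (hp : p ∈ G.path e.1 v)
    (h : G.IsRoute s (e :: r)) : G.IsRoute s (p ++ e :: r) ∧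
      (∃ e' ∈ (p ++ e :: r).head?, e'.1 = v) ∧
      Route.time (p ++ e :: r) = Route.time (e :: r) + p.time := by
  refine (G.path_induction (motive := fun u v p => u = e.1 → (∀ e ∈ p, 0 ≤ e.2.1) ∧
    G.IsRoute s (p ++ e :: r) ∧ (∃ e' ∈ (p ++ e :: r).head?, e'.1 = v) ∧
      Route.time (p ++ e :: r) = Route.time (e :: r) + p.time) ?_ ?_ hp rfl).2
  · rintro u rfl
    exact ⟨by simp, by simpa using h, ⟨e, by simp, rfl⟩, by simp [Route.time]⟩
  · rintro u x v p c ih hc hu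
    obtain ⟨h₀, h₁, ⟨e', he', rfl⟩, h₃⟩ := ih hu
    have hc0 := G.weight_nonneg _ _ _ hc
    refine ⟨?_, ?_, ⟨(v, c, 0), by simp, rfl⟩, ?_⟩
    · intro e he
      rcases List.mem_cons.1 he with rfl | he
      · exact hc0
      · exact h₀ e he
    · rw [List.cons_append]
      rcases hr : p ++ e :: r with - | ⟨e'', r'⟩
      · simp at hr
      · rw [hr] at h₁ he'
        obtain rfl : e'' = e' := by simpa using he'
        exact .cons _ h₁ hc
    · rw [List.cons_append, time_cons_zero hc0 h₁.nonneg, time_cons_zero hc0 h₀, h₃]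
      ring

theorem goTo_spec {e : Fin G.n × ℚ × ℚ} {v : Fin G.n} {c : ℚ} (hc : G.dist e.1 v = some c)
    (h : G.IsRoute s (e :: r)) : ∃ e' r', G.goTo (e :: r) v = e' :: r' ∧ G.IsRoute s (e' :: r') ∧
      e'.1 = v ∧ e :: r <:+ e' :: r' ∧ Route.time (e' :: r') = Route.time (e :: r) + c := by
  obtain ⟨p, hp, rfl⟩ := dist_eq_some_iff.1 hc
  have hg : G.goTo (e :: r) v = p ++ e :: r := by simp [goTo, hp]
  obtain ⟨h₁, ⟨e', he', h₂⟩, h₃⟩ := path_append (p := p) (v := v) (by simp [hp]) h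
  rcases hr : p ++ e :: r with - | ⟨e'', r'⟩
  · simp at hr
  · rw [hr] at h₁ he' h₃ hg
    obtain rfl : e'' = e' := by simpa using he'
    exact ⟨e'', r', hg, h₁, h₂, ⟨p, hr⟩, h₃⟩

theorem dist_self (v : Fin G.n) : G.dist v v = some 0 := by
  obtain ⟨c, hc, hle⟩ := exists_dist_of_walk (G := G) (u := v) (v := v) (W := [v])
    ⟨rfl, rfl, by simp⟩
  have h0 := G.dist_nonneg hc
  rw [hc, le_antisymm hle h0]
  rfl

end WGraph

/-! ### Rides through a group -/

namespace TWInst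

variable {I : TWInst} {m : Bool} {g : GroupData I.n} {r : Route I.n}

theorem groupWeight_eq_some {u v : Fin I.n} {c : ℚ} : I.groupWeight m g u v = some c ↔
    I.InGroup m g u ∧ I.InGroup m g v ∧ I.toWGraph.dist u v = some c := by
  unfold groupWeight
  split_ifs with h
  · simp [h]
  · simp only [false_iff]
    tauto

theorem foldl_goTo_spec {s : Fin I.n} {e : Fin I.n × ℚ × ℚ} {W : List (Fin I.n)}
    (hW : (e.1 :: W).IsChain fun x y => (I.groupWeight m g x y).isSome)
    (h : I.toWGraph.IsRoute s (e :: r)) :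
    ∃ e' r', W.foldl I.toWGraph.goTo (e :: r) = e' :: r' ∧ I.toWGraph.IsRoute s (e' :: r') ∧
      (e.1 :: W).getLast? = some e'.1 ∧ e :: r <:+ e' :: r' ∧
      Route.time (e' :: r') = Route.time (e :: r) + (I.groupGraph m g).walkLength (e.1 :: W) ∧
      ∀ v ∈ W, I.InGroup m g v ∧
        ∃ τ, (v, τ) ∈ Route.schedule (e' :: r') ∧ Route.time (e :: r) ≤ τ := by
  induction W generalizing e r with
  | nil => exact ⟨e, r, rfl, h, rfl, List.suffix_rfl, by simp [WGraph.walkLength], by simp⟩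
  | cons v W ih =>
    obtain ⟨hc, hW'⟩ := List.isChain_cons_cons.1 hW
    obtain ⟨c, hc⟩ := Option.isSome_iff_exists.1 hc
    obtain ⟨-, hv, hd⟩ := groupWeight_eq_some.1 hc
    obtain ⟨e₁, r₁, h₁, h₂, rfl, h₄, h₅⟩ := WGraph.goTo_spec hd h
    obtain ⟨e₂, r₂, k₁, k₂, k₃, k₄, k₅, k₆⟩ := ih hW' h₂
    have hc0 := I.toWGraph.dist_nonneg hd
    refine ⟨e₂, r₂, by rw [List.foldl_cons, h₁, k₁], k₂, by simpa using k₃, h₄.trans k₄, ?_, ?_⟩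
    · rw [k₅, h₅, WGraph.walkLength_cons_cons (G := I.groupGraph m g)]
      change _ = _ + ((I.groupWeight m g _ _).getD 0 + _)
      rw [hc, Option.getD_some]
      ring
    · intro v hv'
      rcases List.mem_cons.1 hv' with rfl | hv'
      · exact ⟨hv, Route.time (e₁ :: r₁), Route.mem_schedule_of_suffix k₄
          (Route.mem_schedule.2 ⟨e₁, r₁, List.suffix_rfl, rfl⟩), by rw [h₅]; linarith⟩
      · obtain ⟨a₁, τ, a₂, a₃⟩ := k₆ v hv'
        exact ⟨a₁, τ, a₂, by linarith⟩

/-- Waiting postpones the last stop, so its old entry, which is at `u`, may disappear from the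
schedule; all other entries survive. This is harmless for the count because `u` belongs to the new
group. -/
theorem ride_spec {s : Fin I.n} {e : Fin I.n × ℚ × ℚ} {W : List (Fin I.n)} {u w : Fin I.n}
    (a : ℚ) (hu : I.InGroup m g u) (hW : (I.groupGraph m g).IsWalk u w W) (he : e.1 = u)
    (h : I.toWGraph.IsRoute s (e :: r)) :
    ∃ e' r', I.toWGraph.ride a W (e :: r) = e' :: r' ∧ I.toWGraph.IsRoute s (e' :: r') ∧
      e'.1 = w ∧
      Route.time (e' :: r') = max (Route.time (e :: r)) a + (I.groupGraph m g).walkLength W ∧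
      (∀ x ∈ Route.schedule (e :: r), x.1 ≠ u → x ∈ Route.schedule (e' :: r')) ∧
      ∀ v ∈ W, I.InGroup m g v ∧ ∃ τ, (v, τ) ∈ Route.schedule (e' :: r') ∧ a ≤ τ := by
  have hw : Route.waitUntil a (e :: r) = (e.1, e.2.1, max e.2.2 a) :: r := by
    simp [Route.waitUntil]
  have hwt : Route.time ((e.1, e.2.1, max e.2.2 a) :: r) = max (Route.time (e :: r)) a := by
    rw [Route.time_cons, Route.time_cons, max_assoc]
  have h' : I.toWGraph.IsRoute s ((e.1, e.2.1, max e.2.2 a) :: r) := hw ▸ h.waitUntil a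
  have huu : I.groupWeight m g u u = some 0 :=
    groupWeight_eq_some.2 ⟨hu, hu, WGraph.dist_self u⟩
  cases W with
  | nil => exact absurd hW.head (by simp)
  | cons u' W =>
    obtain rfl : u' = u := by simpa using hW.head
    -- The walk begins at `u`, where the route already stands. Going from `u` to `u` costs nothing
    -- and lets `u` be treated like the other vertices of the walk.
    obtain ⟨e', r', k₁, k₂, k₃, k₄, k₅, k₆⟩ := foldl_goTo_spec (m := m) (g := g)
      (W := u' :: W) (by
        rw [he]
        exact List.isChain_cons_cons.2 ⟨by simp [huu], hW.chain⟩) h'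
    refine ⟨e', r', by rw [WGraph.ride, hw, k₁], k₂, ?_, ?_, ?_, ?_⟩
    · have := hW.last
      rw [he, List.getLast?_cons_cons, this] at k₃
      simpa using k₃.symm
    · rw [k₅, hwt, he, WGraph.walkLength_cons_cons (G := I.groupGraph m g)]
      change _ + ((I.groupWeight m g _ _).getD 0 + _) = _
      rw [huu, Option.getD_some, zero_add]
    · intro x hx hxu
      rw [Route.schedule_cons, List.mem_append, List.mem_singleton] at hx
      rcases hx with hx | rfl
      · exact Route.mem_schedule_of_suffix ((List.suffix_cons _ r).trans k₄) hx
      · exact absurd he hxu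
    · intro v hv
      obtain ⟨a₁, τ, a₂, a₃⟩ := k₆ v hv
      exact ⟨a₁, τ, a₂, (le_max_right _ _).trans (hwt ▸ a₃)⟩

end TWInst

/-! ### Soundness of the algorithm -/

namespace TWInst

variable {I : TWInst} {O : (J : OrientInst) → List (Fin J.n)} {κ : GraphKind} {m : Bool}

/-- The vertices that are on the schedule of `r` during their windows. -/
def seen (I : TWInst) (r : Route I.n) : Finset (Fin I.n) :=
  ((r.schedule.filter fun a => I.R a.1 ≤ a.2 ∧ a.2 ≤ I.D a.1).map Prod.fst).toFinset

theorem mem_seen {r : Route I.n} {v : Fin I.n} :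
    v ∈ I.seen r ↔ ∃ τ, (v, τ) ∈ r.schedule ∧ I.R v ≤ τ ∧ τ ≤ I.D v := by
  simp [seen]

/-- The route of the label sees at least `count` vertices with keys up to `bound`. -/
structure Sound (I : TWInst) (m : Bool) (l : Label I.n) : Prop where
  isRoute : I.toWGraph.IsRoute I.s l.route
  count_le : l.count ≤ ((I.seen l.route).filter fun v => I.key m v ≤ l.bound).card

theorem groupWalks_spec (hO : ∀ J : OrientInst, κ.Allows J.toWGraph → (∃ W, J.Feasible W) →
    J.Feasible (O J)) (hI : κ.Allows I.toWGraph) {g : GroupData I.n} {W : List (Fin I.n)}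
    (hW : W ∈ I.groupWalks O m g) :
    I.InGroup m g g.u ∧ (I.groupGraph m g).IsWalk g.u g.w W ∧ g.k < W.toFinset.card := by
  unfold groupWalks at hW
  split_ifs at hW with h
  · have hc := h
    obtain ⟨c, hc⟩ := Option.isSome_iff_exists.1 hc
    exact ⟨(groupWeight_eq_some.1 hc).1, WGraph.isWalk_of_mem_search (G := I.groupGraph m g)
      (fun B => hO _ (I.allows_groupGraph hI m g) ⟨_, WGraph.query_feasible _ h B⟩) hW⟩
  · simp at hW

/-- All members of the new group have keys above the old bound, so they are disjoint from the
vertices counted before; in particular the entry at `u` that waiting may move was not counted. The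
members are served in time because the ride starts after `R g.p` and ends by `D g.q`. -/
theorem Sound.extend (hO : ∀ J : OrientInst, κ.Allows J.toWGraph → (∃ W, J.Feasible W) →
    J.Feasible (O J)) (hI : κ.Allows I.toWGraph) {l l' : Label I.n} {g : GroupData I.n}
    (hl : I.Sound m l) (hl' : l' ∈ I.extend O m l g) : I.Sound m l' := by
  obtain ⟨hb, e, he, p, hp, W, hW, ht, rfl⟩ := I.mem_extend O hl'
  obtain ⟨hu, hW, hk⟩ := groupWalks_spec hO hI hW
  obtain ⟨hr, hc⟩ := hl
  obtain ⟨b, c, route⟩ := l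
  simp only at hb he hr hc ht ⊢
  rcases route with - | ⟨e', r⟩
  · simp at he
  obtain rfl : e' = e := by simpa using he
  obtain ⟨h₁, ⟨e₁, he₁, h₂⟩, -⟩ := WGraph.path_append hp hr
  rcases hpr : p ++ e' :: r with - | ⟨e₂, r₁⟩
  · simp at hpr
  rw [hpr] at h₁ he₁ ht
  obtain rfl : e₂ = e₁ := by simpa using he₁
  obtain ⟨e₃, r₃, k₁, k₂, -, -, k₅, k₆⟩ := ride_spec (I.R g.p) hu hW h₂ h₁
  rw [k₁] at ht ⊢
  refine ⟨k₂, ?_⟩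
  have hxy : I.key m g.x ≤ I.key m g.y := hu.2.2.1.trans hu.2.2.2
  have hsub : ((I.seen (e' :: r)).filter fun v => I.key m v ≤ b) ∪ W.toFinset ⊆
      (I.seen (e₃ :: r₃)).filter fun v => I.key m v ≤ I.key m g.y := by
    intro v hv
    rcases Finset.mem_union.1 hv with hv | hv
    · obtain ⟨hv, hvb⟩ := Finset.mem_filter.1 hv
      obtain ⟨τ, hτ, hw⟩ := mem_seen.1 hv
      refine Finset.mem_filter.2 ⟨mem_seen.2 ⟨τ, k₅ _ ?_ ?_, hw⟩, by linarith⟩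
      · exact Route.mem_schedule_of_suffix (hpr ▸ List.suffix_append _ _) hτ
      · rintro rfl
        have := hu.2.2.1
        linarith
    · obtain ⟨hg, τ, hτ, ha⟩ := k₆ v (List.mem_toFinset.1 hv)
      refine Finset.mem_filter.2 ⟨mem_seen.2 ⟨τ, hτ, hg.1.trans ha, ?_⟩, hg.2.2.2⟩
      obtain ⟨e₄, r₄, hs, h₄⟩ := Route.mem_schedule.1 hτ
      obtain ⟨-, rfl⟩ := Prod.mk.inj h₄
      exact ((WGraph.time_le_of_suffix hs k₂.nonneg).trans ht).trans hg.2.1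
  have hdisj : Disjoint ((I.seen (e' :: r)).filter fun v => I.key m v ≤ b) W.toFinset := by
    rw [Finset.disjoint_left]
    intro v hv hv'
    have h₁ := (Finset.mem_filter.1 hv).2
    have h₂ := (k₆ v (List.mem_toFinset.1 hv')).1.2.2.1
    linarith
  have := Finset.card_le_card hsub
  rw [Finset.card_union_of_disjoint hdisj] at this
  simp only
  omega

theorem sound_of_mem_iterate (hO : ∀ J : OrientInst, κ.Allows J.toWGraph → (∃ W, J.Feasible W) →
    J.Feasible (O J)) (hI : κ.Allows I.toWGraph) {l : Label I.n} {i : ℕ}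
    (hl : l ∈ (I.round O m)^[i] (I.initial m)) : I.Sound m l := by
  induction i generalizing l with
  | zero =>
    simp only [Function.iterate_zero, id_eq, initial, List.mem_singleton] at hl
    subst hl
    exact ⟨.start 0, Nat.zero_le _⟩
  | succ i ih =>
    rw [Function.iterate_succ_apply'] at hl
    rcases List.mem_append.1 (I.mem_prune hl).1 with h | h
    · exact ih h
    · simp only [List.mem_flatMap] at h
      obtain ⟨l₀, hl₀, g, -, h⟩ := h
      exact (ih hl₀).extend hO hI h

theorem labels_eq : I.labels O m = (I.round O m)^[I.n] (I.initial m) := by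
  rw [labels, List.foldl_const, List.length_finRange]

/-- The output maximises the recorded count, not the reward. By soundness the count is a lower bound
for the reward, so each completed label bounds the result from below. -/
theorem solve_spec (hO : ∀ J : OrientInst, κ.Allows J.toWGraph → (∃ W, J.Feasible W) →
    J.Feasible (O J)) (hI : κ.Allows I.toWGraph) {x : ℕ × Route I.n} (hx : x ∈ I.finals O m) :
    I.Feasible (I.solve O) ∧ x.1 ≤ I.reward (I.solve O) := by
  have hx' : x ∈ I.finals O true ++ I.finals O false := by cases m <;> simp [hx]
  obtain ⟨y, hy, hb, hle⟩ := List.exists_best (cost := fun x : ℕ × Route I.n => -(x.1 : ℚ)) hx'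
  have hle : x.1 ≤ y.1 := by
    have : (x.1 : ℚ) ≤ y.1 := by linarith
    exact_mod_cast this
  have hs : I.solve O = y.2.schedule := by simp [solve, hb]
  obtain ⟨m', hy⟩ : ∃ m', y ∈ I.finals O m' := by
    rcases List.mem_append.1 hy with hy | hy
    · exact ⟨_, hy⟩
    · exact ⟨_, hy⟩
  simp only [finals, List.mem_flatMap] at hy
  obtain ⟨l, hl, e, he, p, hp, hy⟩ := hy
  split_ifs at hy with ht
  swap
  · simp at hy
  obtain ⟨hr, hc⟩ := sound_of_mem_iterate hO hI (labels_eq (O := O) ▸ hl)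
  rw [List.mem_singleton] at hy
  subst hy
  rcases hlr : l.route with - | ⟨e', r⟩
  · simp [hlr] at he
  rw [hlr] at he hr hc hs ht hb
  obtain rfl : e = e' := by simpa using he
  obtain ⟨h₁, ⟨e₁, he₁, h₂⟩, -⟩ := WGraph.path_append hp hr
  have hsuff : e :: r <:+ p ++ e :: r := List.suffix_append _ _
  rw [hs]
  refine ⟨⟨h₁.head?_schedule, ?_, h₁.isChain_schedule⟩, hle.trans (hc.trans ?_)⟩
  · rcases hpr : p ++ e :: r with - | ⟨e₂, r₁⟩
    · simp at hpr
    rw [hpr] at he₁ ht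
    obtain rfl : e₂ = e₁ := by simpa using he₁
    exact ⟨_, by simp only [Route.schedule_cons, List.getLast?_concat, h₂], ht⟩
  · refine Finset.card_le_card fun v hv => ?_
    obtain ⟨τ, hτ, hw⟩ := mem_seen.1 (Finset.mem_filter.1 hv).1
    exact mem_seen.2 ⟨τ, Route.mem_schedule_of_suffix hsuff hτ, hw⟩

end TWInst

/-! ### Completeness of the dynamic program -/

namespace WGraph

variable {G : WGraph}

theorem IsWalk.trans {a b d : Fin G.n} {W W' : List (Fin G.n)} (h : G.IsWalk a b W)
    (h' : G.IsWalk b d W') :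
    ∃ W'', G.IsWalk a d W'' ∧ G.walkLength W'' = G.walkLength W + G.walkLength W' := by
  induction W generalizing a with
  | nil => exact absurd h.head (by simp)
  | cons x l ih =>
    obtain rfl : x = a := by simpa using h.head
    cases l with
    | nil =>
      obtain rfl : x = b := by simpa using h.last
      exact ⟨W', h', by simp [walkLength]⟩
    | cons y l =>
      obtain ⟨h₁, h₂⟩ := List.isChain_cons_cons.1 h.chain
      obtain ⟨W'', k, hl⟩ := ih (a := y) ⟨rfl, by simpa using h.last, h₂⟩
      rcases W'' with - | ⟨y', l'⟩
      · exact absurd k.head (by simp)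
      obtain rfl : y' = y := by simpa using k.head
      refine ⟨x :: y' :: l', ⟨rfl, by simpa using k.last, List.isChain_cons_cons.2 ⟨h₁, k.chain⟩⟩, ?_⟩
      rw [walkLength_cons_cons, walkLength_cons_cons, hl]
      ring

/-- One can be at `b.1` at time `b.2` after having been at `a.1` at time `a.2`. -/
def Travel (G : WGraph) (a b : Fin G.n × ℚ) : Prop :=
  ∃ c, G.dist a.1 b.1 = some c ∧ a.2 + c ≤ b.2

theorem Travel.trans {a b c : Fin G.n × ℚ} (h : G.Travel a b) (h' : G.Travel b c) :
    G.Travel a c := by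
  obtain ⟨x, hx, hx'⟩ := h
  obtain ⟨y, hy, hy'⟩ := h'
  obtain ⟨W, hW, rfl⟩ := exists_walk_of_dist hx
  obtain ⟨W', hW', rfl⟩ := exists_walk_of_dist hy
  obtain ⟨W'', h₁, h₂⟩ := hW.trans hW'
  obtain ⟨z, hz, hz'⟩ := exists_dist_of_walk h₁
  exact ⟨z, hz, by linarith⟩

theorem Travel.le {a b : Fin G.n × ℚ} (h : G.Travel a b) : a.2 ≤ b.2 := by
  obtain ⟨c, hc, h⟩ := h
  have := G.dist_nonneg hc
  linarith

/-- The route can be prolonged so as to be at `b.1` at time `b.2`. -/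
def Reach (G : WGraph) (r : Route G.n) (b : Fin G.n × ℚ) : Prop :=
  ∃ e ∈ r.head?, G.Travel (e.1, r.time) b

end WGraph

namespace TWInst

variable {I : TWInst} {O : (J : OrientInst) → List (Fin J.n)} {κ : GraphKind} {m : Bool}

/-- Travel times add up along the visits, so the walk through the group takes at most the time that
elapses between its first and last visit. By the triangle inequality the direct edge is no longer
than this walk, which is the hypothesis `hd` of `exists_search`. -/
theorem walkLength_groupGraph {g : GroupData I.n} (a : Fin I.n × ℚ) (G : List (Fin I.n × ℚ))
    (hg : ∀ b ∈ a :: G, I.InGroup m g b.1) (hp : (a :: G).IsChain I.toWGraph.Travel) :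
    ((a :: G).map Prod.fst).IsChain (fun x y => (I.groupWeight m g x y).isSome) ∧
    ∀ b ∈ (a :: G).getLast?,
      (I.groupGraph m g).walkLength ((a :: G).map Prod.fst) ≤ b.2 - a.2 ∧
      ∃ c, I.groupWeight m g a.1 b.1 = some c ∧
        c ≤ (I.groupGraph m g).walkLength ((a :: G).map Prod.fst) := by
  induction G generalizing a with
  | nil =>
    refine ⟨by simp, ?_⟩
    intro b hb
    obtain rfl : a = b := by simpa using hb
    exact ⟨by simp [WGraph.walkLength],
      0, groupWeight_eq_some.2 ⟨hg a (by simp), hg a (by simp), WGraph.dist_self _⟩,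
      by simp [WGraph.walkLength]⟩
  | cons a' G ih =>
    obtain ⟨h₁, h₂⟩ := List.isChain_cons_cons.1 hp
    obtain ⟨k₁, k₂⟩ := ih a' (fun b hb => hg b (by simp at hb ⊢; tauto)) h₂
    obtain ⟨c, hc, hle⟩ := h₁
    have hc' : I.groupWeight m g a.1 a'.1 = some c :=
      groupWeight_eq_some.2 ⟨hg a (by simp), hg a' (by simp), hc⟩
    have hlen : (I.groupGraph m g).walkLength ((a :: a' :: G).map Prod.fst) =
        c + (I.groupGraph m g).walkLength ((a' :: G).map Prod.fst) := by
      rw [List.map_cons, List.map_cons, WGraph.walkLength_cons_cons (G := I.groupGraph m g)]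
      change (I.groupWeight m g _ _).getD 0 + _ = _
      rw [hc', Option.getD_some]
    refine ⟨List.isChain_cons_cons.2 ⟨by simp [hc'], k₁⟩, ?_⟩
    intro b hb
    obtain ⟨k₃, d, hd, k₄⟩ := k₂ b (by simpa using hb)
    obtain ⟨-, hb', hd⟩ := groupWeight_eq_some.1 hd
    obtain ⟨z, hz, hz'⟩ := WGraph.Travel.trans (G := I.toWGraph) (a := (a.1, 0)) (b := (a'.1, c))
      (c := (b.1, c + d)) ⟨c, hc, by simp⟩ ⟨d, hd, le_rfl⟩
    refine ⟨by linarith, z, groupWeight_eq_some.2 ⟨hg a (by simp), hb', hz⟩, ?_⟩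
    simp only at hz'
    linarith

/-- The label `l'` is as good as `l`. -/
structure Better (l l' : Label I.n) : Prop where
  bound_eq : l'.bound = l.bound
  count_eq : l'.count = l.count
  head_eq : l'.route.head?.map Prod.fst = l.route.head?.map Prod.fst
  time_le : l'.route.time ≤ l.route.time

/-- What a route can still reach depends only on its position and time, and being earlier never
hurts since waiting is allowed. This justifies the pruning. -/
theorem Better.reach {l l' : Label I.n} (h : Better l l') {b : Fin I.n × ℚ}
    (hl : I.toWGraph.Reach l.route b) : I.toWGraph.Reach l'.route b := by
  obtain ⟨e, he, c, hc, hle⟩ := hl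
  have := h.head_eq
  rw [Option.mem_def.1 he, Option.map_some, Option.map_eq_some_iff] at this
  obtain ⟨e', he', h'⟩ := this
  have := h.time_le
  exact ⟨e', he', c, by rw [← hc]; simp [h'], by simp only at hle ⊢; linarith⟩

theorem exists_better_of_mem {ls : List (Label I.n)} {l : Label I.n} (hl : l ∈ ls)
    (hb : l.bound ∈ I.bounds m) (hc : l.count ≤ I.n) (hr : l.route ≠ []) :
    ∃ l' ∈ I.prune m ls, Better l l' := by
  rcases hlr : l.route with - | ⟨e, r⟩
  · exact absurd hlr hr
  have hmem : l ∈ ls.flatMap fun l' => (l'.route.take 1).flatMap fun e' =>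
      if l'.bound = l.bound ∧ e'.1 = e.1 ∧ (l'.count : ℚ) = l.count then [l'] else [] := by
    simp only [List.mem_flatMap]
    exact ⟨l, hl, e, by simp [hlr], by simp⟩
  obtain ⟨l', -, h₁, h₂⟩ := List.exists_best (cost := fun l : Label I.n => l.route.time) hmem
  have hl' : l' ∈ I.select ls l.bound e.1 l.count := by rw [select, h₁]; simp
  refine ⟨l', ?_, ?_⟩
  · simp only [prune, List.mem_flatMap]
    exact ⟨_, hb, e.1, List.mem_finRange _, _, I.mem_counts.2 hc, hl'⟩
  · obtain ⟨-, k₁, k₂, e', he', k₃⟩ := I.mem_select hl'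
    refine ⟨k₁, k₂, ?_, h₂⟩
    rw [Option.mem_def.1 he', hlr]
    simp [k₃]

theorem Sound.route_ne_nil {l : Label I.n} (h : I.Sound m l) : l.route ≠ [] := by
  have := h.isRoute
  intro h'
  rw [h'] at this
  cases this

theorem Sound.count_le_n {l : Label I.n} (h : I.Sound m l) : l.count ≤ I.n :=
  h.count_le.trans ((Finset.card_le_univ _).trans (by simp))

theorem exists_better_of_mem_extend (hO : ∀ J : OrientInst, κ.Allows J.toWGraph →
    (∃ W, J.Feasible W) → J.Feasible (O J)) (hI : κ.Allows I.toWGraph) {l l' : Label I.n} {i : ℕ}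
    {g : GroupData I.n} (hl : l ∈ (I.round O m)^[i] (I.initial m))
    (hl' : l' ∈ I.extend O m l g) :
    ∃ l'' ∈ (I.round O m)^[i + 1] (I.initial m), Better l' l'' := by
  have hs := (sound_of_mem_iterate hO hI hl).extend hO hI hl'
  rw [Function.iterate_succ_apply']
  refine exists_better_of_mem (List.mem_append_right _ ?_) ?_ hs.count_le_n hs.route_ne_nil
  · simp only [List.mem_flatMap]
    exact ⟨l, hl, g, I.mem_groups g, hl'⟩
  · obtain ⟨-, e, -, p, -, W, -, -, rfl⟩ := I.mem_extend O hl'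
    simp [bounds]

theorem Better.trans {l₁ l₂ l₃ : Label I.n} (h : Better l₁ l₂) (h' : Better l₂ l₃) :
    Better l₁ l₃ :=
  ⟨h'.bound_eq.trans h.bound_eq, h'.count_eq.trans h.count_eq, h'.head_eq.trans h.head_eq,
    h'.time_le.trans h.time_le⟩

/-- The number of rounds is always `n`, whereas a chain may have fewer groups; its label survives
the remaining rounds up to dominance. -/
theorem exists_better_of_le (hO : ∀ J : OrientInst, κ.Allows J.toWGraph →
    (∃ W, J.Feasible W) → J.Feasible (O J)) (hI : κ.Allows I.toWGraph) {l : Label I.n} {i j : ℕ}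
    (hij : i ≤ j) (hl : l ∈ (I.round O m)^[i] (I.initial m)) :
    ∃ l' ∈ (I.round O m)^[j] (I.initial m), Better l l' := by
  induction j, hij using Nat.le_induction with
  | base => exact ⟨l, hl, rfl, rfl, rfl, le_rfl⟩
  | succ j hij ih =>
    obtain ⟨l', hl', h⟩ := ih
    have hs := sound_of_mem_iterate hO hI hl'
    rw [Function.iterate_succ_apply']
    obtain ⟨l'', h₁, h₂⟩ := exists_better_of_mem (m := m) (List.mem_append_left
      (((I.round O m)^[j] (I.initial m)).flatMap fun l => I.groups.flatMap fun g =>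
        I.extend O m l g) hl') (I.mem_iterate_round O hl').2.1 hs.count_le_n hs.route_ne_nil
    exact ⟨l'', h₁, h.trans h₂⟩

/-- The group of visits is found under the description by its extremal vertices `p`, `q`, `x`, `y`
and its first and last visits `u`, `w`. The label can be at `u` by the time of visit `u`, when all
releases have passed, and the walk found is no longer than the elapsed time. So it arrives at `w` no
later than the given walk, and hence before all deadlines. From `w` it can reach everything that the
given walk reaches afterwards. -/
theorem exists_extend (hO : ∀ J : OrientInst, κ.Allows J.toWGraph →
    (∃ W, J.Feasible W) → J.Feasible (O J)) (hI : κ.Allows I.toWGraph) {K : ℕ → ℕ}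
    {G : List (Fin I.n × ℚ)} (hne : G ≠ [])
    (hK : ∀ J : OrientInst, κ.Allows J.toWGraph → J.n = I.n → ∀ W, J.Feasible W →
      W.toFinset.card = G.length → K G.length ≤ (O J).toFinset.card)
    (hpos : 0 < K G.length) (hnd : (G.map Prod.fst).Nodup)
    (hG : G.Pairwise I.toWGraph.Travel)
    (hwin : ∀ a ∈ G, ∀ b ∈ G, I.R a.1 ≤ b.2 ∧ b.2 ≤ I.D a.1)
    {l : Label I.n} {i : ℕ} (hl : l ∈ (I.round O m)^[i] (I.initial m))
    (hb : ∀ a ∈ G, l.bound < I.key m a.1) (hr : ∀ a ∈ G, I.toWGraph.Reach l.route a)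
    (hT : ∀ a ∈ G, a.2 ≤ I.T) :
    ∃ l' ∈ (I.round O m)^[i + 1] (I.initial m), l'.count = l.count + K G.length ∧
      (∀ b, (∀ a ∈ G, I.key m a.1 < I.key m b) → l'.bound < I.key m b) ∧
      ∀ b, (∀ a ∈ G, I.toWGraph.Travel a b) → I.toWGraph.Reach l'.route b := by
  have hne' : G.toFinset.Nonempty := by simpa using hne
  obtain ⟨p, hp, hp'⟩ := G.toFinset.exists_max_image (fun a => I.R a.1) hne'
  obtain ⟨q, hq, hq'⟩ := G.toFinset.exists_min_image (fun a => I.D a.1) hne'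
  obtain ⟨x, hx, hx'⟩ := G.toFinset.exists_min_image (fun a => I.key m a.1) hne'
  obtain ⟨y, hy, hy'⟩ := G.toFinset.exists_max_image (fun a => I.key m a.1) hne'
  simp only [List.mem_toFinset] at hp hp' hq hq' hx hx' hy hy'
  rcases G with - | ⟨u, G'⟩
  · exact absurd rfl hne
  set G := u :: G' with hGdef
  obtain ⟨w, hw⟩ : ∃ w, G.getLast? = some w := ⟨_, List.getLast?_eq_some_getLast hne⟩
  have hwG : w ∈ G := List.mem_of_getLast? hw
  have huG : u ∈ G := by simp [hGdef]
  have facts : ∀ g : GroupData I.n, g.p = p.1 → g.q = q.1 → g.x = x.1 → g.y = y.1 → g.u = u.1 →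
      g.w = w.1 → (I.groupWeight m g g.u g.w).isSome ∧
        (I.groupWeight m g g.u g.w).getD 0 ≤ (I.groupGraph m g).walkLength (G.map Prod.fst) ∧
        (I.groupGraph m g).walkLength (G.map Prod.fst) ≤ w.2 - u.2 ∧
        ∀ B, (I.groupGraph m g).walkLength (G.map Prod.fst) ≤ B →
          K G.length ≤ (O ((I.groupGraph m g).query g.u g.w B)).toFinset.card := by
    intro g gp gq gx gy gu gw
    have hin : ∀ a ∈ G, I.InGroup m g a.1 := fun a ha =>
      ⟨gp ▸ hp' a ha, gq ▸ hq' a ha, gx ▸ hx' a ha, gy ▸ hy' a ha⟩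
    obtain ⟨h₁, h₂⟩ := walkLength_groupGraph u G' hin hG.isChain
    obtain ⟨h₃, c, hc, h₄⟩ := h₂ w hw
    rw [gu, gw, hc]
    refine ⟨rfl, h₄, h₃, fun B hB => hK _ (I.allows_groupGraph hI m g) rfl (G.map Prod.fst)
      ⟨by simp [hGdef], by simp [hw], h₁, hB.trans (le_max_left _ _)⟩ ?_⟩
    rw [List.toFinset_card_of_nodup hnd, List.length_map]
  have hk : K G.length ≤ I.n := by
    -- The last component is a dummy value for `k`, on which `facts` does not depend. The bound
    -- obtained makes `K G.length - 1` an admissible value.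
    obtain ⟨-, -, -, h⟩ := facts ⟨p.1, q.1, x.1, y.1, u.1, w.1, u.1⟩ rfl rfl rfl rfl rfl rfl
    exact (h _ le_rfl).trans ((Finset.card_le_univ _).trans (by simp))
  have main : ∀ g : GroupData I.n, g.p = p.1 → g.q = q.1 → g.x = x.1 → g.y = y.1 → g.u = u.1 →
      g.w = w.1 → g.k + 1 = K G.length → ∃ l₁ ∈ I.extend O m l g,
        l₁.count = l.count + K G.length ∧ l₁.bound = I.key m y.1 ∧
        ∃ e ∈ l₁.route.head?, e.1 = w.1 ∧ l₁.route.time ≤ w.2 := by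
    intro g gp gq gx gy gu gw gk
    obtain ⟨f₁, f₂, f₃, f₄⟩ := facts g gp gq gx gy gu gw
    obtain ⟨e, he, c, hc, hle⟩ := hr u huG
    have hroute := (sound_of_mem_iterate hO hI hl).isRoute
    have hu0 : 0 ≤ u.2 := by
      have h₁ := hroute.time_nonneg
      have h₂ := I.toWGraph.dist_nonneg hc
      simp only at hle
      linarith
    obtain ⟨W, hW, hWle⟩ := WGraph.exists_search (G := I.groupGraph m g) (O := O) (u := g.u)
      (w := g.w) (k := g.k) (T := I.T)
      (fun B => hO _ (I.allows_groupGraph hI m g) ⟨_, WGraph.query_feasible _ f₁ B⟩) f₂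
      (by linarith [hT w hwG]) fun B hB => by
        have := f₄ B hB
        unfold WGraph.Enough
        omega
    have hW' : W ∈ I.groupWalks O m g := by rw [groupWalks, if_pos f₁]; exact hW
    obtain ⟨hu, hwalk, -⟩ := groupWalks_spec hO hI hW'
    obtain ⟨P, hP, rfl⟩ := WGraph.dist_eq_some_iff.1 hc
    rcases hlr : l.route with - | ⟨e', r⟩
    · simp [hlr] at he
    rw [hlr] at he hroute hle
    obtain rfl : e' = e := by simpa using he
    obtain ⟨k₁, ⟨e₁, he₁, k₂⟩, k₃⟩ := WGraph.path_append (p := P) (v := u.1) (by simp [hP]) hroute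
    rcases hpr : P ++ e' :: r with - | ⟨e₂, r₁⟩
    · simp at hpr
    rw [hpr] at k₁ he₁ k₃
    obtain rfl : e₂ = e₁ := by simpa using he₁
    obtain ⟨e₃, r₃, j₁, -, j₃, j₄, -, -⟩ := ride_spec (I.R g.p) hu hwalk (k₂.trans gu.symm) k₁
    have htime : Route.time (e₃ :: r₃) ≤ w.2 := by
      -- The time of the first visit lies in the window of `p`, so at that time the latest release
      -- has passed.
      have h₁ : max (Route.time (e₂ :: r₁)) (I.R g.p) ≤ u.2 :=
        max_le (by rw [k₃]; exact hle) (by rw [gp]; exact (hwin p hp u huG).1)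
      rw [j₄]
      linarith
    refine ⟨⟨I.key m g.y, l.count + (g.k + 1), e₃ :: r₃⟩, ?_, by rw [gk], by rw [gy], e₃, rfl,
      j₃.trans gw, htime⟩
    rw [extend, if_pos (by rw [gx]; exact hb x hx)]
    simp only [List.mem_flatMap]
    refine ⟨e', by simp [hlr], P, by rw [gu, hP]; simp, W, hW', ?_⟩
    rw [visit, hlr, hpr, j₁, if_pos (htime.trans (by rw [gq]; exact (hwin q hq w hwG).2))]
    simp
  obtain ⟨l₁, h₁, h₂, h₃, e, he, h₄, h₅⟩ := main ⟨p.1, q.1, x.1, y.1, u.1, w.1,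
    ⟨K G.length - 1, by omega⟩⟩ rfl rfl rfl rfl rfl rfl (by simp; omega)
  obtain ⟨l', hl', hbet⟩ := exists_better_of_mem_extend hO hI hl h₁
  refine ⟨l', hl', hbet.count_eq.trans h₂, ?_, ?_⟩
  · intro b hb
    rw [hbet.bound_eq, h₃]
    exact hb y hy
  · intro b hb
    refine hbet.reach ⟨e, he, ?_⟩
    obtain ⟨c, hc, hle⟩ := hb w hwG
    exact ⟨c, by rw [← hc]; simp [h₄], by simp only; linarith⟩

/-- The groups of visits in `gs` can be served one after the other. -/
structure IsGroupChain (I : TWInst) (m : Bool) (gs : List (List (Fin I.n × ℚ))) : Prop where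
  ne_nil : ∀ G ∈ gs, G ≠ []
  nodup : ∀ G ∈ gs, (G.map Prod.fst).Nodup
  travel : gs.flatten.Pairwise I.toWGraph.Travel
  window : ∀ G ∈ gs, ∀ a ∈ G, ∀ b ∈ G, I.R a.1 ≤ b.2 ∧ b.2 ≤ I.D a.1
  key_lt : gs.Pairwise fun G G' => ∀ a ∈ G, ∀ b ∈ G', I.key m a.1 < I.key m b.1

/-- Induction over the groups: the invariant is that the label's bound is below all remaining keys
and that all remaining visits, as well as the target, can be reached in time. -/
theorem exists_label_of_isGroupChain (hO : ∀ J : OrientInst, κ.Allows J.toWGraph →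
    (∃ W, J.Feasible W) → J.Feasible (O J)) (hI : κ.Allows I.toWGraph) {K : ℕ → ℕ}
    {gs : List (List (Fin I.n × ℚ))} (hgs : I.IsGroupChain m gs)
    (hK : ∀ G ∈ gs, ∀ J : OrientInst, κ.Allows J.toWGraph → J.n = I.n → ∀ W, J.Feasible W →
      W.toFinset.card = G.length → K G.length ≤ (O J).toFinset.card)
    (hpos : ∀ G ∈ gs, 0 < K G.length)
    (ht : ∀ a ∈ gs.flatten, I.toWGraph.Travel a (I.t, I.T))
    {l : Label I.n} {i : ℕ} (hl : l ∈ (I.round O m)^[i] (I.initial m))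
    (hb : ∀ a ∈ gs.flatten, l.bound < I.key m a.1)
    (hr : ∀ a ∈ gs.flatten, I.toWGraph.Reach l.route a)
    (hlt : I.toWGraph.Reach l.route (I.t, I.T)) :
    ∃ l' ∈ (I.round O m)^[i + gs.length] (I.initial m),
      l'.count = l.count + (gs.map fun G => K G.length).sum ∧
      I.toWGraph.Reach l'.route (I.t, I.T) := by
  induction gs generalizing l i with
  | nil => exact ⟨l, hl, by simp, hlt⟩
  | cons G gs ih =>
    have htr := hgs.travel
    rw [List.flatten_cons, List.pairwise_append] at htr
    have hkey := List.pairwise_cons.1 hgs.key_lt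
    obtain ⟨l', hl', h₁, h₂, h₃⟩ := exists_extend hO hI (hgs.ne_nil G (by simp))
      (hK G (by simp)) (hpos G (by simp)) (hgs.nodup G (by simp)) htr.1
      (hgs.window G (by simp)) hl (fun a ha => hb a (by simp [ha])) (fun a ha => hr a (by simp [ha]))
      fun a ha => (ht a (by simp [ha])).le
    have hsub : ∀ G' ∈ gs, G' ∈ G :: gs := fun G' h => by simp [h]
    have hsub' : ∀ a ∈ gs.flatten, a ∈ (G :: gs).flatten := fun a h => by
      rw [List.flatten_cons]; exact List.mem_append_right _ h
    have hlt' : ∀ b ∈ gs.flatten, ∀ a ∈ G, I.key m a.1 < I.key m b.1 := by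
      intro b hb a ha
      obtain ⟨G', hG', hb⟩ := List.mem_flatten.1 hb
      exact hkey.1 G' hG' a ha b hb
    obtain ⟨l'', hl'', k₁, k₂⟩ := ih (l := l') (i := i + 1)
      ⟨fun G' h => hgs.ne_nil G' (hsub G' h), fun G' h => hgs.nodup G' (hsub G' h), htr.2.1,
        fun G' h => hgs.window G' (hsub G' h), hkey.2⟩
      (fun G' h => hK G' (hsub G' h)) (fun G' h => hpos G' (hsub G' h))
      (fun a ha => ht a (hsub' a ha)) hl' (fun b hb => h₂ _ (hlt' b hb))
      (fun b hb => h₃ _ fun a ha => htr.2.2 a ha b hb) (h₃ _ fun a ha => ht a (by simp [ha]))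
    refine ⟨l'', ?_, ?_, k₂⟩
    · rwa [List.length_cons, show i + (gs.length + 1) = i + 1 + gs.length by omega]
    · rw [k₁, h₁, List.map_cons, List.sum_cons, add_assoc]

theorem bottom_lt (m : Bool) (v : Fin I.n) : I.bottom m < I.key m v := by
  have key : ∀ (l : List (Fin I.n)) (q : ℚ), l.foldl (fun s v => min s (I.key m v)) q ≤ q ∧
      ∀ v ∈ l, l.foldl (fun s v => min s (I.key m v)) q ≤ I.key m v := by
    intro l
    induction l with
    | nil => simp
    | cons v l ih =>
      intro q
      obtain ⟨h₁, h₂⟩ := ih (min q (I.key m v))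
      refine ⟨h₁.trans (min_le_left _ _), fun w hw => ?_⟩
      rcases List.mem_cons.1 hw with rfl | hw
      · exact h₁.trans (min_le_right _ _)
      · exact h₂ w hw
  have := (key (List.finRange I.n) 0).2 v (List.mem_finRange v)
  unfold bottom
  linarith

/-- The algorithm does at least as well as each chain of groups, up to the losses `K`. -/
theorem solve_of_isGroupChain (hO : ∀ J : OrientInst, κ.Allows J.toWGraph →
    (∃ W, J.Feasible W) → J.Feasible (O J)) (hI : κ.Allows I.toWGraph) {K : ℕ → ℕ}
    {gs : List (List (Fin I.n × ℚ))} (hgs : I.IsGroupChain m gs)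
    (hK : ∀ G ∈ gs, ∀ J : OrientInst, κ.Allows J.toWGraph → J.n = I.n → ∀ W, J.Feasible W →
      W.toFinset.card = G.length → K G.length ≤ (O J).toFinset.card)
    (hpos : ∀ G ∈ gs, 0 < K G.length) (hlen : gs.length ≤ I.n)
    (hs : ∀ a ∈ gs.flatten, I.toWGraph.Travel (I.s, 0) a)
    (ht : ∀ a ∈ gs.flatten, I.toWGraph.Travel a (I.t, I.T))
    (hst : I.toWGraph.Travel (I.s, 0) (I.t, I.T)) :
    I.Feasible (I.solve O) ∧ (gs.map fun G => K G.length).sum ≤ I.reward (I.solve O) := by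
  have h0 : ∀ b, I.toWGraph.Travel (I.s, 0) b →
      I.toWGraph.Reach [(I.s, (0 : ℚ), (0 : ℚ))] b := fun b hb =>
    ⟨_, rfl, by simpa [Route.time] using hb⟩
  obtain ⟨l, hl, hc, hr⟩ := exists_label_of_isGroupChain hO hI hgs hK hpos ht
    (l := ⟨I.bottom m, 0, [(I.s, 0, 0)]⟩) (i := 0) (by simp [initial])
    (fun a _ => bottom_lt m a.1) (fun a ha => h0 a (hs a ha)) (h0 _ hst)
  rw [zero_add] at hl
  obtain ⟨l', hl', hbet⟩ := exists_better_of_le hO hI hlen hl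
  obtain ⟨e, he, c, hc', hle⟩ := hbet.reach hr
  obtain ⟨p, hp, rfl⟩ := WGraph.dist_eq_some_iff.1 hc'
  have hroute := (sound_of_mem_iterate hO hI hl').isRoute
  rcases hlr : l'.route with - | ⟨e', r⟩
  · simp [hlr] at he
  rw [hlr] at he hroute hle
  obtain rfl : e' = e := by simpa using he
  obtain ⟨-, -, k⟩ := WGraph.path_append (p := p) (v := I.t) (by simp [hp]) hroute
  have hmem : (l'.count, p ++ l'.route) ∈ I.finals O m := by
    simp only [finals, List.mem_flatMap, labels_eq]
    refine ⟨l', hl', e', by simp [hlr], p, by simp [hp], ?_⟩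
    rw [if_pos (by rw [hlr, k]; exact hle)]
    simp
  obtain ⟨h₁, h₂⟩ := solve_spec hO hI hmem
  refine ⟨h₁, le_trans ?_ h₂⟩
  simp only [hbet.count_eq, hc, zero_add, le_refl]

end TWInst

/-! ### Partitioning the visits into chains of groups -/

/-- The middle number is the element of `[b, e]` divisible by the highest power of two; its
neighbours among the multiples of `2 ^ h` lie outside. When `e` grows onto the right neighbour, that
neighbour takes over. -/
theorem Nat.exists_dyadic {b e : ℕ} (hb : 0 < b) (hbe : b ≤ e) : ∃ h q : ℕ,
    2 * q * 2 ^ h < b ∧ b ≤ (2 * q + 1) * 2 ^ h ∧ (2 * q + 1) * 2 ^ h ≤ e ∧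
      e < (2 * q + 2) * 2 ^ h := by
  induction e, hbe using Nat.le_induction with
  | base =>
    obtain ⟨h, q', ⟨q, rfl⟩, hq⟩ := Nat.exists_eq_two_pow_mul_odd (n := b) (by omega)
    have hp : 0 < 2 ^ h := by positivity
    exact ⟨h, q, by rw [hq]; nlinarith, by rw [hq, mul_comm], by rw [hq, mul_comm],
      by rw [hq]; nlinarith⟩
  | succ e hbe ih =>
    obtain ⟨h, q, h₁, h₂, h₃, h₄⟩ := ih
    by_cases hlt : e + 1 < (2 * q + 2) * 2 ^ h
    · exact ⟨h, q, h₁, h₂, by omega, hlt⟩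
    · obtain ⟨h', q', ⟨q'', rfl⟩, hq⟩ := Nat.exists_eq_two_pow_mul_odd (n := q + 1) (by omega)
      have hp : 0 < 2 ^ h := by positivity
      have hp' : 0 < 2 ^ h' := by positivity
      have he : e + 1 = (2 * q'' + 1) * 2 ^ (h + 1 + h') := by
        have : e + 1 = (2 * q + 2) * 2 ^ h := by omega
        rw [this, show 2 * q + 2 = 2 * (q + 1) by ring, hq, pow_add, pow_succ]
        ring
      refine ⟨h + 1 + h', q'', lt_of_le_of_lt ?_ h₁, by omega, he.ge, ?_⟩
      · have hq' : 2 * q'' * 2 ^ h' ≤ q := by nlinarith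
        calc 2 * q'' * 2 ^ (h + 1 + h') = 2 * q'' * 2 ^ h' * 2 * 2 ^ h := by
              rw [pow_add, pow_succ]; ring
          _ ≤ 2 * q * 2 ^ h := by nlinarith
      · rw [he]
        have : 0 < 2 ^ (h + 1 + h') := by positivity
        nlinarith

/-- The types of visits: windows of length zero; windows that contain a dyadic cell around the visit
time, by level and parity; windows that end or begin in the basic cell of the visit time, by the
level of a dyadic position. -/
abbrev VisitType (J H : ℕ) : Type := Unit ⊕ (Fin J × Bool) ⊕ (Fin H × Bool)

namespace VisitType

variable {k J H : ℕ} (R D x : Fin k → ℚ) (μ : ℚ)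

/-- The window of visit `i` contains the cell number `c` of length `S`, which contains its time. -/
def InCell (S : ℚ) (c : ℤ) (i : Fin k) : Prop :=
  c * S ≤ x i ∧ x i < (c + 1) * S ∧ R i ≤ c * S ∧ (c + 1) * S ≤ D i

/-- Visit `i` has the given type and belongs to group number `γ`. -/
def Fits : VisitType J H → ℚ → Fin k → Prop
  | .inl _, γ, i => D i = R i ∧ γ = x i
  | .inr (.inl (j, true)), γ, i => ∃ c : ℤ, γ = c ∧ InCell R D x (2 ^ (j : ℕ) * μ) c i ∧
      Even c ∧ D i < (c + 2) * (2 ^ (j : ℕ) * μ)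
  | .inr (.inl (j, false)), γ, i => ∃ c : ℤ, γ = c ∧ InCell R D x (2 ^ (j : ℕ) * μ) c i ∧
      Odd c ∧ (c - 1) * (2 ^ (j : ℕ) * μ) < R i
  | .inr (.inr (h, true)), γ, i => ∃ q : ℕ, γ = q ∧ 2 * q * 2 ^ (h : ℕ) < i + 1 ∧
      (∃ p : Fin k, p + 1 = (2 * q + 1) * 2 ^ (h : ℕ) ∧ i ≤ p ∧ x p ≤ D i) ∧
      (∀ p : Fin k, (2 * q + 2) * 2 ^ (h : ℕ) ≤ p + 1 → D i < x p) ∧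
      ∃ a : ℤ, a * μ ≤ x i ∧ D i < (a + 1) * μ ∧ R i ≤ a * μ
  | .inr (.inr (h, false)), γ, i => ∃ q : ℕ, γ = q ∧ (i : ℕ) + 1 < (2 * q + 2) * 2 ^ (h : ℕ) ∧
      (∃ p : Fin k, p + 1 = (2 * q + 1) * 2 ^ (h : ℕ) ∧ p ≤ i ∧ R i ≤ x p) ∧
      (∀ p : Fin k, (p : ℕ) + 1 ≤ 2 * q * 2 ^ (h : ℕ) → x p < R i) ∧
      ∃ a : ℤ, a * μ < R i ∧ x i < (a + 1) * μ ∧ (a + 1) * μ ≤ D i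

/-- The groups of a type are ordered by deadlines or by release times. -/
def mode : VisitType J H → Bool
  | .inl _ => true
  | .inr (.inl (_, b)) => b
  | .inr (.inr (_, b)) => b

variable {R D x μ}

/-- Choose the last level before the first one at which the window fails to contain the dyadic cell
of the visit time. The parent cell sticks out of the window, and since the cell itself does not, the
parity of its number tells at which end. -/
theorem exists_fits_of_inCell (hμ : 0 < μ) {i : Fin k} (hJ : D i - R i < 2 ^ J * μ) {c : ℤ}
    (hc : InCell R D x μ c i) : ∃ (t : VisitType J H) (γ : ℚ), Fits R D x μ t γ i := by
  classical
  have hex : ∃ j, ¬ ∃ c : ℤ, InCell R D x (2 ^ j * μ) c i := by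
    -- A cell of level `J` is longer than the window.
    refine ⟨J, ?_⟩
    rintro ⟨c, -, -, h₁, h₂⟩
    linarith
  obtain ⟨j, hj⟩ : ∃ j, Nat.find hex = j + 1 := by
    refine Nat.exists_eq_succ_of_ne_zero fun h0 => ?_
    have := Nat.find_spec hex
    rw [h0] at this
    exact this ⟨c, by simpa using hc⟩
  have hspec := Nat.find_spec hex
  rw [hj] at hspec
  obtain ⟨c, h₁, h₂, h₃, h₄⟩ := not_not.1 (Nat.find_min hex (m := j) (by omega))
  have hS : 0 < 2 ^ j * μ := by positivity
  have hjJ : j < J := by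
    by_contra hle
    have : (2 : ℚ) ^ J * μ ≤ 2 ^ j * μ := by
      gcongr
      · norm_num
      · omega
    linarith
  have hS2 : (2 : ℚ) ^ (j + 1) * μ = 2 * (2 ^ j * μ) := by ring
  rw [hS2] at hspec
  set S := (2 : ℚ) ^ j * μ with hSdef
  rcases Int.even_or_odd c with hev | hodd
  · refine ⟨.inr (.inl (⟨j, hjJ⟩, true)), c, c, rfl, ⟨h₁, h₂, h₃, h₄⟩, hev, ?_⟩
    obtain ⟨b, rfl⟩ := hev
    by_contra hlt
    push_cast at *
    exact hspec ⟨b, by linarith, by linarith, by linarith, by linarith⟩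
  · refine ⟨.inr (.inl (⟨j, hjJ⟩, false)), c, c, rfl, ⟨h₁, h₂, h₃, h₄⟩, hodd, ?_⟩
    obtain ⟨b, rfl⟩ := hodd
    by_contra hlt
    push_cast at *
    exact hspec ⟨b, by linarith, by linarith, by linarith, by linarith⟩

/-- With `a = ⌊x i / μ⌋`, a window of positive length ends inside the basic cell `a`, contains it,
or begins inside it. In the first case its length, at least `μ`, forces it to cover the left end of
the cell. -/
theorem exists_fits (hR : ∀ i, R i ≤ x i) (hD : ∀ i, x i ≤ D i) (hx : Monotone x) (hμ : 0 < μ)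
    (hlen : ∀ i, D i = R i ∨ μ ≤ D i - R i) (hJ : ∀ i, D i - R i < 2 ^ J * μ) (hH : k < 2 ^ H)
    (i : Fin k) : ∃ (t : VisitType J H) (γ : ℚ), Fits R D x μ t γ i := by
  classical
  rcases hlen i with h0 | hpos
  · exact ⟨.inl (), x i, h0, rfl⟩
  have ha₁ : ⌊x i / μ⌋ * μ ≤ x i := (le_div_iff₀ hμ).1 (Int.floor_le _)
  have ha₂ : x i < (⌊x i / μ⌋ + 1) * μ := (div_lt_iff₀ hμ).1 (Int.lt_floor_add_one _)
  have hlevel : ∀ h q : ℕ, (2 * q + 1) * 2 ^ h ≤ k → h < H := by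
    intro h q hle
    -- The number `(2q + 1) * 2 ^ h` is a position, so `2 ^ h ≤ k < 2 ^ H`.
    refine (Nat.pow_lt_pow_iff_right (a := 2) (by norm_num)).1 (lt_of_le_of_lt ?_ hH)
    nlinarith [Nat.zero_le (2 * q * 2 ^ h)]
  by_cases hd : D i < (⌊x i / μ⌋ + 1) * μ
  · obtain ⟨e, he, hmax⟩ := (Finset.univ.filter fun p : Fin k => x p ≤ D i).exists_max_image id
      ⟨i, by simp [hD]⟩
    simp only [Finset.mem_filter, Finset.mem_univ, true_and, id_eq] at he hmax
    -- Positions are shifted by one because dyadic levels are defined for positive numbers only.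
    obtain ⟨h, q, h₁, h₂, h₃, h₄⟩ := Nat.exists_dyadic (b := i + 1) (e := e + 1) (by omega)
      (by have := hmax i (hD i); simpa using this)
    have hp := e.isLt
    have hpos' : 0 < (2 * q + 1) * 2 ^ h := by positivity
    refine ⟨.inr (.inr (⟨h, hlevel h q (by omega)⟩, true)), q, q, rfl, h₁,
      ⟨⟨(2 * q + 1) * 2 ^ h - 1, by omega⟩, by simp; omega, ?_, ?_⟩, ?_, ⌊x i / μ⌋, ha₁, hd, ?_⟩
    · rw [Fin.le_def]; simp; omega
    · exact (hx (by rw [Fin.le_def]; simp; omega)).trans he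
    · intro p hp
      by_contra hlt
      have := hmax p (not_lt.1 hlt)
      rw [Fin.le_def] at this
      simp only at hp
      omega
    · linarith
  · by_cases hr : R i ≤ ⌊x i / μ⌋ * μ
    · exact exists_fits_of_inCell hμ (hJ i) ⟨ha₁, ha₂, hr, not_lt.1 hd⟩
    · obtain ⟨b, hb, hmin⟩ := (Finset.univ.filter fun p : Fin k => R i ≤ x p).exists_min_image id
        ⟨i, by simp [hR]⟩
      simp only [Finset.mem_filter, Finset.mem_univ, true_and, id_eq] at hb hmin
      obtain ⟨h, q, h₁, h₂, h₃, h₄⟩ := Nat.exists_dyadic (b := b + 1) (e := i + 1) (by omega)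
        (by have := hmin i (hR i); simpa using this)
      have hp := i.isLt
      have hpos' : 0 < (2 * q + 1) * 2 ^ h := by positivity
      refine ⟨.inr (.inr (⟨h, hlevel h q (by omega)⟩, false)), q, q, rfl, h₄,
        ⟨⟨(2 * q + 1) * 2 ^ h - 1, by omega⟩, by simp; omega, ?_, ?_⟩, ?_, ⌊x i / μ⌋, not_le.1 hr,
          ha₂, not_lt.1 hd⟩
      · rw [Fin.le_def]; simp; omega
      · exact hb.trans (hx (by rw [Fin.le_def]; simp; omega))
      · intro p hp
        by_contra hlt
        have := hmin p (not_lt.1 hlt)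
        rw [Fin.le_def] at this
        simp only at hp
        omega

/-- Visits in the same dyadic cell have all their windows around that cell. Visits with the same
dyadic position `p` lie on one side of `p` and reach up to `x p` with their windows, while the basic
cell controls the opposite ends. For different groups, an intermediate time separates the keys. -/
theorem Fits.spec (hR : ∀ i, R i ≤ x i) (hD : ∀ i, x i ≤ D i) (hx : Monotone x) (hμ : 0 < μ)
    {t : VisitType J H} {γ γ' : ℚ} {i j : Fin k} (hij : i ≤ j) (hi : Fits R D x μ t γ i)
    (hj : Fits R D x μ t γ' j) :
    γ ≤ γ' ∧ (γ = γ' → R j ≤ x i ∧ x j ≤ D i) ∧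
      (γ < γ' → cond t.mode (D i) (R i) < cond t.mode (D j) (R j)) := by
  have hxij := hx hij
  rcases t with ⟨⟩ | ⟨l, b⟩ | ⟨h, b⟩
  · obtain ⟨h₁, rfl⟩ := hi
    obtain ⟨h₂, rfl⟩ := hj
    have := hR i; have := hR j; have := hD i; have := hD j
    refine ⟨hxij, fun h => ⟨by linarith, by linarith⟩, fun h => ?_⟩
    change D i < D j
    linarith
  · have hS : (0 : ℚ) < 2 ^ (l : ℕ) * μ := by positivity
    have key : ∀ c c' : ℤ, InCell R D x (2 ^ (l : ℕ) * μ) c i →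
        InCell R D x (2 ^ (l : ℕ) * μ) c' j → c ≤ c' := by
      intro c c' hc hc'
      have : (c : ℚ) < c' + 1 := lt_of_mul_lt_mul_right
        (hc.1.trans_lt (hxij.trans_lt hc'.2.1)) hS.le
      have : c < c' + 1 := by exact_mod_cast this
      omega
    cases b with
    | true =>
      obtain ⟨c, rfl, hc, hev, hlt⟩ := hi
      obtain ⟨c', rfl, hc', hev', hlt'⟩ := hj
      refine ⟨by exact_mod_cast key c c' hc hc', fun h => ?_, fun h => ?_⟩
      · obtain rfl : c = c' := by exact_mod_cast h
        exact ⟨hc'.2.2.1.trans hc.1, hc'.2.1.le.trans hc.2.2.2⟩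
      · have h' : c < c' := by exact_mod_cast h
        -- Cells of equal parity are at least two apart, so the parent of the earlier one ends
        -- before the later one begins.
        have h₂ : c + 2 ≤ c' := by
          obtain ⟨a, rfl⟩ := hev
          obtain ⟨a', rfl⟩ := hev'
          omega
        have h₃ : (c : ℚ) + 2 ≤ c' := by exact_mod_cast h₂
        have h₄ := mul_le_mul_of_nonneg_right h₃ hS.le
        have h₅ := hc'.2.2.2
        change D i < D j
        linarith
    | false =>
      obtain ⟨c, rfl, hc, hev, hlt⟩ := hi
      obtain ⟨c', rfl, hc', hev', hlt'⟩ := hj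
      refine ⟨by exact_mod_cast key c c' hc hc', fun h => ?_, fun h => ?_⟩
      · obtain rfl : c = c' := by exact_mod_cast h
        exact ⟨hc'.2.2.1.trans hc.1, hc'.2.1.le.trans hc.2.2.2⟩
      · have h' : c < c' := by exact_mod_cast h
        have h₂ : c + 2 ≤ c' := by
          obtain ⟨a, rfl⟩ := hev
          obtain ⟨a', rfl⟩ := hev'
          omega
        have h₃ : (c : ℚ) + 2 ≤ c' := by exact_mod_cast h₂
        have h₄ := mul_le_mul_of_nonneg_right h₃ hS.le
        have h₅ := hc.2.2.1
        change R i < R j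
        linarith
  · have hP : 0 < 2 ^ (h : ℕ) := by positivity
    have hij' : (i : ℕ) ≤ j := hij
    have cast : ∀ a c : ℤ, a * μ < (c + 1) * μ → a ≤ c := by
      intro a c hac
      have : (a : ℚ) < c + 1 := lt_of_mul_lt_mul_right hac hμ.le
      have : a < c + 1 := by exact_mod_cast this
      omega
    cases b with
    | true =>
      obtain ⟨q, rfl, h₁, ⟨p, hp, hip, hxp⟩, hlast, a, ha₁, ha₂, ha₃⟩ := hi
      obtain ⟨q', rfl, h₁', ⟨p', hp', hip', hxp'⟩, hlast', a', ha₁', ha₂', ha₃'⟩ := hj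
      have hip'' : (j : ℕ) ≤ p' := hip'
      have hlt : q < q' + 1 := by
        have : 2 * q * 2 ^ (h : ℕ) < 2 * (q' + 1) * 2 ^ (h : ℕ) := by nlinarith
        have := lt_of_mul_lt_mul_right this hP.le
        omega
      refine ⟨by exact_mod_cast Nat.lt_succ_iff.1 hlt, fun h => ?_, fun h => ?_⟩
      · obtain rfl : q = q' := by exact_mod_cast h
        obtain rfl : p = p' := by ext; omega
        have hxjp := hx hip'
        refine ⟨?_, by linarith⟩
        -- The chain `a' * μ ≤ x j ≤ x p ≤ D i < (a + 1) * μ` shows that the later visit is in no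
        -- later basic cell, so its release precedes `x i`.
        have haa := cast a' a (by linarith)
        have : (a' : ℚ) ≤ a := by exact_mod_cast haa
        have := mul_le_mul_of_nonneg_right this hμ.le
        linarith
      · have hqq : q + 1 ≤ q' := by exact_mod_cast h
        -- Position `j + 1` exceeds `2 * q' * 2 ^ h`, which is at least `(2 * q + 2) * 2 ^ h`, so
        -- visit `j` comes after the deadline of `i`.
        have := hlast j (by nlinarith)
        change D i < D j
        exact this.trans_le (hD j)
    | false =>
      obtain ⟨q, rfl, h₁, ⟨p, hp, hip, hxp⟩, hfirst, a, ha₁, ha₂, ha₃⟩ := hi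
      obtain ⟨q', rfl, h₁', ⟨p', hp', hip', hxp'⟩, hfirst', a', ha₁', ha₂', ha₃'⟩ := hj
      have hip'' : (p : ℕ) ≤ i := hip
      have hlt : q < q' + 1 := by
        have : 2 * q * 2 ^ (h : ℕ) < 2 * (q' + 1) * 2 ^ (h : ℕ) := by nlinarith
        have := lt_of_mul_lt_mul_right this hP.le
        omega
      refine ⟨by exact_mod_cast Nat.lt_succ_iff.1 hlt, fun h => ?_, fun h => ?_⟩
      · obtain rfl : q = q' := by exact_mod_cast h
        obtain rfl : p = p' := by ext; omega
        have hxpi := hx hip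
        refine ⟨by linarith, ?_⟩
        -- Here `a' * μ < R j ≤ x p ≤ x i < (a + 1) * μ`, so `x j < (a' + 1) * μ ≤ (a + 1) * μ ≤ D
        -- i`.
        have haa := cast a' a (by linarith)
        have : (a' : ℚ) ≤ a := by exact_mod_cast haa
        have := mul_le_mul_of_nonneg_right this hμ.le
        linarith
      · have hqq : q + 1 ≤ q' := by exact_mod_cast h
        have := hfirst' i (by nlinarith)
        change R i < R j
        exact (hR i).trans_lt this

end VisitType

/-! ### Cutting the visits of a walk into groups -/

theorem List.exists_groups {β : Type} (g : β → ℚ) (l : List β)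
    (h : l.Pairwise fun a b => g a ≤ g b) :
    ∃ gs : List (List β), gs.flatten = l ∧ (∀ G ∈ gs, G ≠ [] ∧ ∀ a ∈ G, ∀ b ∈ G, g a = g b) ∧
      gs.Pairwise fun G G' => ∀ a ∈ G, ∀ b ∈ G', g a < g b := by
  induction l with
  | nil => exact ⟨[], by simp⟩
  | cons a l ih =>
    obtain ⟨h₁, h₂⟩ := List.pairwise_cons.1 h
    obtain ⟨gs, k₁, k₂, k₃⟩ := ih h₂
    rcases gs with - | ⟨G, gs⟩
    · simp only [List.flatten_nil] at k₁
      exact ⟨[[a]], by simp [← k₁]⟩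
    obtain ⟨hne, hG⟩ := k₂ G (by simp)
    obtain ⟨b, hb⟩ := List.exists_mem_of_ne_nil G hne
    have hbl : b ∈ l := by rw [← k₁]; simp [hb]
    obtain ⟨k₄, k₅⟩ := List.pairwise_cons.1 k₃
    rcases (h₁ b hbl).eq_or_lt with heq | hlt
    · have hG' : ∀ c ∈ a :: G, g c = g b := by
        intro c hc
        rcases List.mem_cons.1 hc with rfl | hc
        · exact heq
        · exact hG c hc b hb
      refine ⟨(a :: G) :: gs, by simp [← k₁], ?_, ?_⟩
      · intro G' hG''
        rcases List.mem_cons.1 hG'' with rfl | hG''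
        · exact ⟨by simp, fun c hc d hd => (hG' c hc).trans (hG' d hd).symm⟩
        · exact k₂ G' (by simp [hG''])
      · refine List.pairwise_cons.2 ⟨fun G' hG'' c hc d hd => ?_, k₅⟩
        rw [hG' c hc]
        exact k₄ G' hG'' b hb d hd
    · refine ⟨[a] :: G :: gs, by simp [← k₁], ?_, ?_⟩
      · intro G' hG''
        rcases List.mem_cons.1 hG'' with rfl | hG''
        · simp
        · exact k₂ G' hG''
      · refine List.pairwise_cons.2 ⟨fun G' hG'' c hc d hd => ?_, k₃⟩
        obtain rfl : c = a := by simpa using hc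
        rcases List.mem_cons.1 hG'' with rfl | hG''
        · rw [hG d hd b hb]; exact hlt
        · exact hlt.trans (k₄ G' hG'' b hb d hd)

/-- A vertex may be visited several times inside its window; this selects one visit for each
rewarded vertex. -/
theorem List.exists_sublist_nodup_map {β γ : Type} [DecidableEq γ] (f : β → γ) (l : List β) :
    ∃ l' : List β, l'.Sublist l ∧ (l'.map f).Nodup ∧ (l'.map f).toFinset = (l.map f).toFinset := by
  induction l with
  | nil => exact ⟨[], by simp⟩
  | cons a l ih =>
    obtain ⟨l', h₁, h₂, h₃⟩ := ih
    by_cases ha : f a ∈ l'.map f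
    · refine ⟨l', h₁.cons a, h₂, ?_⟩
      rw [List.map_cons, List.toFinset_cons, ← h₃, Finset.insert_eq_of_mem (List.mem_toFinset.2 ha)]
    · exact ⟨a :: l', h₁.cons_cons a, List.nodup_cons.2 ⟨ha, h₂⟩, by simp [h₃]⟩

theorem List.length_le_length_flatten {β : Type} (gs : List (List β)) (h : ∀ G ∈ gs, G ≠ []) :
    gs.length ≤ gs.flatten.length := by
  induction gs with
  | nil => simp
  | cons G gs ih =>
    have h₁ := ih fun G' h' => h G' (by simp [h'])
    have h₂ := List.length_pos_iff.2 (h G (by simp))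
    rw [List.flatten_cons, List.length_append, List.length_cons]
    omega

namespace TWInst

variable {I : TWInst} {W : List (Fin I.n × ℚ)}

namespace Feasible

theorem travel (h : I.Feasible W) : W.Pairwise I.toWGraph.Travel := by
  have : Trans I.toWGraph.Travel I.toWGraph.Travel I.toWGraph.Travel :=
    ⟨fun h h' => WGraph.Travel.trans h h'⟩
  refine List.isChain_iff_pairwise.1 (h.edges.imp ?_)
  rintro a b ⟨c, hc, hle⟩
  obtain ⟨d, hd, hd'⟩ := WGraph.exists_dist_of_walk (G := I.toWGraph) (u := a.1) (v := b.1)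
    (W := [a.1, b.1]) ⟨rfl, rfl, by simp [hc]⟩
  have : I.toWGraph.walkLength [a.1, b.1] = c := by
    rw [WGraph.walkLength_cons_cons, hc]
    simp [WGraph.walkLength]
  exact ⟨d, hd, by linarith⟩

theorem travel_start (h : I.Feasible W) {a : Fin I.n × ℚ} (ha : a ∈ W) :
    I.toWGraph.Travel (I.s, 0) a := by
  obtain ⟨τ, hτ, h0⟩ := h.start
  have hs : I.toWGraph.Travel (I.s, 0) (I.s, τ) := ⟨0, WGraph.dist_self _, by simpa using h0⟩
  have htr := h.travel
  cases W with
  | nil => simp at hτ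
  | cons b W =>
    obtain rfl : b = (I.s, τ) := by simpa using hτ
    rcases List.mem_cons.1 ha with rfl | ha
    · exact hs
    · exact hs.trans ((List.pairwise_cons.1 htr).1 a ha)

theorem travel_target (h : I.Feasible W) {a : Fin I.n × ℚ} (ha : a ∈ W) :
    I.toWGraph.Travel a (I.t, I.T) := by
  obtain ⟨τ, hτ, hle⟩ := h.finish
  have hs : I.toWGraph.Travel (I.t, τ) (I.t, I.T) := ⟨0, WGraph.dist_self _, by simpa using hle⟩
  have htr := h.travel
  obtain ⟨W', rfl⟩ := List.getLast?_eq_some_iff.1 hτ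
  rcases List.mem_append.1 ha with ha | ha
  · exact ((List.pairwise_append.1 htr).2.2 a ha _ (by simp)).trans hs
  · obtain rfl : a = (I.t, τ) := by simpa using ha
    exact hs

theorem travel_start_target (h : I.Feasible W) : I.toWGraph.Travel (I.s, 0) (I.t, I.T) := by
  obtain ⟨τ, hτ, -⟩ := h.start
  have hm := List.mem_of_mem_head? (Option.mem_def.2 hτ)
  exact (h.travel_start hm).trans (h.travel_target hm)

end Feasible

/-- The visits of a feasible walk contain a large chain of groups. -/
theorem exists_isGroupChain (hW : I.Feasible W) {μ : ℚ} {J H : ℕ} (hμ : 0 < μ)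
    (hlen : ∀ v, I.D v = I.R v ∨ μ ≤ I.D v - I.R v) (hJ : ∀ v, I.D v - I.R v < 2 ^ J * μ)
    (hH : I.reward W < 2 ^ H) :
    ∃ (m : Bool) (gs : List (List (Fin I.n × ℚ))), I.IsGroupChain m gs ∧ gs.length ≤ I.n ∧
      (∀ G ∈ gs, G.length ≤ I.reward W) ∧ (∀ a ∈ gs.flatten, a ∈ W) ∧
      (I.reward W : ℝ) ≤ (1 + 2 * J + 2 * H) * gs.flatten.length := by
  obtain ⟨l, hl, hnd, hset⟩ := List.exists_sublist_nodup_map Prod.fst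
    (W.filter fun a => I.R a.1 ≤ a.2 ∧ a.2 ≤ I.D a.1)
  have hk : l.length = I.reward W := by
    rw [reward, ← hset, List.toFinset_card_of_nodup hnd, List.length_map]
  have hmem : ∀ a ∈ l, a ∈ W ∧ I.R a.1 ≤ a.2 ∧ a.2 ≤ I.D a.1 := fun a ha => by
    simpa using hl.subset ha
  have htr : l.Pairwise I.toWGraph.Travel :=
    hW.travel.sublist (hl.trans List.filter_sublist)
  have htr' := List.pairwise_iff_get.1 htr
  let x : Fin l.length → ℚ := fun i => (l.get i).2
  let R : Fin l.length → ℚ := fun i => I.R (l.get i).1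
  let D : Fin l.length → ℚ := fun i => I.D (l.get i).1
  have hR : ∀ i, R i ≤ x i := fun i => (hmem _ (List.get_mem l i)).2.1
  have hD : ∀ i, x i ≤ D i := fun i => (hmem _ (List.get_mem l i)).2.2
  have hx : Monotone x := monotone_iff_forall_lt.2 fun i j hij => (htr' i j hij).le
  choose t γ hfit using VisitType.exists_fits (J := J) (H := H) hR hD hx hμ
    (fun i => hlen (l.get i).1) (fun i => hJ (l.get i).1) (by omega)
  -- Pigeonhole over the types: some type has at least the average number of visits.
  obtain ⟨t₀, ht₀⟩ := Fintype.exists_le_card_fiber_of_nsmul_le_card t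
    (b := (l.length : ℝ) / (1 + 2 * J + 2 * H)) (by
      have : Fintype.card (VisitType J H) = 1 + 2 * J + 2 * H := by
        simp [VisitType]
        ring
      rw [this, nsmul_eq_mul, Fintype.card_fin]
      push_cast
      rw [mul_div_cancel₀]
      positivity)
  let is := (List.finRange l.length).filter fun i => t i = t₀
  have his : is.Pairwise fun i j => i < j :=
    (List.pairwise_lt_finRange _).sublist List.filter_sublist
  have hist : ∀ i ∈ is, t i = t₀ := fun i hi => by simpa [is] using hi
  have hspec : ∀ i ∈ is, ∀ j ∈ is, i ≤ j → γ i ≤ γ j ∧ (γ i = γ j → R j ≤ x i ∧ x j ≤ D i) ∧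
      (γ i < γ j → cond t₀.mode (D i) (R i) < cond t₀.mode (D j) (R j)) := fun i hi j hj hij =>
    VisitType.Fits.spec hR hD hx hμ hij (hist i hi ▸ hfit i) (hist j hj ▸ hfit j)
  obtain ⟨gs, h₁, h₂, h₃⟩ := List.exists_groups γ is
    (his.imp_of_mem fun {i j} hi hj hij => (hspec i hi j hj hij.le).1)
  have hin : ∀ G ∈ gs, ∀ i ∈ G, i ∈ is := fun G hG i hi => by
    rw [← h₁]; exact List.mem_flatten.2 ⟨G, hG, hi⟩
  have hflat : (gs.map (List.map l.get)).flatten = is.map l.get := by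
    rw [← h₁, List.map_flatten]
  have hsub : (is.map l.get).Sublist l := by
    have := (List.filter_sublist (p := fun i => t i = t₀) (l := List.finRange l.length)).map l.get
    rwa [List.map_get_finRange] at this
  have hndf : ((is.map l.get).map Prod.fst).Nodup := hnd.sublist (hsub.map _)
  have hGsub : ∀ G ∈ gs.map (List.map l.get), G.Sublist (is.map l.get) := fun G hG => by
    rw [← hflat]; exact List.sublist_flatten_of_mem hG
  have hne : ∀ G ∈ gs.map (List.map l.get), G ≠ [] := by
    intro G hG
    obtain ⟨G', hG', rfl⟩ := List.mem_map.1 hG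
    simpa using (h₂ G' hG').1
  refine ⟨t₀.mode, gs.map (List.map l.get), ⟨hne, ?_, ?_, ?_, ?_⟩, ?_, ?_, ?_, ?_⟩
  · intro G hG
    exact hndf.sublist ((hGsub G hG).map _)
  · rw [hflat]
    exact htr.sublist hsub
  · intro G hG a ha b hb
    obtain ⟨G', hG', rfl⟩ := List.mem_map.1 hG
    obtain ⟨i, hi, rfl⟩ := List.mem_map.1 ha
    obtain ⟨j, hj, rfl⟩ := List.mem_map.1 hb
    have hγ := (h₂ G' hG').2 i hi j hj
    rcases le_total i j with hij | hij
    · have := (hspec i (hin G' hG' i hi) j (hin G' hG' j hj) hij).2.1 hγ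
      exact ⟨(hR i).trans (hx hij), this.2⟩
    · have := (hspec j (hin G' hG' j hj) i (hin G' hG' i hi) hij).2.1 hγ.symm
      exact ⟨this.1, (hx hij).trans (hD i)⟩
  · rw [List.pairwise_map]
    refine h₃.imp_of_mem ?_
    intro G G' hG hG' hlt a ha b hb
    obtain ⟨i, hi, rfl⟩ := List.mem_map.1 ha
    obtain ⟨j, hj, rfl⟩ := List.mem_map.1 hb
    have hi' := hin G hG i hi
    have hj' := hin G' hG' j hj
    have hij : i ≤ j := by
      by_contra h
      have := (hspec j hj' i hi' (not_le.1 h).le).1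
      exact absurd (hlt i hi j hj) (not_lt.2 this)
    have := (hspec i hi' j hj' hij).2.2 (hlt i hi j hj)
    cases hm : t₀.mode <;> rw [hm] at this <;> exact this
  · refine (List.length_le_length_flatten _ hne).trans ?_
    rw [hflat]
    have := hndf.length_le_card
    simpa using this
  · intro G hG
    rw [← hk]
    exact ((hGsub G hG).trans hsub).length_le
  · intro a ha
    rw [hflat] at ha
    exact (hmem a (hsub.subset ha)).1
  · have hcard : is.length = (Finset.univ.filter fun i => t i = t₀).card := by
      rw [← List.toFinset_card_of_nodup (his.imp fun h => h.ne)]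
      congr 1
      ext i
      simp [is]
    rw [hflat, List.length_map, hcard, ← hk]
    rwa [div_le_iff₀ (by positivity), mul_comm] at ht₀

end TWInst

/-! ### The reduction -/

/-- The scale is the shortest positive window length. If there is none, all visits are of the
zero-length type and any positive scale will do. -/
theorem TWInst.exists_scale (I : TWInst) : ∃ μ : ℚ, 0 < μ ∧
    (∀ v, I.D v = I.R v ∨ μ ≤ I.D v - I.R v) ∧ (∀ v, I.D v - I.R v ≤ I.L * μ) ∧ 1 ≤ I.L := by
  have hmem : ∀ v, I.D v = I.R v ∨ I.D v - I.R v ∈ I.posLengths := by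
    intro v
    rcases (sub_nonneg.2 (I.window v)).eq_or_lt with h | h
    · exact .inl (by linarith)
    · exact .inr (by simp [posLengths, h])
  unfold TWInst.L
  split_ifs with hne
  · have hpos : 0 < I.posLengths.min' hne :=
      (Finset.mem_filter.1 (Finset.min'_mem _ hne)).2
    have hle : I.posLengths.min' hne ≤ I.posLengths.max' hne := Finset.min'_le_max' _ hne
    refine ⟨I.posLengths.min' hne, hpos, fun v => ?_, fun v => ?_, (one_le_div hpos).2 hle⟩
    · exact (hmem v).imp_right fun h => Finset.min'_le _ _ h
    · rw [div_mul_cancel₀ _ hpos.ne']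
      rcases hmem v with h | h
      · rw [h]; linarith
      · exact Finset.le_max' _ _ h
  · rw [Finset.not_nonempty_iff_eq_empty] at hne
    have h0 : ∀ v, I.D v = I.R v := fun v => (hmem v).resolve_right (by simp [hne])
    exact ⟨1, one_pos, fun v => .inl (h0 v), fun v => by simp [h0 v], le_rfl⟩

/-- The constant comes from `log 2 > 2/3`. -/
theorem Nat.log_two_le_mul_log {m : ℕ} (hm : 0 < m) {y : ℝ} (hy : (m : ℝ) ≤ y) :
    (Nat.log 2 m : ℝ) ≤ 3 / 2 * Real.log y := by
  have h₁ : (Nat.log 2 m : ℝ) ≤ Real.logb 2 m := by exact_mod_cast Real.natLog_le_logb m 2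
  have hm' : (1 : ℝ) ≤ m := by exact_mod_cast hm
  have h₂ : Real.log m ≤ Real.log y := Real.log_le_log (by linarith) hy
  have h₃ : 0 ≤ Real.log m := Real.log_nonneg hm'
  have h₄ := Real.log_two_gt_d9
  have h₅ : Real.logb 2 m ≤ 3 / 2 * Real.log m := by
    rw [Real.logb, div_le_iff₀ (by linarith)]
    nlinarith
  linarith

theorem TWInst.reward_le (I : TWInst) (W : List (Fin I.n × ℚ)) : I.reward W ≤ I.n :=
  (Finset.card_le_univ _).trans (by simp)

/-- The algorithm is good if `O` is. -/
theorem TWInst.solve_approx {I : TWInst} {O : (J : OrientInst) → List (Fin J.n)} {κ : GraphKind}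
    (hO : ∀ J : OrientInst, κ.Allows J.toWGraph → (∃ W, J.Feasible W) → J.Feasible (O J))
    (hI : κ.Allows I.toWGraph) {W : List (Fin I.n × ℚ)} (hW : I.Feasible W) {a : ℝ} (ha : 1 ≤ a)
    (hK : ∀ J : OrientInst, κ.Allows J.toWGraph → J.n = I.n → ∀ W', J.Feasible W' →
      W'.toFinset.card ≤ I.reward W → (W'.toFinset.card : ℝ) ≤ a * (O J).toFinset.card) :
    I.Feasible (I.solve O) ∧ (I.reward W : ℝ) ≤ 16 * a *
      max 1 (max (Real.log (I.reward W)) (Real.log (I.L : ℝ))) * I.reward (I.solve O) := by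
  obtain ⟨μ, hμ, hlen, hL, hL1⟩ := I.exists_scale
  have ha0 : 0 < a := by linarith
  have hfloor : 0 < ⌊I.L⌋₊ := Nat.floor_pos.2 hL1
  have hJ : ∀ v, I.D v - I.R v < 2 ^ (Nat.log 2 ⌊I.L⌋₊ + 1) * μ := by
    intro v
    refine (hL v).trans_lt (mul_lt_mul_of_pos_right ?_ hμ)
    have h₁ := Nat.lt_pow_succ_log_self (b := 2) (by norm_num) ⌊I.L⌋₊
    have h₂ := Nat.lt_floor_add_one I.L
    have h₃ : (⌊I.L⌋₊ : ℚ) + 1 ≤ 2 ^ (Nat.log 2 ⌊I.L⌋₊ + 1) := by exact_mod_cast h₁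
    linarith
  obtain ⟨m, gs, h₁, h₂, h₃, h₄, h₅⟩ := exists_isGroupChain hW hμ hlen hJ
    (Nat.lt_pow_succ_log_self (b := 2) (by norm_num) (I.reward W))
  -- Rounding up is legitimate since the algorithm collects a whole number of vertices, and it makes
  -- every nonempty group contribute at least one.
  obtain ⟨k₁, k₂⟩ := solve_of_isGroupChain hO hI (K := fun j => ⌈(j : ℝ) / a⌉₊) h₁
    (fun G hG J hJ hn W' hW' hcard => by
      have := hK J hJ hn W' hW' (hcard ▸ h₃ G hG)
      rw [hcard] at this
      refine Nat.ceil_le.2 ((div_le_iff₀ ha0).2 (by linarith)))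
    (fun G hG => Nat.ceil_pos.2 (div_pos (by
      exact_mod_cast List.length_pos_iff.2 (h₁.ne_nil G hG)) ha0))
    h₂ (fun b hb => hW.travel_start (h₄ b hb)) (fun b hb => hW.travel_target (h₄ b hb))
    hW.travel_start_target
  refine ⟨k₁, ?_⟩
  have hsum : (gs.flatten.length : ℝ) ≤ a * I.reward (I.solve O) := by
    have hs : ∀ gs : List (List (Fin I.n × ℚ)), (gs.flatten.length : ℝ) ≤
        a * ((gs.map fun G => ⌈(G.length : ℝ) / a⌉₊).sum : ℕ) := by
      intro gs
      induction gs with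
      | nil => simp
      | cons G gs ih =>
        have h := Nat.le_ceil ((G.length : ℝ) / a)
        rw [div_le_iff₀ ha0] at h
        rw [List.flatten_cons, List.length_append, List.map_cons, List.sum_cons]
        push_cast at ih ⊢
        linarith
    refine (hs gs).trans (mul_le_mul_of_nonneg_left ?_ ha0.le)
    exact_mod_cast k₂
  set M := max 1 (max (Real.log (I.reward W)) (Real.log (I.L : ℝ))) with hM
  have hM1 : 1 ≤ M := le_max_left _ _
  rcases Nat.eq_zero_or_pos (I.reward W) with h0 | hpos
  · rw [h0, Nat.cast_zero]
    positivity
  have e₁ : (Nat.log 2 ⌊I.L⌋₊ : ℝ) ≤ 3 / 2 * M := by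
    have h₁ : (⌊I.L⌋₊ : ℝ) ≤ (I.L : ℝ) := by
      exact_mod_cast Nat.floor_le (by linarith : 0 ≤ I.L)
    have h₂ : Real.log (I.L : ℝ) ≤ M := (le_max_right _ _).trans (le_max_right _ _)
    have := Nat.log_two_le_mul_log hfloor h₁
    linarith
  have e₂ : (Nat.log 2 (I.reward W) : ℝ) ≤ 3 / 2 * M := by
    have h₂ : Real.log (I.reward W) ≤ M := (le_max_left _ _).trans (le_max_right _ _)
    have := Nat.log_two_le_mul_log hpos le_rfl
    linarith
  -- By `e₁` and `e₂` the left side is at most `5 + 6 * M`, and `M ≥ 1`.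
  have hN : (1 + 2 * ((Nat.log 2 ⌊I.L⌋₊ + 1 : ℕ) : ℝ) + 2 * ((Nat.log 2 (I.reward W) + 1 : ℕ) : ℝ))
      ≤ 16 * M := by
    push_cast
    linarith
  calc (I.reward W : ℝ) ≤ 16 * M * gs.flatten.length :=
        h₅.trans (mul_le_mul_of_nonneg_right hN (by positivity))
    _ ≤ 16 * M * (a * I.reward (I.solve O)) := by
        refine mul_le_mul_of_nonneg_left hsum (by positivity)
    _ = _ := by ring

theorem orienteering_bddAbove (κ : GraphKind) (J : (orienteering κ).Inst) :
    BddAbove {k | ∃ S, (orienteering κ).Feasible J S ∧ (orienteering κ).value J S = k} := by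
  refine ⟨J.1.n, ?_⟩
  rintro k ⟨S, -, rfl⟩
  exact (Finset.card_le_univ (List.toFinset (α := Fin J.1.n) S)).trans_eq (Fintype.card_fin _)

theorem orientTW_bddAbove (κ : GraphKind) (I : (orientTW κ).Inst) :
    BddAbove {k | ∃ S, (orientTW κ).Feasible I S ∧ (orientTW κ).value I S = k} := by
  refine ⟨I.1.n, ?_⟩
  rintro k ⟨S, -, rfl⟩
  exact I.1.reward_le S

/-- There is an absolute constant `C` such that, for directed and for undirected graphs, a
polynomial-time approximation algorithm for orienteering with ratio `α = α(n, OPT)` yields one for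
orienteering with time windows with ratio `C · α(n, OPT) · max {1, log OPT, log L}`. -/
theorem mainTheorem1 :
    ∃ C : ℝ, 0 < C ∧ ∀ (κ : GraphKind) (α : ℕ → ℕ → ℝ),
      (∀ n k, 1 ≤ α n k) →
      (∀ k, Monotone fun n => α n k) →
      (∀ n, Monotone fun k => α n k) →
      (∀ n, Monotone fun k : ℕ => (k : ℝ) / α n k) →
      (orienteering κ).HasPolyTimeApprox
        (fun I => α I.1.n ((orienteering κ).opt I)) →
      (orientTW κ).HasPolyTimeApprox
        (fun I => C * α I.1.n ((orientTW κ).opt I) *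
          max 1 (max (Real.log ((orientTW κ).opt I)) (Real.log (I.1.L : ℝ)))) := by
  classical
  refine ⟨16, by norm_num, fun κ α hα1 _ hαk hαd ⟨A, p, hA⟩ => ?_⟩
  choose y t hrun htime hsol using hA
  -- The output is decoded to a walk on feasible instances; elsewhere the empty list serves as a
  -- default.
  have hex : ∀ J : (orienteering κ).Inst, ∃ S : List (Fin J.1.n), (∃ S, J.1.Feasible S) →
      J.1.Feasible S ∧ y J = listOf .vertex S ∧
        ((orienteering κ).opt J : ℝ) ≤ α J.1.n ((orienteering κ).opt J) * S.toFinset.card := by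
    intro J
    by_cases h : ∃ S, J.1.Feasible S
    · obtain ⟨S, hS⟩ := hsol J h
      exact ⟨S, fun _ => hS⟩
    · exact ⟨[], fun h' => absurd h' h⟩
  choose S hS using hex
  let O : (J : OrientInst) → List (Fin J.n) := fun J =>
    if h : κ.Allows J.toWGraph then S ⟨J, h⟩ else []
  have hOS : ∀ J (h : κ.Allows J.toWGraph), O J = S ⟨J, h⟩ := fun J h => dif_pos h
  have hO : ∀ J : OrientInst, κ.Allows J.toWGraph → (∃ W, J.Feasible W) → J.Feasible (O J) := by
    intro J h hf
    rw [hOS J h]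
    exact (hS ⟨J, h⟩ hf).1
  have hOtime : PTime (X := {J : OrientInst // κ.Allows J.toWGraph ∧ ∃ W, J.Feasible W})
      (fun J => J.1.enc) fun J => listOf .vertex (O J.1) := by
    refine ⟨A, p, fun J => ⟨t ⟨J.1, J.2.1⟩, ?_, htime ⟨J.1, J.2.1⟩⟩⟩
    have h : y ⟨J.1, J.2.1⟩ = listOf .vertex (O J.1) :=
      (hS ⟨J.1, J.2.1⟩ J.2.2).2.1.trans (congrArg _ (hOS J.1 J.2.1).symm)
    have h' := hrun ⟨J.1, J.2.1⟩
    rw [h] at h'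
    exact h'
  obtain ⟨P, q, hP⟩ := PTime.solve (X := (orientTW κ).Inst) (Γ := fun I => I.1.enc)
    (I := fun I => I.1) hOtime (fun I => I.2) .refl
  refine ⟨P, q, fun I => ?_⟩
  obtain ⟨t', h₁, h₂⟩ := hP I
  refine ⟨_, t', h₁, h₂, fun hfeas => ?_⟩
  obtain ⟨W, hW, hopt⟩ : ∃ W, I.1.Feasible W ∧ I.1.reward W = (orientTW κ).opt I := by
    obtain ⟨W, hW⟩ := hfeas
    exact Nat.sSup_mem (s := {k | ∃ S, (orientTW κ).Feasible I S ∧ (orientTW κ).value I S = k})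
      ⟨_, W, hW, rfl⟩ (orientTW_bddAbove κ I)
  obtain ⟨k₁, k₂⟩ := TWInst.solve_approx hO I.2 hW (hα1 I.1.n ((orientTW κ).opt I)) (by
    intro J hJ hn W' hW' hle
    rw [hopt] at hle
    obtain ⟨-, -, hval⟩ := hS ⟨J, hJ⟩ ⟨W', hW'⟩
    have hle' : W'.toFinset.card ≤ (orienteering κ).opt ⟨J, hJ⟩ :=
      le_csSup (orienteering_bddAbove κ ⟨J, hJ⟩) ⟨W', hW', rfl⟩
    rw [← hOS J hJ] at hval
    set r := (orienteering κ).opt ⟨J, hJ⟩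
    replace hval : (r : ℝ) ≤ α I.1.n r * (O J).toFinset.card :=
      hval.trans_eq (congrArg (fun n => α n r * ((O J).toFinset.card : ℝ)) hn)
    have p₁ := hα1 I.1.n r
    have p₂ := hα1 I.1.n W'.toFinset.card
    -- The optimum `r` of the queried instance may exceed the size of the group, and even `OPT`.
    -- Monotonicity of `k / α(n, k)` turns the guarantee for `r` into one for the smaller walk `W'`,
    -- and monotonicity of `α` in `k` then replaces its ratio by the one at `OPT`.
    have d₁ : (W'.toFinset.card : ℝ) / α I.1.n W'.toFinset.card ≤ r / α I.1.n r := hαd I.1.n hle'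
    have d₂ : (r : ℝ) / α I.1.n r ≤ (O J).toFinset.card :=
      (div_le_iff₀ (by linarith)).2 (by linarith)
    have d₃ := (div_le_iff₀ (by linarith)).1 (d₁.trans d₂)
    have d₄ : α I.1.n W'.toFinset.card ≤ α I.1.n ((orientTW κ).opt I) := hαk I.1.n hle
    have d₅ : (0 : ℝ) ≤ (O J).toFinset.card := Nat.cast_nonneg _
    nlinarith)
  rw [hopt] at k₂
  exact ⟨I.1.solve O, k₁, rfl, k₂⟩
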